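/- Setting. Let $n,d$ be the number of observations and of covariates, $X\in\mathbb R^{n\times d}$ a deterministic feature matrix, $A\in\mathbb R^{n\times n}$ symmetric with zero diagonal, and $D$ a diagonal matrix with positive entries; $X,A,D$ are known. For $\theta\in\mathbb R^d$, $\beta\in\mathbb R$ with $\beta A+D\succ0$, one observes a single $y=X\theta+\varepsilon$ with $\varepsilon\sim\mathcal N(0,(\beta A+D)^{-1})$. Over-parametrize by $(\theta,\beta,\kappa)\in\mathbb R^{2d+1}$, where $\kappa=\beta\theta$ in the model, with log-likelihood, for every $(\theta,\beta,\kappa)$ such that $\beta A+D\succ 0$, $$LL(\theta,\beta,\kappa)=h_{\theta,\beta,\kappa}(y)-\log\int_{\mathbb R^n}e^{h_{\theta,\beta,\kappa}(z)}\,dz,\qquad h_{\theta,\beta,\kappa}(z)=-\tfrac12z^\top(\beta A+D)z+z^\top AX\kappa+z^\top DX\theta .$$ A maximum likelihood estimate (MLE) $(\hat\theta,\hat\beta,\hat\kappa)$ is a maximizer of $LL$ over this domain. For $\Theta,B>0$ let $\mathbb B=[-\Theta,\Theta]^d\times[-B,B]\times[-\Theta B,\Theta B]^d$. Theorem. Fix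 $d$ and positive constants $\Theta,B,a,c,q_{\min},q_{\max},\rho_{\min},\rho_{\max},\rho_{DAX}$, and assume that 1. the eigenvalues of $Q=\frac1nX^\top X$ lie in $[q_{\min},q_{\max}]$; 2. $\|A\|_2\le a$, $\|A\|_F^2\ge cn$, and $\lambda_{\min}\big(\frac1nX^\top A^\top(I-DX(X^\top D^2X)^{-1}X^\top D)AX\big)\ge\rho_{DAX}$; 3. for every $\beta\in(-B,B)$ the eigenvalues of $(\beta A+D)^{-1}$ lie in $(\rho_{\min},\rho_{\max})$. (a) For every $\delta>0$ there is a constant $C$, depending only on $\delta$ and the fixed constants (including $d$), such that for every true parameter $(\theta_0,\beta_0)$ with $(\theta_0,\beta_0,\kappa_0)$, $\kappa_0=\beta_0\theta_0$, in the interior of $\mathbb B$, for all sufficiently large $n$ and all $X,A,D$ as above, with probability at least $1-\delta$ the MLE exists, is unique and satisfies $\|(\hat\theta,\hat\beta,\hat\kappa)-(\theta_0,\beta_0,\kappa_0)\|_2\le C/\sqrt n$. (b) There are a step size $\eta>0$ and constants $C,K$, depending only on the fixed constants, such that for every such true parameter, with probability $1-o(1)$ as $n\to\infty$ (uniformly in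 $X,A,D$ as above), the MLE exists, is unique and, after any number $t\ge K\ln n$ of iterations, the $t$-th iterate of projected gradient descent (applied to $-\frac1nLL$, with step size $\eta$, projection onto $\mathbb B$, started at $0$) is within $C/\sqrt n$ of $(\hat\theta,\hat\beta,\hat\kappa)$ in $\ell_2$ norm; in particular its $(\theta,\beta)$-part $(\tilde\theta,\tilde\beta)$ is within $C/\sqrt n$ of $(\hat\theta,\hat\beta)$. So $O(\ln n)$ iterations suffice. (c) Each iteration is computable in polynomial time: there is one program for a real random access machine (unit-cost arithmetic operations and comparisons of reals) that, for all $n\ge1$ and $d$, all inputs $A=A^\top,D,X,y,\eta,\Theta,B$ and every current iterate with $\beta A+D\succ0$, computes the next iterate in a number of steps bounded by a fixed polynomial in $n+d$. -/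

import Mathlib

open Matrix MeasureTheory ProbabilityTheory
open scoped ENNReal

namespace DepLinReg

noncomputable section

/-! ### The model -/

/-- The known data of a linear regression with `n` dependent observations and `d` covariates:
the interaction matrix `A`, the diagonal entries of `D`, and the feature matrix `X`. -/
structure Design (n d : ℕ) where
  A : Matrix (Fin n) (Fin n) ℝ
  D : Fin n → ℝ
  X : Matrix (Fin n) (Fin d) ℝ

/-- The parameter space `ℝ^(2d+1)` of triples `(θ, β, κ)`, with the Euclidean norm. -/
abbrev Param (d : ℕ) : Type := EuclideanSpace ℝ (Fin d ⊕ Unit ⊕ Fin d)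

namespace Param

variable {d : ℕ}

/-- The vector `(θ, β, κ)`. -/
def mk (θ : Fin d → ℝ) (β : ℝ) (κ : Fin d → ℝ) : Param d :=
  WithLp.toLp 2 (Sum.elim θ (Sum.elim (fun _ => β) κ))

def theta (w : Param d) : Fin d → ℝ := fun k => w (Sum.inl k)

def beta (w : Param d) : ℝ := w (Sum.inr (Sum.inl ()))

def kappa (w : Param d) : Fin d → ℝ := fun k => w (Sum.inr (Sum.inr k))

end Param

/-- The half-widths of the box `[-Θ, Θ]^d × [-B, B] × [-Θ B, Θ B]^d`. -/
def halfWidth (d : ℕ) (Θ B : ℝ) : Fin d ⊕ Unit ⊕ Fin d → ℝ :=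
  Sum.elim (fun _ => Θ) (Sum.elim (fun _ => B) (fun _ => Θ * B))

/-- The box `[-Θ, Θ]^d × [-B, B] × [-Θ B, Θ B]^d`. -/
def paramBox (d : ℕ) (Θ B : ℝ) : Set (Param d) :=
  {w | ∀ i, |w i| ≤ halfWidth d Θ B i}

/-- The Euclidean projection onto `paramBox d Θ B`: every coordinate is clipped. -/
def projBox {d : ℕ} (Θ B : ℝ) (w : Param d) : Param d :=
  WithLp.toLp 2 (fun i => max (-halfWidth d Θ B i) (min (halfWidth d Θ B i) (w i)))

namespace Design

variable {n d : ℕ} (M : Design n d)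

/-- The precision matrix `β A + D`. -/
def precision (β : ℝ) : Matrix (Fin n) (Fin n) ℝ :=
  β • M.A + diagonal M.D

/-- The law of the responses `y = X θ + ε` with `ε ∼ N(0, (β A + D)⁻¹)`. -/
def responseLaw (θ : Fin d → ℝ) (β : ℝ) : Measure (EuclideanSpace ℝ (Fin n)) :=
  multivariateGaussian (WithLp.toLp 2 (M.X *ᵥ θ)) (M.precision β)⁻¹

/-- The matrix `(1/n) Xᵀ Aᵀ (I - D X (Xᵀ D² X)⁻¹ Xᵀ D) A X`. -/
def schurMatrix : Matrix (Fin d) (Fin d) ℝ :=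
  (1 / (n : ℝ)) • (M.Xᵀ * M.Aᵀ *
    (1 - diagonal M.D * M.X * (M.Xᵀ * (diagonal M.D) ^ 2 * M.X)⁻¹ * M.Xᵀ * diagonal M.D) *
    M.A * M.X)

/-- The standing assumptions, with explicit constants:
`‖A‖₂ ≤ a`, `‖A‖_F² ≥ c n`, eigenvalues of `Q = (1/n) XᵀX` in `[qmin, qmax]`,
eigenvalues of `(β A + D)⁻¹` in `(ρmin, ρmax)` for all `β ∈ (-B, B)`,
and least eigenvalue of `(1/n) Xᵀ Aᵀ (I - D X (Xᵀ D² X)⁻¹ Xᵀ D) A X` at least `ρDAX`.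
All matrices whose spectrum is used are symmetric. The entries of `D` are bounded above
and below by positive constants as a consequence of the condition at `β = 0`;
likewise `‖A‖₂² ≥ c` is a consequence of `‖A‖_F² ≥ c n`. -/
structure Admissible (B a c qmin qmax ρmin ρmax ρDAX : ℝ) : Prop where
  symm : M.A.IsSymm
  zero_diag : ∀ i, M.A i i = 0
  D_pos : ∀ i, 0 < M.D i
  opNorm_le : ‖Matrix.toEuclideanCLM (n := Fin n) (𝕜 := ℝ) M.A‖ ≤ a
  frobenius_ge : c * n ≤ ∑ i, ∑ j, M.A i j ^ 2
  covariates : ∀ q ∈ spectrum ℝ ((1 / (n : ℝ)) • (M.Xᵀ * M.X)), qmin ≤ q ∧ q ≤ qmax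
  covariance : ∀ β : ℝ, |β| < B →
    ∀ ρ ∈ spectrum ℝ (M.precision β)⁻¹, ρmin < ρ ∧ ρ < ρmax
  schur : ∀ r ∈ spectrum ℝ M.schurMatrix, ρDAX ≤ r

/-! ### The reparametrized log-likelihood and the maximum likelihood estimate -/

/-- `-(1/2) zᵀ (β A + D) z + zᵀ A X κ + zᵀ D X θ`. -/
def logWeight (w : Param d) (z : Fin n → ℝ) : ℝ :=
  -(1 / 2) * (z ⬝ᵥ (M.precision w.beta *ᵥ z)) + z ⬝ᵥ (M.A *ᵥ (M.X *ᵥ w.kappa))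
    + z ⬝ᵥ (diagonal M.D *ᵥ (M.X *ᵥ w.theta))

/-- The log-likelihood of `(θ, β, κ)`, given the observed responses `y`. -/
def logLik (y : Fin n → ℝ) (w : Param d) : ℝ :=
  M.logWeight w y - Real.log (∫ z : Fin n → ℝ, Real.exp (M.logWeight w z))

/-- The natural parameter domain, where `β A + D` is positive definite, so that the likelihood
is defined. -/
def paramDomain : Set (Param d) :=
  {w | (M.precision w.beta).PosDef}

/-- `w` is a maximum likelihood estimate of `(θ, β, κ)`: it maximizes the log-likelihood over
all parameters for which the likelihood is defined. -/
def IsMLE (y : Fin n → ℝ) (w : Param d) : Prop :=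
  w ∈ M.paramDomain ∧ IsMaxOn (M.logLik y) M.paramDomain w

/-- `w` is the one and only maximum likelihood estimate. -/
def IsTheMLE (y : Fin n → ℝ) (w : Param d) : Prop :=
  M.IsMLE y w ∧ ∀ w', M.IsMLE y w' → w' = w

/-! ### Projected gradient descent -/

/-- The normalized negative log-likelihood `-(1/n) LL`. -/
def objective (y : Fin n → ℝ) (w : Param d) : ℝ :=
  -(1 / (n : ℝ)) * M.logLik y w

/-- One iteration of projected gradient descent with step size `η` on the box. -/
def pgdStep (Θ B η : ℝ) (y : Fin n → ℝ) (w : Param d) : Param d :=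
  projBox Θ B (w - η • gradient (M.objective y) w)

/-- The `t`-th iterate of projected gradient descent, started at the origin. -/
def pgd (Θ B η : ℝ) (y : Fin n → ℝ) (t : ℕ) : Param d :=
  (M.pgdStep Θ B η y)^[t] 0

end Design

/-! ### A machine model for the cost of one iteration

A real random access machine with unit cost for the field operations and comparisons of reals.
A program is one fixed finite text, for all sizes of the input; it has finitely many arrays of
reals, doubly indexed by natural numbers, and `for` loops. -/

/-- Expressions for array indices and loop bounds. -/
inductive IdxExpr : Type
  | const (k : ℕ)
  | var (v : ℕ)

/-- Expressions for real numbers. -/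
inductive RealExpr : Type
  | const (k : ℤ)
  | cell (a : ℕ) (i j : IdxExpr)
  | add (e f : RealExpr)
  | sub (e f : RealExpr)
  | mul (e f : RealExpr)
  | div (e f : RealExpr)

/-- Programs. -/
inductive Prog : Type
  | skip
  | assign (a : ℕ) (i j : IdxExpr) (e : RealExpr)
  | seq (p q : Prog)
  | ifLe (e f : RealExpr) (p q : Prog)
  | forLoop (v : ℕ) (bound : IdxExpr) (body : Prog)

/-- The memory: index variables and arrays of reals. -/
structure Memory : Type where
  idx : ℕ → ℕ
  arr : ℕ → ℕ → ℕ → ℝ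

namespace Memory

def setIdx (m : Memory) (v k : ℕ) : Memory :=
  { m with idx := Function.update m.idx v k }

def setCell (m : Memory) (a i j : ℕ) (x : ℝ) : Memory :=
  { m with arr := fun a' i' j' => if a' = a ∧ i' = i ∧ j' = j then x else m.arr a' i' j' }

end Memory

def IdxExpr.eval (m : Memory) : IdxExpr → ℕ
  | .const k => k
  | .var v => m.idx v

def RealExpr.eval (m : Memory) : RealExpr → ℝ
  | .const k => (k : ℝ)
  | .cell a i j => m.arr a (i.eval m) (j.eval m)
  | .add e f => e.eval m + f.eval m
  | .sub e f => e.eval m - f.eval m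
  | .mul e f => e.eval m * f.eval m
  | .div e f => e.eval m / f.eval m

/-- The cost of evaluating an expression: one unit for every node. -/
def RealExpr.cost : RealExpr → ℕ
  | .const _ => 1
  | .cell _ _ _ => 1
  | .add e f => e.cost + f.cost + 1
  | .sub e f => e.cost + f.cost + 1
  | .mul e f => e.cost + f.cost + 1
  | .div e f => e.cost + f.cost + 1

/-- Running a program: the final memory and the number of steps. The loop `forLoop v b p` runs `p`
with `v` set to `0, 1, …, N - 1`, where `N` is the value of `b` at the entry of the loop. -/
def Prog.run : Prog → Memory → Memory × ℕ
  | .skip, m => (m, 1)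
  | .assign a i j e, m => (m.setCell a (i.eval m) (j.eval m) (e.eval m), e.cost + 1)
  | .seq p q, m =>
      ((q.run (p.run m).1).1, (p.run m).2 + (q.run (p.run m).1).2)
  | .ifLe e f p q, m =>
      open scoped Classical in
      if e.eval m ≤ f.eval m then ((p.run m).1, e.cost + f.cost + 1 + (p.run m).2)
      else ((q.run m).1, e.cost + f.cost + 1 + (q.run m).2)
  | .forLoop v b p, m =>
      Nat.rec (m, 1)
        (fun k r => ((p.run (r.1.setIdx v k)).1, r.2 + (p.run (r.1.setIdx v k)).2 + 1))
        (b.eval m)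

/-- A vector, padded by zeros. -/
def padVec {n : ℕ} (v : Fin n → ℝ) (i : ℕ) : ℝ :=
  if h : i < n then v ⟨i, h⟩ else 0

/-- The input of one iteration: the sizes `n`, `d` in the index variables 0 and 1;
`A`, `X`, `D`, `y` in the arrays 0 to 3, the numbers `η`, `Θ`, `B` in the array 4,
and the iterate `(θ, β, κ)` in the arrays 5, 6, 7. Everything else is zero. -/
def loadInput {n d : ℕ} (M : Design n d) (Θ B η : ℝ) (y : Fin n → ℝ) (w : Param d) : Memory where
  idx := fun v => if v = 0 then n else if v = 1 then d else 0
  arr := fun a i j =>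
    match a with
    | 0 => padVec (fun i' => padVec (M.A i') j) i
    | 1 => padVec (fun i' => padVec (M.X i') j) i
    | 2 => if j = 0 then padVec M.D i else 0
    | 3 => if j = 0 then padVec y i else 0
    | 4 => if j = 0 then padVec ![η, Θ, B] i else 0
    | 5 => if j = 0 then padVec w.theta i else 0
    | 6 => if i = 0 ∧ j = 0 then w.beta else 0
    | 7 => if j = 0 then padVec w.kappa i else 0
    | _ => 0

/-- The parameter `(θ, β, κ)` held in the arrays 5, 6, 7. -/
def readParam (d : ℕ) (m : Memory) : Param d :=
  Param.mk (fun k => m.arr 5 k 0) (m.arr 6 0 0) (fun k => m.arr 7 k 0)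

end

end DepLinReg

open DepLinReg

/-!
Consistency of the maximum likelihood estimate for a linear regression with dependent observations,
convergence of projected gradient descent, and the cost of its iterations.

Completing the square makes the likelihood of `w = (θ, β, κ)` the density of a Gaussian with
precision `P = β A + D` and mean `P⁻¹ (A X κ + D X θ)` (`exp_logLik`), which gives the gradient of
the objective `-(1/n) LL` in closed form (`hasGradientAt_objective`). The rest avoids Hessians. For
two parameters the inner product of the difference of the gradients with `w - w'` is, up to a factor,
the symmetrized Kullback-Leibler divergence of the two Gaussians: a trace `tr (P⁻¹ A P'⁻¹ A)` times
`(β - β')²`, plus quadratic forms in the difference of the means (`inner_gradVec_sub_self`). The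
first part is at least of order `n (β - β')²` by the bound on `‖A‖_F`; the second one, by the bound
on the Schur complement, controls `θ` and `κ` once `β` is controlled. So on the box the gradient is
strongly monotone and Lipschitz with constants `m` and `L` that do not depend on the design, and it
is injective on the whole domain (`exists_regular`).

Hence a projected gradient step of size `m / L²` is a contraction of the box. If the gradient at the
true parameter is small, then the fixed point is near the true parameter, thus in the interior of
the box; there the projection has no effect, so that the fixed point is a critical point, and
therefore the unique maximizer (`Regular.exists_isTheMLE`). The iterates converge to it
geometrically, and are within order `1 / √n` of it after order `ln n` steps.

The gradient at the true parameter is of order `1 / √n` with high probability: the likelihood ratio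
of any other parameter has expectation one, so by Markov's inequality moving the true parameter by
`1 / √n` in a coordinate direction is unlikely to raise the log-likelihood by much, while a large
partial derivative would do so, by the Lipschitz bound (`Regular.responseLaw_inner_gradVec_le`).

For the cost, a program whose loop bounds are constants or input sizes takes polynomially many steps
(`Prog.SizeBounded.exists_cost_le`). Such a program suffices: all steps are sums over index ranges
and clippings, and the inverse of `β A + D` is found by Gauss-Jordan elimination. No pivot search is
needed, as every pivot is a value of the quadratic form of the positive definite matrix at a nonzero
vector (`EliminationState.pivot_pos`).
-/

namespace DepLinReg

/-! ### The density of a Gaussian vector -/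

/-- The standard Gaussian measure on `ℝⁿ` has the product of the one-dimensional densities as its
density. -/
lemma pi_gaussianReal_eq_withDensity (n : ℕ) :
    Measure.pi (fun _ : Fin n => gaussianReal 0 1) =
      (volume : Measure (Fin n → ℝ)).withDensity
        (fun x => ENNReal.ofReal (∏ i, gaussianPDFReal 0 1 (x i))) := by
  symm
  refine (Measure.pi_eq fun s hs => ?_).symm
  have hint : ∀ i, Integrable ((s i).indicator (gaussianPDFReal 0 1)) volume := fun i =>
    (integrable_gaussianPDFReal 0 1).indicator (hs i)
  have hnn : ∀ i x, 0 ≤ (s i).indicator (gaussianPDFReal 0 1) x := fun i x =>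
    Set.indicator_nonneg (fun y _ => gaussianPDFReal_nonneg 0 1 y) x
  have h1 : ∀ x : Fin n → ℝ,
      (Set.univ.pi s).indicator (fun x => ENNReal.ofReal (∏ i, gaussianPDFReal 0 1 (x i))) x =
        ENNReal.ofReal (∏ i, (s i).indicator (gaussianPDFReal 0 1) (x i)) := by
    intro x
    by_cases hx : x ∈ Set.univ.pi s
    · rw [Set.indicator_of_mem hx]
      congr 1
      exact Finset.prod_congr rfl fun i _ => (Set.indicator_of_mem (hx i trivial) _).symm
    · rw [Set.indicator_of_notMem hx]
      simp only [Set.mem_pi, Set.mem_univ, true_implies, not_forall] at hx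
      obtain ⟨i, hi⟩ := hx
      rw [Finset.prod_eq_zero (Finset.mem_univ i) (Set.indicator_of_notMem hi _),
        ENNReal.ofReal_zero]
  have hprod : Integrable (fun x : Fin n → ℝ => ∏ i, (s i).indicator (gaussianPDFReal 0 1) (x i))
      volume := Integrable.fintype_prod hint
  rw [withDensity_apply _ (MeasurableSet.univ_pi hs), ← lintegral_indicator (MeasurableSet.univ_pi hs),
    lintegral_congr h1, ← ofReal_integral_eq_lintegral_ofReal hprod
      (Filter.Eventually.of_forall fun x => Finset.prod_nonneg fun i _ => hnn i _),
    integral_fintype_prod_volume_eq_prod,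
    ENNReal.ofReal_prod_of_nonneg fun i _ => integral_nonneg (hnn i)]
  refine Finset.prod_congr rfl fun i _ => ?_
  rw [gaussianReal_apply_eq_integral _ one_ne_zero, integral_indicator (hs i)]

/-- The density of `N(μ, P⁻¹)`, for a positive definite precision matrix `P`. -/
noncomputable def gaussianDensity {n : ℕ} (μ : Fin n → ℝ) (P : Matrix (Fin n) (Fin n) ℝ)
    (z : Fin n → ℝ) : ℝ :=
  (√(2 * Real.pi))⁻¹ ^ n * √P.det * Real.exp (-(1 / 2) * ((z - μ) ⬝ᵥ (P *ᵥ (z - μ))))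

lemma gaussianDensity_nonneg {n : ℕ} (μ : Fin n → ℝ) (P : Matrix (Fin n) (Fin n) ℝ)
    (z : Fin n → ℝ) : 0 ≤ gaussianDensity μ P z := by
  unfold gaussianDensity; positivity

lemma continuous_gaussianDensity {n : ℕ} (μ : Fin n → ℝ) (P : Matrix (Fin n) (Fin n) ℝ) :
    Continuous (gaussianDensity μ P) := by
  unfold gaussianDensity
  refine continuous_const.mul (Real.continuous_exp.comp (continuous_const.mul ?_))
  exact (continuous_id.sub continuous_const).dotProduct
    (continuous_const.matrix_mulVec (continuous_id.sub continuous_const))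

open scoped MatrixOrder in
/-- A positive definite matrix `P` is `S * S` for an invertible symmetric `S`, whose inverse is the
square root of `P⁻¹`. -/
lemma exists_sqrt_inv {n : ℕ} {P : Matrix (Fin n) (Fin n) ℝ} (hP : P.PosDef) :
    (CFC.sqrt P⁻¹).det ≠ 0 ∧ ((CFC.sqrt P⁻¹)⁻¹)ᵀ * (CFC.sqrt P⁻¹)⁻¹ = P ∧
      |(CFC.sqrt P⁻¹).det|⁻¹ = √P.det := by
  set R := CFC.sqrt P⁻¹ with hR
  have hinv : P⁻¹.PosDef := hP.inv
  have hRR : R * R = P⁻¹ := CFC.sqrt_mul_sqrt_self _ hinv.posSemidef.nonneg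
  have hRt : Rᵀ = R := by
    have : IsSelfAdjoint R := (CFC.sqrt_nonneg P⁻¹).isSelfAdjoint
    simpa [IsSelfAdjoint, star_eq_conjTranspose] using this
  have hdet : R.det * R.det = P.det⁻¹ := by
    rw [← det_mul, hRR, det_nonsing_inv, Ring.inverse_eq_inv']
  have hPd : 0 < P.det := hP.det_pos
  have hne : R.det ≠ 0 := by
    intro h
    rw [h, zero_mul] at hdet
    exact (inv_pos.2 hPd).ne hdet
  refine ⟨hne, ?_, ?_⟩
  · rw [transpose_nonsing_inv, hRt, ← Matrix.mul_inv_rev, hRR, nonsing_inv_nonsing_inv]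
    exact hPd.ne'.isUnit
  · have : P.det = (R.det)⁻¹ ^ 2 := by rw [inv_pow, pow_two, hdet, inv_inv]
    rw [this, Real.sqrt_sq_eq_abs, abs_inv]

open scoped MatrixOrder in
/-- Expectations under `N(μ, P⁻¹)` are integrals against the Gaussian density. -/
lemma lintegral_multivariateGaussian {n : ℕ} (μ : Fin n → ℝ) {P : Matrix (Fin n) (Fin n) ℝ}
    (hP : P.PosDef) {g : (Fin n → ℝ) → ℝ≥0∞} (hg : Measurable g) :
    ∫⁻ y, g (WithLp.ofLp y) ∂(multivariateGaussian (WithLp.toLp 2 μ) P⁻¹) =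
      ∫⁻ z, g z * ENNReal.ofReal (gaussianDensity μ P z) := by
  obtain ⟨hdet, hSS, hsq⟩ := exists_sqrt_inv hP
  set R := CFC.sqrt P⁻¹ with hR
  have hgm : Measurable fun x : Fin n → ℝ => g (μ + R *ᵥ x) :=
    hg.comp (by fun_prop)
  have hdm : Measurable fun x : Fin n → ℝ => ENNReal.ofReal (∏ i, gaussianPDFReal 0 1 (x i)) := by
    refine ENNReal.measurable_ofReal.comp (Finset.measurable_prod _ fun i _ => ?_)
    exact (measurable_gaussianPDFReal 0 1).comp (measurable_pi_apply i)
  have e1 : ∫⁻ y, g (WithLp.ofLp y) ∂(multivariateGaussian (WithLp.toLp 2 μ) P⁻¹) =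
      ∫⁻ x : Fin n → ℝ, g (μ + R *ᵥ x) *
        ENNReal.ofReal (∏ i, gaussianPDFReal 0 1 (x i)) := by
    have hofLp : Measurable fun y : EuclideanSpace ℝ (Fin n) => g (WithLp.ofLp y) :=
      hg.comp (by fun_prop)
    have hmap : Measurable fun x : EuclideanSpace ℝ (Fin n) =>
        WithLp.toLp 2 μ + toEuclideanCLM (𝕜 := ℝ) R x := by fun_prop
    have hcomp : Measurable fun x : EuclideanSpace ℝ (Fin n) =>
        g (WithLp.toLp 2 μ + toEuclideanCLM (𝕜 := ℝ) R x).ofLp := hofLp.comp hmap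
    rw [multivariateGaussian, ← hR, lintegral_map hofLp hmap,
      ← map_pi_eq_stdGaussian, lintegral_map hcomp (by fun_prop),
      pi_gaussianReal_eq_withDensity, lintegral_withDensity_eq_lintegral_mul _ hdm]
    · refine lintegral_congr fun x => ?_
      rw [Pi.mul_apply, mul_comm]
      rfl
    · exact hgm
  have e2 : ∀ z : Fin n → ℝ, ENNReal.ofReal |(R.det)⁻¹| *
      ENNReal.ofReal (∏ i, gaussianPDFReal 0 1 ((R⁻¹ *ᵥ (z - μ)) i)) =
        ENNReal.ofReal (gaussianDensity μ P z) := by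
    intro z
    rw [← ENNReal.ofReal_mul (abs_nonneg _), abs_inv, hsq]
    congr 1
    set u := z - μ with hu
    have hq : (R⁻¹ *ᵥ u) ⬝ᵥ (R⁻¹ *ᵥ u) = u ⬝ᵥ (P *ᵥ u) := by
      rw [← hSS, ← mulVec_mulVec, dotProduct_mulVec u, vecMul_transpose]
    have : ∏ i, gaussianPDFReal 0 1 ((R⁻¹ *ᵥ u) i) = (√(2 * Real.pi))⁻¹ ^ n *
        Real.exp (-(1 / 2) * (u ⬝ᵥ (P *ᵥ u))) := by
      simp only [gaussianPDFReal, NNReal.coe_one, mul_one, sub_zero, Finset.prod_mul_distrib,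
        Finset.prod_const, Finset.card_univ, Fintype.card_fin, ← Real.exp_sum, ← hq]
      congr 2
      rw [dotProduct, Finset.mul_sum]
      exact Finset.sum_congr rfl fun i _ => by ring
    rw [this, gaussianDensity, ← hu]
    ring
  have hdm2 : Measurable fun z : Fin n → ℝ =>
      ENNReal.ofReal (∏ i, gaussianPDFReal 0 1 ((R⁻¹ *ᵥ z) i)) := hdm.comp (by fun_prop)
  have hgm2 : Measurable fun z : Fin n → ℝ => g (μ + z) := hg.comp (by fun_prop)
  have e3 : ∀ x : Fin n → ℝ, R⁻¹ *ᵥ (toLin' R x) = x := fun x => by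
    rw [toLin'_apply, mulVec_mulVec, nonsing_inv_mul _ hdet.isUnit, one_mulVec]
  calc _ = ∫⁻ x : Fin n → ℝ, g (μ + toLin' R x) *
        ENNReal.ofReal (∏ i, gaussianPDFReal 0 1 ((R⁻¹ *ᵥ (toLin' R x)) i)) := by
        rw [e1]
        exact lintegral_congr fun x => by rw [e3, toLin'_apply]
    _ = ∫⁻ z, g (μ + z) * ENNReal.ofReal (∏ i, gaussianPDFReal 0 1 ((R⁻¹ *ᵥ z) i))
          ∂(Measure.map (toLin' R) volume) :=
        (lintegral_map (f := fun z => g (μ + z) *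
          ENNReal.ofReal (∏ i, gaussianPDFReal 0 1 ((R⁻¹ *ᵥ z) i))) (hgm2.mul hdm2)
          (LinearMap.continuous_on_pi _).measurable).symm
    _ = ∫⁻ z, g (μ + z) * (ENNReal.ofReal |(R.det)⁻¹| *
          ENNReal.ofReal (∏ i, gaussianPDFReal 0 1 ((R⁻¹ *ᵥ z) i))) := by
        rw [Real.map_matrix_volume_pi_eq_smul_volume_pi hdet, lintegral_smul_measure, smul_eq_mul,
          ← lintegral_const_mul' _ _ ENNReal.ofReal_ne_top]
        exact lintegral_congr fun z => by ring
    _ = ∫⁻ z, g (μ + (z - μ)) * (ENNReal.ofReal |(R.det)⁻¹| *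
          ENNReal.ofReal (∏ i, gaussianPDFReal 0 1 ((R⁻¹ *ᵥ (z - μ)) i))) :=
        (lintegral_sub_right_eq_self (fun z => g (μ + z) * (ENNReal.ofReal |(R.det)⁻¹| *
          ENNReal.ofReal (∏ i, gaussianPDFReal 0 1 ((R⁻¹ *ᵥ z) i)))) μ).symm
    _ = _ := lintegral_congr fun z => by rw [e2, add_sub_cancel]

lemma lintegral_gaussianDensity {n : ℕ} (μ : Fin n → ℝ) {P : Matrix (Fin n) (Fin n) ℝ}
    (hP : P.PosDef) : ∫⁻ z, ENNReal.ofReal (gaussianDensity μ P z) = 1 := by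
  have h := lintegral_multivariateGaussian μ hP (g := fun _ => 1) measurable_const
  simp only [lintegral_one, measure_univ, one_mul] at h
  exact h.symm

lemma integral_gaussianDensity {n : ℕ} (μ : Fin n → ℝ) {P : Matrix (Fin n) (Fin n) ℝ}
    (hP : P.PosDef) : ∫ z, gaussianDensity μ P z = 1 := by
  rw [integral_eq_lintegral_of_nonneg_ae
    (Filter.Eventually.of_forall (gaussianDensity_nonneg μ P))
    (continuous_gaussianDensity μ P).aestronglyMeasurable, lintegral_gaussianDensity μ hP,
    ENNReal.toReal_one]

/-! ### Quadratic forms and spectra -/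

section QuadraticForms

variable {n : ℕ}

open scoped MatrixOrder in
lemma mul_dotProduct_self_le_of_spectrum {S : Matrix (Fin n) (Fin n) ℝ} (hS : S.IsHermitian) {r : ℝ}
    (h : ∀ x ∈ spectrum ℝ S, r ≤ x) (x : Fin n → ℝ) : r * (x ⬝ᵥ x) ≤ x ⬝ᵥ (S *ᵥ x) := by
  have h1 : algebraMap ℝ (Matrix (Fin n) (Fin n) ℝ) r ≤ S :=
    (algebraMap_le_iff_le_spectrum (ha := hS)).2 h
  have h2 := (Matrix.le_iff.1 h1).dotProduct_mulVec_nonneg x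
  rw [Algebra.algebraMap_eq_smul_one, sub_mulVec, smul_mulVec, one_mulVec, star_trivial,
    dotProduct_sub, dotProduct_smul, smul_eq_mul] at h2
  linarith

open scoped MatrixOrder in
lemma dotProduct_mulVec_le_of_spectrum {S : Matrix (Fin n) (Fin n) ℝ} (hS : S.IsHermitian) {r : ℝ}
    (h : ∀ x ∈ spectrum ℝ S, x ≤ r) (x : Fin n → ℝ) : x ⬝ᵥ (S *ᵥ x) ≤ r * (x ⬝ᵥ x) := by
  have h1 : S ≤ algebraMap ℝ (Matrix (Fin n) (Fin n) ℝ) r :=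
    (le_algebraMap_iff_spectrum_le (ha := hS)).2 h
  have h2 := (Matrix.le_iff.1 h1).dotProduct_mulVec_nonneg x
  rw [Algebra.algebraMap_eq_smul_one, sub_mulVec, smul_mulVec, one_mulVec, star_trivial,
    dotProduct_sub, dotProduct_smul, smul_eq_mul] at h2
  linarith

open scoped MatrixOrder in
/-- A positive definite form is bounded below by a multiple of the squared norm. -/
lemma exists_pos_mul_dotProduct_self_le {P : Matrix (Fin n) (Fin n) ℝ} (hP : P.PosDef) :
    ∃ r : ℝ, 0 < r ∧ ∀ x : Fin n → ℝ, r * (x ⬝ᵥ x) ≤ x ⬝ᵥ (P *ᵥ x) := by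
  rcases Nat.eq_zero_or_pos n with rfl | hn
  · exact ⟨1, one_pos, fun x => by simp [dotProduct]⟩
  · have : Nonempty (Fin n) := ⟨⟨0, hn⟩⟩
    obtain ⟨r, hr, h⟩ := (CFC.exists_pos_algebraMap_le_iff (a := P) (ha := hP.isHermitian)).2
      (fun x hx => by
        rw [hP.isHermitian.spectrum_real_eq_range_eigenvalues] at hx
        obtain ⟨i, rfl⟩ := hx
        exact hP.eigenvalues_pos i)
    refine ⟨r, hr, fun x => ?_⟩
    have h2 := (Matrix.le_iff.1 h).dotProduct_mulVec_nonneg x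
    rw [Algebra.algebraMap_eq_smul_one, sub_mulVec, smul_mulVec, one_mulVec, star_trivial,
      dotProduct_sub, dotProduct_smul, smul_eq_mul] at h2
    linarith

/-- The Euclidean norm of a vector of reals. -/
noncomputable def eNorm {ι : Type*} [Fintype ι] (x : ι → ℝ) : ℝ := ‖WithLp.toLp 2 x‖

variable {ι : Type*} [Fintype ι]

lemma eNorm_nonneg (x : ι → ℝ) : 0 ≤ eNorm x := norm_nonneg _

lemma eNorm_sq (x : ι → ℝ) : eNorm x ^ 2 = x ⬝ᵥ x := by
  rw [eNorm, EuclideanSpace.real_norm_sq_eq, dotProduct]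
  exact Finset.sum_congr rfl fun i _ => pow_two _

lemma eNorm_add_le (x y : ι → ℝ) : eNorm (x + y) ≤ eNorm x + eNorm y := by
  rw [eNorm, WithLp.toLp_add]; exact norm_add_le _ _

lemma eNorm_sub_le (x y : ι → ℝ) : eNorm (x - y) ≤ eNorm x + eNorm y := by
  rw [eNorm, WithLp.toLp_sub]; exact norm_sub_le _ _

lemma eNorm_smul (c : ℝ) (x : ι → ℝ) : eNorm (c • x) = |c| * eNorm x := by
  rw [eNorm, WithLp.toLp_smul, norm_smul, Real.norm_eq_abs]; rfl

lemma abs_dotProduct_le (x y : ι → ℝ) : |x ⬝ᵥ y| ≤ eNorm x * eNorm y := by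
  have := abs_real_inner_le_norm (WithLp.toLp 2 y : EuclideanSpace ℝ ι) (WithLp.toLp 2 x)
  rwa [EuclideanSpace.inner_toLp_toLp, star_trivial, mul_comm] at this

lemma dotProduct_le (x y : ι → ℝ) : x ⬝ᵥ y ≤ eNorm x * eNorm y :=
  (le_abs_self _).trans (abs_dotProduct_le x y)

lemma eNorm_mulVec_le (A : Matrix (Fin n) (Fin n) ℝ) (x : Fin n → ℝ) :
    eNorm (A *ᵥ x) ≤ ‖Matrix.toEuclideanCLM (n := Fin n) (𝕜 := ℝ) A‖ * eNorm x := by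
  have := (Matrix.toEuclideanCLM (n := Fin n) (𝕜 := ℝ) A).le_opNorm (WithLp.toLp 2 x)
  rwa [Matrix.toEuclideanCLM_toLp] at this

/-- Positive definiteness is preserved under small perturbations along a symmetric direction. -/
lemma isOpen_setOf_posDef {A P : Matrix (Fin n) (Fin n) ℝ} (hA : A.IsSymm) (hP : P.IsSymm) :
    IsOpen {β : ℝ | (β • A + P).PosDef} := by
  rw [Metric.isOpen_iff]
  intro β hβ
  obtain ⟨r, hr, h⟩ := exists_pos_mul_dotProduct_self_le hβ
  set a := ‖Matrix.toEuclideanCLM (n := Fin n) (𝕜 := ℝ) A‖ with ha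
  have ha0 : 0 ≤ a := norm_nonneg _
  refine ⟨r / (a + 1), by positivity, fun β' hβ' => ?_⟩
  refine Matrix.PosDef.of_dotProduct_mulVec_pos ?_ fun x hx => ?_
  · rw [Matrix.IsHermitian, conjTranspose_eq_transpose_of_trivial, transpose_add, transpose_smul,
      hA.eq, hP.eq]
  · rw [Metric.mem_ball, Real.dist_eq, lt_div_iff₀ (by positivity)] at hβ'
    have hx2 : 0 < x ⬝ᵥ x := by
      simpa using dotProduct_star_self_pos_iff.2 hx
    have h3 : |x ⬝ᵥ (A *ᵥ x)| ≤ a * (x ⬝ᵥ x) := by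
      have := (abs_dotProduct_le x (A *ᵥ x)).trans
        (mul_le_mul_of_nonneg_left (eNorm_mulVec_le A x) (eNorm_nonneg x))
      rw [← eNorm_sq]
      nlinarith
    have h4 : |(β' - β) * (x ⬝ᵥ (A *ᵥ x))| < r * (x ⬝ᵥ x) := by
      rw [abs_mul]
      calc _ ≤ |β' - β| * (a * (x ⬝ᵥ x)) := mul_le_mul_of_nonneg_left h3 (abs_nonneg _)
        _ ≤ |β' - β| * ((a + 1) * (x ⬝ᵥ x)) := by gcongr; linarith
        _ = |β' - β| * (a + 1) * (x ⬝ᵥ x) := by ring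
        _ < r * (x ⬝ᵥ x) := mul_lt_mul_of_pos_right hβ' hx2
    have h5 := h x
    have h6 : x ⬝ᵥ ((β' • A + P) *ᵥ x) =
        x ⬝ᵥ ((β • A + P) *ᵥ x) + (β' - β) * (x ⬝ᵥ (A *ᵥ x)) := by
      simp only [add_mulVec, smul_mulVec, dotProduct_add, dotProduct_smul, smul_eq_mul]
      ring
    rw [star_trivial, h6]
    linarith [(abs_lt.1 h4).1]

lemma trace_mul_mul_transpose (C E : Matrix (Fin n) (Fin n) ℝ) :
    (C * E * Cᵀ).trace = ∑ i, C i ⬝ᵥ (E *ᵥ C i) := by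
  rw [trace]
  refine Finset.sum_congr rfl fun i _ => ?_
  rw [diag_apply, mul_apply_eq_vecMul, vecMul_transpose, mul_apply_eq_vecMul, mulVec,
    dotProduct_comm, ← dotProduct_mulVec]

lemma mul_trace_le_trace_mul_mul_transpose (C : Matrix (Fin n) (Fin n) ℝ)
    {E : Matrix (Fin n) (Fin n) ℝ} {r : ℝ}
    (hE : ∀ x : Fin n → ℝ, r * (x ⬝ᵥ x) ≤ x ⬝ᵥ (E *ᵥ x)) :
    r * (C * Cᵀ).trace ≤ (C * E * Cᵀ).trace := by
  have h1 := trace_mul_mul_transpose C 1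
  rw [mul_one] at h1
  rw [trace_mul_mul_transpose, h1, Finset.mul_sum]
  exact Finset.sum_le_sum fun i _ => by simpa using hE (C i)

lemma trace_mul_mul_transpose_le (C : Matrix (Fin n) (Fin n) ℝ)
    {E : Matrix (Fin n) (Fin n) ℝ} {r : ℝ}
    (hE : ∀ x : Fin n → ℝ, x ⬝ᵥ (E *ᵥ x) ≤ r * (x ⬝ᵥ x)) :
    (C * E * Cᵀ).trace ≤ r * (C * Cᵀ).trace := by
  have h1 := trace_mul_mul_transpose C 1
  rw [mul_one] at h1
  rw [trace_mul_mul_transpose, h1, Finset.mul_sum]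
  exact Finset.sum_le_sum fun i _ => by simpa using hE (C i)

end QuadraticForms

/-! ### Derivatives of the inverse and of the determinant of a pencil -/

section Pencil

variable {n : ℕ} (A P : Matrix (Fin n) (Fin n) ℝ)

lemma hasDerivAt_det_pencil {β : ℝ} (h : (β • A + P).det ≠ 0) :
    HasDerivAt (fun t : ℝ => (t • A + P).det)
      ((β • A + P).det * ((β • A + P)⁻¹ * A).trace) β := by
  set Q := β • A + P with hQ
  have key : ∀ t : ℝ, (t • A + P).det = Q.det * (1 + (Q⁻¹ * A).trace * (t - β) +
      (det (1 + (Polynomial.X : Polynomial ℝ) •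
        (Q⁻¹ * A).map Polynomial.C)).divX.divX.eval (t - β) * (t - β) ^ 2) := by
    intro t
    rw [← det_one_add_smul, ← det_mul, mul_add, mul_one, mul_smul_comm,
      mul_nonsing_inv_cancel_left _ _ h.isUnit, hQ, sub_smul]
    congr 1
    abel
  rw [funext key]
  set p := (det (1 + (Polynomial.X : Polynomial ℝ) • (Q⁻¹ * A).map Polynomial.C)).divX.divX
  have hs : HasDerivAt (fun t : ℝ => t - β) 1 β := (hasDerivAt_id β).sub_const β
  have hp : HasDerivAt (fun t : ℝ => p.eval (t - β)) (p.derivative.eval (β - β) * 1) β :=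
    HasDerivAt.comp (h := fun t : ℝ => t - β) β (p.hasDerivAt (β - β)) hs
  have := (((hs.const_mul (Q⁻¹ * A).trace).const_add 1).add (hp.mul (hs.pow 2))).const_mul Q.det
  exact this.congr_deriv (by simp)

lemma continuousAt_inv_pencil {β : ℝ} (h : (β • A + P).det ≠ 0) :
    ContinuousAt (fun t : ℝ => (t • A + P)⁻¹) β := by
  have hc : Continuous fun t : ℝ => t • A + P := by fun_prop
  simp only [Matrix.inv_def, Ring.inverse_eq_inv']
  exact (hc.matrix_det.continuousAt.inv₀ h).smul hc.matrix_adjugate.continuousAt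

lemma hasDerivAt_inv_pencil {β : ℝ} (h : (β • A + P).det ≠ 0) (i j : Fin n) :
    HasDerivAt (fun t : ℝ => (t • A + P)⁻¹ i j)
      (-((β • A + P)⁻¹ * A * (β • A + P)⁻¹) i j) β := by
  rw [hasDerivAt_iff_tendsto_slope]
  have hc : Continuous fun t : ℝ => t • A + P := by fun_prop
  have hev : ∀ᶠ t in nhds β, (t • A + P).det ≠ 0 := hc.matrix_det.continuousAt.eventually_ne h
  have hcont : Filter.Tendsto (fun t : ℝ => -((t • A + P)⁻¹ * A * (β • A + P)⁻¹) i j)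
      (nhdsWithin β {β}ᶜ) (nhds (-((β • A + P)⁻¹ * A * (β • A + P)⁻¹) i j)) := by
    have h1 : ContinuousAt (fun t : ℝ => (t • A + P)⁻¹ * A * (β • A + P)⁻¹) β := by
      have h0 := continuousAt_inv_pencil A P h
      have h2 : Continuous fun Q : Matrix (Fin n) (Fin n) ℝ => Q * A * (β • A + P)⁻¹ := by fun_prop
      exact h2.continuousAt.comp h0
    have h2 : Continuous fun Q : Matrix (Fin n) (Fin n) ℝ => -Q i j := by fun_prop
    exact ((h2.continuousAt.comp h1).tendsto).mono_left nhdsWithin_le_nhds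
  refine hcont.congr' ?_
  filter_upwards [nhdsWithin_le_nhds hev, self_mem_nhdsWithin] with t ht htβ
  have htβ' : t - β ≠ 0 := sub_ne_zero.2 htβ
  have hsub : (t • A + P)⁻¹ - (β • A + P)⁻¹ =
      -(t - β) • ((t • A + P)⁻¹ * A * (β • A + P)⁻¹) := by
    rw [Matrix.inv_sub_inv ⟨fun _ => (isUnit_iff_isUnit_det _).2 h.isUnit,
      fun _ => (isUnit_iff_isUnit_det _).2 ht.isUnit⟩, add_sub_add_right_eq_sub, ← sub_smul,
      mul_smul_comm, smul_mul_assoc, neg_sub]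
  rw [slope_def_field, ← Matrix.sub_apply, hsub, Matrix.smul_apply, smul_eq_mul]
  field_simp

end Pencil

/-! ### The log-partition function and the gradient of the objective -/

section ParamLemmas

variable {d : ℕ}

lemma Param.inner_eq (w u : Param d) : inner ℝ w u =
    w.theta ⬝ᵥ u.theta + w.beta * u.beta + w.kappa ⬝ᵥ u.kappa := by
  rw [EuclideanSpace.inner_eq_star_dotProduct, star_trivial]
  simp only [dotProduct, Fintype.sum_sum_type, Finset.univ_unique, Finset.sum_singleton,
    Param.theta, Param.beta, Param.kappa]
  simp only [mul_comm, add_assoc]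

@[simp] lemma Param.theta_mk (θ : Fin d → ℝ) (β : ℝ) (κ : Fin d → ℝ) : (mk θ β κ).theta = θ := rfl
@[simp] lemma Param.beta_mk (θ : Fin d → ℝ) (β : ℝ) (κ : Fin d → ℝ) : (mk θ β κ).beta = β := rfl
@[simp] lemma Param.kappa_mk (θ : Fin d → ℝ) (β : ℝ) (κ : Fin d → ℝ) : (mk θ β κ).kappa = κ := rfl
@[simp] lemma Param.beta_sub (w u : Param d) : (w - u).beta = w.beta - u.beta := rfl
@[simp] lemma Param.theta_add (w u : Param d) : (w + u).theta = w.theta + u.theta := rfl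
@[simp] lemma Param.beta_add (w u : Param d) : (w + u).beta = w.beta + u.beta := rfl
@[simp] lemma Param.kappa_add (w u : Param d) : (w + u).kappa = w.kappa + u.kappa := rfl
@[simp] lemma Param.theta_smul (c : ℝ) (u : Param d) : (c • u).theta = c • u.theta := rfl
@[simp] lemma Param.beta_smul (c : ℝ) (u : Param d) : (c • u).beta = c * u.beta := rfl
@[simp] lemma Param.kappa_smul (c : ℝ) (u : Param d) : (c • u).kappa = c • u.kappa := rfl

lemma Param.ext {w u : Param d} (h1 : w.theta = u.theta) (h2 : w.beta = u.beta)
    (h3 : w.kappa = u.kappa) : w = u := by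
  ext i
  rcases i with k | ⟨⟨⟩⟩ | k
  · exact congrFun h1 k
  · exact h2
  · exact congrFun h3 k

/-- The coordinate `β` as a continuous linear form. -/
noncomputable def Param.betaCLM (d : ℕ) : Param d →L[ℝ] ℝ :=
  EuclideanSpace.proj (Sum.inr (Sum.inl ()))

@[simp] lemma Param.betaCLM_apply (w : Param d) : Param.betaCLM d w = w.beta := rfl

end ParamLemmas

namespace Design

variable {n d : ℕ} (M : Design n d)

/-- The linear term `A X κ + D X θ` of the exponent of the model. -/
noncomputable def linTerm (w : Param d) : Fin n → ℝ :=
  M.A *ᵥ (M.X *ᵥ w.kappa) + diagonal M.D *ᵥ (M.X *ᵥ w.theta)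

/-- The mean of the model with parameter `w`: the exponent is a quadratic function with
its maximum there. -/
noncomputable def meanVec (w : Param d) : Fin n → ℝ :=
  (M.precision w.beta)⁻¹ *ᵥ M.linTerm w

/-- The gradient of the objective. -/
noncomputable def gradVec (y : Fin n → ℝ) (w : Param d) : Param d :=
  Param.mk ((1 / (n : ℝ)) • (M.Xᵀ *ᵥ (diagonal M.D *ᵥ (M.meanVec w - y))))
    ((1 / (n : ℝ)) * ((1 / 2) * (y ⬝ᵥ (M.A *ᵥ y) - ((M.precision w.beta)⁻¹ * M.A).trace
      - M.meanVec w ⬝ᵥ (M.A *ᵥ M.meanVec w))))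
    ((1 / (n : ℝ)) • (M.Xᵀ *ᵥ (M.A *ᵥ (M.meanVec w - y))))

lemma logLik_eq (hn : 0 < n) (y : Fin n → ℝ) (w : Param d) :
    M.logLik y w = -(n * M.objective y w) := by
  rw [objective]; field_simp

variable {M}

lemma precision_isSymm (hA : M.A.IsSymm) (β : ℝ) : (M.precision β).IsSymm := by
  rw [IsSymm, precision, transpose_add, transpose_smul, hA.eq, diagonal_transpose]

lemma dotProduct_mulVec_comm_of_isSymm {S : Matrix (Fin n) (Fin n) ℝ} (hS : S.IsSymm)
    (x y : Fin n → ℝ) : x ⬝ᵥ (S *ᵥ y) = y ⬝ᵥ (S *ᵥ x) := by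
  rw [dotProduct_mulVec, ← mulVec_transpose, hS.eq, dotProduct_comm]

lemma precision_mulVec_meanVec {w : Param d} (hw : w ∈ M.paramDomain) :
    M.precision w.beta *ᵥ M.meanVec w = M.linTerm w := by
  rw [meanVec, mulVec_mulVec, mul_nonsing_inv _ (PosDef.det_pos hw).ne'.isUnit, one_mulVec]

lemma isOpen_paramDomain (hA : M.A.IsSymm) : IsOpen M.paramDomain :=
  (isOpen_setOf_posDef hA (isSymm_diagonal M.D)).preimage (Param.betaCLM d).continuous

lemma logWeight_eq (w : Param d) (z : Fin n → ℝ) : M.logWeight w z =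
    -(1 / 2) * (z ⬝ᵥ (M.precision w.beta *ᵥ z)) + z ⬝ᵥ M.linTerm w := by
  rw [logWeight, linTerm, dotProduct_add, add_assoc]

/-- Completing the square in the exponent. -/
lemma logWeight_eq_completed (hA : M.A.IsSymm) {w : Param d} (hw : w ∈ M.paramDomain)
    (z : Fin n → ℝ) : M.logWeight w z = (1 / 2) * (M.linTerm w ⬝ᵥ M.meanVec w) +
      -(1 / 2) * ((z - M.meanVec w) ⬝ᵥ (M.precision w.beta *ᵥ (z - M.meanVec w))) := by
  rw [logWeight_eq, mulVec_sub, precision_mulVec_meanVec hw, sub_dotProduct, dotProduct_sub,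
    dotProduct_sub, dotProduct_mulVec_comm_of_isSymm (precision_isSymm hA _) (M.meanVec w) z,
    precision_mulVec_meanVec hw, dotProduct_comm (M.linTerm w)]
  ring

/-- The normalizing constant of the Gaussian density, as a function of the precision. -/
noncomputable def normConst (n : ℕ) (P : Matrix (Fin n) (Fin n) ℝ) : ℝ :=
  (√(2 * Real.pi))⁻¹ ^ n * √P.det

lemma exp_logWeight_eq (hA : M.A.IsSymm) {w : Param d} (hw : w ∈ M.paramDomain) (z : Fin n → ℝ) :
    Real.exp (M.logWeight w z) = Real.exp ((1 / 2) * (M.linTerm w ⬝ᵥ M.meanVec w)) *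
      ((normConst n (M.precision w.beta))⁻¹ * gaussianDensity (M.meanVec w) (M.precision w.beta) z) := by
  have hdet := PosDef.det_pos hw
  have hne : normConst n (M.precision w.beta) ≠ 0 := by unfold normConst; positivity
  rw [logWeight_eq_completed hA hw, Real.exp_add, gaussianDensity, ← normConst,
    inv_mul_cancel_left₀ hne]

/-- The partition function. -/
lemma integral_exp_logWeight (hA : M.A.IsSymm) {w : Param d} (hw : w ∈ M.paramDomain) :
    ∫ z, Real.exp (M.logWeight w z) = Real.exp ((1 / 2) * (M.linTerm w ⬝ᵥ M.meanVec w)) *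
      (normConst n (M.precision w.beta))⁻¹ := by
  simp only [exp_logWeight_eq hA hw]
  rw [integral_const_mul, integral_const_mul, integral_gaussianDensity _ hw, mul_one]

/-- The likelihood is the Gaussian density. -/
lemma exp_logLik (hA : M.A.IsSymm) {w : Param d} (hw : w ∈ M.paramDomain) (y : Fin n → ℝ) :
    Real.exp (M.logLik y w) = gaussianDensity (M.meanVec w) (M.precision w.beta) y := by
  have hdet := PosDef.det_pos hw
  have hne : 0 < normConst n (M.precision w.beta) := by unfold normConst; positivity
  rw [logLik, Real.exp_sub, integral_exp_logWeight hA hw, Real.exp_log (by positivity),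
    exp_logWeight_eq hA hw]
  field_simp

lemma objective_eq (hA : M.A.IsSymm) {w : Param d} (hw : w ∈ M.paramDomain) (y : Fin n → ℝ) :
    M.objective y w = (1 / (n : ℝ)) * ((1 / 2) * (w.beta * (y ⬝ᵥ (M.A *ᵥ y)) +
      y ⬝ᵥ (diagonal M.D *ᵥ y)) - y ⬝ᵥ M.linTerm w + (1 / 2) * (M.linTerm w ⬝ᵥ M.meanVec w)
      - (1 / 2) * Real.log (M.precision w.beta).det - Real.log ((√(2 * Real.pi))⁻¹ ^ n)) := by
  have hdet := PosDef.det_pos hw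
  have h1 : 0 < (√(2 * Real.pi))⁻¹ ^ n := by positivity
  rw [objective, logLik, integral_exp_logWeight hA hw, logWeight_eq, normConst,
    Real.log_mul (Real.exp_pos _).ne' (by positivity), Real.log_exp, Real.log_inv,
    Real.log_mul h1.ne' (by positivity), Real.log_sqrt hdet.le, precision, add_mulVec, smul_mulVec,
    dotProduct_add, dotProduct_smul, smul_eq_mul]
  ring

/-- `linTerm` as a continuous linear map. -/
noncomputable def linTermCLM (M : Design n d) : Param d →L[ℝ] (Fin n → ℝ) :=
  LinearMap.toContinuousLinearMap
    { toFun := M.linTerm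
      map_add' := fun u v => by
        simp only [linTerm, Param.kappa_add, Param.theta_add, mulVec_add]; abel
      map_smul' := fun c u => by
        simp only [linTerm, Param.kappa_smul, Param.theta_smul, mulVec_smul, smul_add,
          RingHom.id_apply] }

@[simp] lemma linTermCLM_apply (w : Param d) : M.linTermCLM w = M.linTerm w := rfl

lemma linTerm_sub (w u : Param d) : M.linTerm (w - u) = M.linTerm w - M.linTerm u :=
  map_sub M.linTermCLM w u

lemma dotProduct_linTerm (hA : M.A.IsSymm) (w : Param d) (x : Fin n → ℝ) :
    x ⬝ᵥ M.linTerm w = (M.Xᵀ *ᵥ (M.A *ᵥ x)) ⬝ᵥ w.kappa +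
      (M.Xᵀ *ᵥ (diagonal M.D *ᵥ x)) ⬝ᵥ w.theta := by
  rw [linTerm, dotProduct_add, dotProduct_mulVec, dotProduct_mulVec, dotProduct_mulVec,
    dotProduct_mulVec, ← mulVec_transpose, ← mulVec_transpose, ← mulVec_transpose,
    ← mulVec_transpose, hA.eq, diagonal_transpose]

lemma hasFDerivAt_linTerm_apply (w : Param d) (i : Fin n) :
    HasFDerivAt (fun w => M.linTerm w i)
      ((ContinuousLinearMap.proj (R := ℝ) (φ := fun _ : Fin n => ℝ) i).comp M.linTermCLM) w :=
  ((ContinuousLinearMap.proj (R := ℝ) (φ := fun _ : Fin n => ℝ) i).comp M.linTermCLM).hasFDerivAt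

lemma dotProduct_mulVec_eq_sum (x y : Fin n → ℝ) (S : Matrix (Fin n) (Fin n) ℝ) :
    x ⬝ᵥ (S *ᵥ y) = ∑ i, ∑ j, x i * S i j * y j := by
  simp only [dotProduct, mulVec, Finset.mul_sum, mul_assoc]

/-- The differential of `vᵀ P⁻¹ v`, where `v` is the linear term and `P` the precision matrix. Half
of this function is the part of the log-partition function that depends on `v`. -/
lemma hasFDerivAt_linTerm_dotProduct_meanVec (hA : M.A.IsSymm) {w : Param d}
    (hw : w ∈ M.paramDomain) :
    ∃ L : Param d →L[ℝ] ℝ, HasFDerivAt (fun w => M.linTerm w ⬝ᵥ M.meanVec w) L w ∧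
      ∀ u, L u = 2 * (M.meanVec w ⬝ᵥ M.linTerm u) -
        u.beta * (M.meanVec w ⬝ᵥ (M.A *ᵥ M.meanVec w)) := by
  have hdet := (PosDef.det_pos hw).ne'
  have hinv : ∀ i j, HasFDerivAt (fun w : Param d => (M.precision w.beta)⁻¹ i j)
      ((-((M.precision w.beta)⁻¹ * M.A * (M.precision w.beta)⁻¹) i j) • Param.betaCLM d) w :=
    fun i j => HasDerivAt.comp_hasFDerivAt (h₂ := fun t : ℝ => (M.precision t)⁻¹ i j) w
      (hasDerivAt_inv_pencil M.A (diagonal M.D) hdet i j) (Param.betaCLM d).hasFDerivAt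
  have hsum := HasFDerivAt.fun_sum (u := Finset.univ) fun (i : Fin n) _ =>
    HasFDerivAt.fun_sum (u := Finset.univ) fun (j : Fin n) _ =>
      (((hasFDerivAt_linTerm_apply (M := M) w i).mul (hinv i j)).mul
        (hasFDerivAt_linTerm_apply (M := M) w j))
  have hf : (fun w => M.linTerm w ⬝ᵥ M.meanVec w) = fun w : Param d => ∑ i, ∑ j,
      M.linTerm w i * (M.precision w.beta)⁻¹ i j * M.linTerm w j := by
    funext w
    rw [meanVec, dotProduct_mulVec_eq_sum]
  rw [hf]
  refine ⟨_, hsum, fun u => ?_⟩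
  set Q := (M.precision w.beta)⁻¹ with hQ
  have hQs : Q.IsSymm := by
    rw [hQ, IsSymm, transpose_nonsing_inv, (precision_isSymm hA _).eq]
  have e1 : M.meanVec w ⬝ᵥ (M.A *ᵥ M.meanVec w) =
      M.linTerm w ⬝ᵥ ((Q * M.A * Q) *ᵥ M.linTerm w) := by
    rw [meanVec, ← hQ, ← mulVec_mulVec, ← mulVec_mulVec, dotProduct_mulVec (M.linTerm w),
      ← mulVec_transpose, hQs.eq]
  have e2 : M.meanVec w ⬝ᵥ M.linTerm u = M.linTerm u ⬝ᵥ (Q *ᵥ M.linTerm w) := by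
    rw [dotProduct_comm, meanVec]
  have e3 : M.linTerm u ⬝ᵥ (Q *ᵥ M.linTerm w) = M.linTerm w ⬝ᵥ (Q *ᵥ M.linTerm u) :=
    dotProduct_mulVec_comm_of_isSymm hQs _ _
  have e4 : 2 * (M.meanVec w ⬝ᵥ M.linTerm u) =
      M.linTerm u ⬝ᵥ (Q *ᵥ M.linTerm w) + M.linTerm w ⬝ᵥ (Q *ᵥ M.linTerm u) := by
    rw [e2]; linarith
  rw [e1, e4]
  simp only [dotProduct_mulVec_eq_sum, Finset.mul_sum, ← Finset.sum_add_distrib,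
    ← Finset.sum_sub_distrib, _root_.sum_apply]
  refine Finset.sum_congr rfl fun i _ => Finset.sum_congr rfl fun j _ => ?_
  simp
  ring

/-- The explicit gradient of `-(1/n) LL`, at every point where the likelihood is defined. -/
theorem hasGradientAt_objective (hA : M.A.IsSymm) {w : Param d} (hw : w ∈ M.paramDomain)
    (y : Fin n → ℝ) : HasGradientAt (M.objective y) (M.gradVec y w) w := by
  have hdet := (PosDef.det_pos hw).ne'
  obtain ⟨L, hL, hLu⟩ := hasFDerivAt_linTerm_dotProduct_meanVec hA hw
  rw [hasGradientAt_iff_hasFDerivAt]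
  have hlog : HasFDerivAt (fun w : Param d => Real.log (M.precision w.beta).det)
      ((((M.precision w.beta)⁻¹ * M.A).trace) • Param.betaCLM d) w := by
    refine HasDerivAt.comp_hasFDerivAt (h₂ := fun t : ℝ => Real.log (M.precision t).det) w ?_
      (Param.betaCLM d).hasFDerivAt
    refine ((hasDerivAt_det_pencil M.A (diagonal M.D) hdet).log hdet).congr_deriv ?_
    exact mul_div_cancel_left₀ _ hdet
  have hlin : HasFDerivAt (fun w : Param d => y ⬝ᵥ M.linTerm w)
      (∑ i, y i • (ContinuousLinearMap.proj (R := ℝ) (φ := fun _ : Fin n => ℝ) i).comp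
        M.linTermCLM) w :=
    HasFDerivAt.fun_sum fun i _ => (hasFDerivAt_linTerm_apply w i).const_mul (y i)
  have hb : HasFDerivAt (fun w : Param d => w.beta) (Param.betaCLM d) w :=
    (Param.betaCLM d).hasFDerivAt
  have main := ((((((hb.mul_const (y ⬝ᵥ (M.A *ᵥ y))).add_const
    (y ⬝ᵥ (diagonal M.D *ᵥ y))).const_mul (1 / 2)).sub hlin).add (hL.const_mul (1 / 2))).sub
    (hlog.const_mul (1 / 2))).sub_const (Real.log ((√(2 * Real.pi))⁻¹ ^ n))
  have main2 := main.const_mul (1 / (n : ℝ))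
  have hev : M.objective y =ᶠ[nhds w] _ :=
    Filter.eventuallyEq_of_mem ((isOpen_paramDomain hA).mem_nhds hw)
      fun u hu => objective_eq hA hu y
  refine (main2.congr_of_eventuallyEq hev).congr_fderiv ?_
  ext1 u
  have hy : (∑ i, y i • (ContinuousLinearMap.proj (R := ℝ) (φ := fun _ : Fin n => ℝ) i).comp
        M.linTermCLM) u = y ⬝ᵥ M.linTerm u := by
    simp [dotProduct]
  have hin := dotProduct_linTerm hA u (M.meanVec w - y)
  rw [sub_dotProduct] at hin
  rw [InnerProductSpace.toDual_apply_apply, Param.inner_eq]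
  simp only [_root_.smul_apply, _root_.sub_apply,
    _root_.add_apply, hLu, hy, Param.betaCLM_apply, smul_eq_mul, gradVec,
    Param.theta_mk, Param.beta_mk, Param.kappa_mk, smul_dotProduct]
  linear_combination (1 / (n : ℝ)) * hin

end Design

/-! ### Uniform conditioning of admissible designs -/

lemma Param.norm_sq_eq {d : ℕ} (w : Param d) :
    ‖w‖ ^ 2 = eNorm w.theta ^ 2 + w.beta ^ 2 + eNorm w.kappa ^ 2 := by
  rw [← real_inner_self_eq_norm_sq, Param.inner_eq, eNorm_sq, eNorm_sq, pow_two w.beta]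

lemma Param.abs_beta_le_norm {d : ℕ} (w : Param d) : |w.beta| ≤ ‖w‖ := by
  refine (abs_le_of_sq_le_sq' ?_ (norm_nonneg _)).2
  rw [sq_abs]
  linarith [Param.norm_sq_eq w, sq_nonneg (eNorm w.theta), sq_nonneg (eNorm w.kappa)]

lemma Param.eNorm_theta_le_norm {d : ℕ} (w : Param d) : eNorm w.theta ≤ ‖w‖ := by
  refine (abs_le_of_sq_le_sq' ?_ (norm_nonneg _)).2
  linarith [Param.norm_sq_eq w, sq_nonneg w.beta, sq_nonneg (eNorm w.kappa)]

lemma Param.eNorm_kappa_le_norm {d : ℕ} (w : Param d) : eNorm w.kappa ≤ ‖w‖ := by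
  refine (abs_le_of_sq_le_sq' ?_ (norm_nonneg _)).2
  linarith [Param.norm_sq_eq w, sq_nonneg w.beta, sq_nonneg (eNorm w.theta)]

lemma eNorm_le_of_sq_le {ι κ : Type*} [Fintype ι] [Fintype κ] {x : ι → ℝ} {y : κ → ℝ} {c : ℝ}
    (hc : 0 ≤ c) (h : x ⬝ᵥ x ≤ c ^ 2 * (y ⬝ᵥ y)) : eNorm x ≤ c * eNorm y := by
  refine (abs_le_of_sq_le_sq' ?_ (mul_nonneg hc (eNorm_nonneg y))).2
  rw [mul_pow, eNorm_sq, eNorm_sq]; exact h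

lemma mulVec_dotProduct_mulVec_self {m k : ℕ} (G : Matrix (Fin m) (Fin k) ℝ) (u v : Fin k → ℝ) :
    (G *ᵥ u) ⬝ᵥ (G *ᵥ v) = u ⬝ᵥ ((Gᵀ * G) *ᵥ v) := by
  rw [← mulVec_mulVec, dotProduct_mulVec u, vecMul_transpose]

/-- Minimizing `‖G u + H v‖²` over `u` leaves the quadratic form of the Schur complement. -/
lemma schur_le_dotProduct_self {n d : ℕ} (G H : Matrix (Fin n) (Fin d) ℝ)
    (hW : IsUnit (Gᵀ * G).det) (u v : Fin d → ℝ) :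
    v ⬝ᵥ ((Hᵀ * (1 - G * (Gᵀ * G)⁻¹ * Gᵀ) * H) *ᵥ v) ≤
      (G *ᵥ u + H *ᵥ v) ⬝ᵥ (G *ᵥ u + H *ᵥ v) := by
  set W := Gᵀ * G with hWd
  set k := Gᵀ *ᵥ (H *ᵥ v) with hk
  have hWs : W.IsSymm := by rw [IsSymm, hWd, transpose_mul, transpose_transpose]
  have e1 : v ⬝ᵥ ((Hᵀ * (1 - G * W⁻¹ * Gᵀ) * H) *ᵥ v) =
      (H *ᵥ v) ⬝ᵥ (H *ᵥ v) - k ⬝ᵥ (W⁻¹ *ᵥ k) := by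
    rw [Matrix.mul_sub, Matrix.mul_one, Matrix.sub_mul, sub_mulVec, dotProduct_sub,
      ← mulVec_dotProduct_mulVec_self]
    congr 1
    simp only [← mulVec_mulVec, ← hk]
    rw [dotProduct_mulVec v, vecMul_transpose, dotProduct_mulVec (H *ᵥ v), ← mulVec_transpose, ← hk]
  have e2 : 0 ≤ (G *ᵥ (u + W⁻¹ *ᵥ k)) ⬝ᵥ (G *ᵥ (u + W⁻¹ *ᵥ k)) := by
    rw [← eNorm_sq]; positivity
  have e3 : (G *ᵥ (u + W⁻¹ *ᵥ k)) ⬝ᵥ (G *ᵥ (u + W⁻¹ *ᵥ k)) =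
      (G *ᵥ u) ⬝ᵥ (G *ᵥ u) + 2 * (u ⬝ᵥ k) + k ⬝ᵥ (W⁻¹ *ᵥ k) := by
    have hc : W *ᵥ (W⁻¹ *ᵥ k) = k := by rw [mulVec_mulVec, mul_nonsing_inv _ hW, one_mulVec]
    have hc2 : (W⁻¹ *ᵥ k) ⬝ᵥ (W *ᵥ u) = u ⬝ᵥ k := by
      rw [Design.dotProduct_mulVec_comm_of_isSymm hWs, hc]
    rw [mulVec_dotProduct_mulVec_self, mulVec_dotProduct_mulVec_self, ← hWd, mulVec_add, hc,
      add_dotProduct, dotProduct_add, dotProduct_add, hc2, dotProduct_comm (W⁻¹ *ᵥ k) k]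
    ring
  have e4 : (G *ᵥ u) ⬝ᵥ (H *ᵥ v) = u ⬝ᵥ k := by
    rw [hk, dotProduct_mulVec u, vecMul_transpose]
  rw [e1, add_dotProduct, dotProduct_add, dotProduct_add, dotProduct_comm (H *ᵥ v) (G *ᵥ u), e4]
  linarith

namespace Design

variable {n d : ℕ}

/-- The quantitative consequences of admissibility that the analysis of the likelihood uses, for all
`|β| ≤ B`: the spectrum of the precision is in `[l, p]`, `‖A‖₂ ≤ a`, `‖A‖_F² ≥ c n`, and
`linTerm` is bounded above and below as an operator, relative to `√n`. -/
structure WellConditioned (M : Design n d) (B a c l p s t : ℝ) : Prop where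
  symm : M.A.IsSymm
  posDef : ∀ β, |β| ≤ B → (M.precision β).PosDef
  le_precision : ∀ β, |β| ≤ B → ∀ x, l * (x ⬝ᵥ x) ≤ x ⬝ᵥ (M.precision β *ᵥ x)
  precision_le : ∀ β, |β| ≤ B → ∀ x, eNorm (M.precision β *ᵥ x) ≤ p * eNorm x
  eNorm_A_le : ∀ x, eNorm (M.A *ᵥ x) ≤ a * eNorm x
  frobenius : c * n ≤ (M.A * M.Aᵀ).trace
  le_linTerm : ∀ w : Param d,
    s * n * (eNorm w.theta ^ 2 + eNorm w.kappa ^ 2) ≤ eNorm (M.linTerm w) ^ 2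
  linTerm_le : ∀ w : Param d, eNorm (M.linTerm w) ≤ t * √n * ‖w‖

section Admissible

variable {M : Design n d} {B a c qmin qmax ρmin ρmax ρDAX : ℝ}

lemma isHermitian_of_isSymm {k : ℕ} {S : Matrix (Fin k) (Fin k) ℝ} (h : S.IsSymm) :
    S.IsHermitian := by
  rw [IsHermitian, conjTranspose_eq_transpose_of_trivial, h.eq]

lemma Admissible.precision_bounds_of_lt (h : M.Admissible B a c qmin qmax ρmin ρmax ρDAX)
    (hmin : 0 < ρmin) (hmax : 0 < ρmax) {β : ℝ} (hβ : |β| < B) (x : Fin n → ℝ) :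
    ρmax⁻¹ * (x ⬝ᵥ x) ≤ x ⬝ᵥ (M.precision β *ᵥ x) ∧
      x ⬝ᵥ (M.precision β *ᵥ x) ≤ ρmin⁻¹ * (x ⬝ᵥ x) := by
  have hs := isHermitian_of_isSymm (precision_isSymm h.symm β)
  rcases Nat.eq_zero_or_pos n with rfl | hn
  · simp [dotProduct]
  have : Nonempty (Fin n) := ⟨⟨0, hn⟩⟩
  -- the inverse of a singular matrix is zero by convention, and zero is not in `(ρmin, ρmax)`
  have hdet : IsUnit (M.precision β) := by
    by_contra hc
    have h0 : (M.precision β)⁻¹ = 0 := nonsing_inv_apply_not_isUnit _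
      (fun hu => hc ((isUnit_iff_isUnit_det _).2 hu))
    have := (h.covariance β hβ 0 (by rw [h0, spectrum.zero_eq]; rfl)).1
    linarith
  obtain ⟨U, hU⟩ := hdet
  have key : ∀ r ∈ spectrum ℝ (M.precision β), ρmax⁻¹ ≤ r ∧ r ≤ ρmin⁻¹ := by
    intro r hr
    have hr' : r⁻¹ ∈ spectrum ℝ (M.precision β)⁻¹ := by
      rw [← hU, ← coe_units_inv, ← spectrum.map_inv, Set.inv_mem_inv, hU]
      exact hr
    obtain ⟨h1, h2⟩ := h.covariance β hβ _ hr'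
    have hr0 : 0 < r := inv_pos.1 (hmin.trans h1)
    exact ⟨(inv_le_comm₀ hr0 hmax).1 h2.le, (le_inv_comm₀ hmin hr0).1 h1.le⟩
  exact ⟨mul_dotProduct_self_le_of_spectrum hs (fun r hr => (key r hr).1) x,
    dotProduct_mulVec_le_of_spectrum hs (fun r hr => (key r hr).2) x⟩

lemma Admissible.le_precision (h : M.Admissible B a c qmin qmax ρmin ρmax ρDAX)
    (hB : 0 < B) (hmin : 0 < ρmin) (hmax : 0 < ρmax) {β : ℝ} (hβ : |β| ≤ B) (x : Fin n → ℝ) :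
    ρmax⁻¹ * (x ⬝ᵥ x) ≤ x ⬝ᵥ (M.precision β *ᵥ x) := by
  -- the bound is closed in `β`, and the closed ball is the closure of the open one
  have hcl : β ∈ closure (Metric.ball (0 : ℝ) B) := by
    rw [closure_ball _ hB.ne', mem_closedBall_zero_iff, Real.norm_eq_abs]; exact hβ
  have hc : IsClosed {t : ℝ | ρmax⁻¹ * (x ⬝ᵥ x) ≤ x ⬝ᵥ (M.precision t *ᵥ x)} := by
    refine isClosed_le continuous_const ?_
    have : (fun t : ℝ => x ⬝ᵥ (M.precision t *ᵥ x)) =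
        fun t => t * (x ⬝ᵥ (M.A *ᵥ x)) + x ⬝ᵥ (diagonal M.D *ᵥ x) := by
      funext t
      rw [precision, add_mulVec, smul_mulVec, dotProduct_add, dotProduct_smul, smul_eq_mul]
    rw [this]
    fun_prop
  refine hc.closure_subset_iff.2 (fun t ht => ?_) hcl
  rw [mem_ball_zero_iff, Real.norm_eq_abs] at ht
  exact (h.precision_bounds_of_lt hmin hmax ht x).1

lemma Admissible.D_bounds (h : M.Admissible B a c qmin qmax ρmin ρmax ρDAX)
    (hB : 0 < B) (hmin : 0 < ρmin) (hmax : 0 < ρmax) (i : Fin n) :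
    ρmax⁻¹ ≤ M.D i ∧ M.D i ≤ ρmin⁻¹ := by
  have := h.precision_bounds_of_lt hmin hmax (β := 0) (by rwa [abs_zero]) (Pi.single i 1)
  simpa [precision] using this

lemma Admissible.eNorm_D_le (h : M.Admissible B a c qmin qmax ρmin ρmax ρDAX)
    (hB : 0 < B) (hmin : 0 < ρmin) (hmax : 0 < ρmax) (x : Fin n → ℝ) :
    eNorm (diagonal M.D *ᵥ x) ≤ ρmin⁻¹ * eNorm x := by
  refine eNorm_le_of_sq_le (inv_pos.2 hmin).le ?_
  simp only [dotProduct, mulVec_diagonal, Finset.mul_sum]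
  refine Finset.sum_le_sum fun i _ => ?_
  have h1 := (h.D_bounds hB hmin hmax i).2
  have h2 := h.D_pos i
  nlinarith [mul_le_mul h1 h1 h2.le (inv_pos.2 hmin).le, mul_self_nonneg (x i)]

lemma Admissible.le_eNorm_D (h : M.Admissible B a c qmin qmax ρmin ρmax ρDAX)
    (hB : 0 < B) (hmin : 0 < ρmin) (hmax : 0 < ρmax) (x : Fin n → ℝ) :
    ρmax⁻¹ ^ 2 * (x ⬝ᵥ x) ≤ (diagonal M.D *ᵥ x) ⬝ᵥ (diagonal M.D *ᵥ x) := by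
  simp only [dotProduct, mulVec_diagonal, Finset.mul_sum]
  refine Finset.sum_le_sum fun i _ => ?_
  have h1 := (h.D_bounds hB hmin hmax i).1
  have h2 := h.D_pos i
  nlinarith [mul_le_mul h1 h1 (inv_pos.2 hmax).le h2.le, mul_self_nonneg (x i)]

lemma Admissible.eNorm_A_le (h : M.Admissible B a c qmin qmax ρmin ρmax ρDAX) (x : Fin n → ℝ) :
    eNorm (M.A *ᵥ x) ≤ a * eNorm x :=
  (eNorm_mulVec_le M.A x).trans (mul_le_mul_of_nonneg_right h.opNorm_le (eNorm_nonneg x))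

lemma Admissible.X_bounds (h : M.Admissible B a c qmin qmax ρmin ρmax ρDAX) (hn : 0 < n)
    (u : Fin d → ℝ) : qmin * n * (u ⬝ᵥ u) ≤ (M.X *ᵥ u) ⬝ᵥ (M.X *ᵥ u) ∧
      (M.X *ᵥ u) ⬝ᵥ (M.X *ᵥ u) ≤ qmax * n * (u ⬝ᵥ u) := by
  have hn' : (0 : ℝ) < n := by exact_mod_cast hn
  have hs : ((1 / (n : ℝ)) • (M.Xᵀ * M.X)).IsHermitian := isHermitian_of_isSymm (by
    rw [IsSymm, transpose_smul, transpose_mul, transpose_transpose])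
  have h1 := mul_dotProduct_self_le_of_spectrum hs (fun r hr => (h.covariates r hr).1) u
  have h2 := dotProduct_mulVec_le_of_spectrum hs (fun r hr => (h.covariates r hr).2) u
  rw [smul_mulVec, dotProduct_smul, smul_eq_mul, ← mulVec_dotProduct_mulVec_self] at h1 h2
  rw [one_div, ← div_eq_inv_mul] at h1 h2
  rw [le_div_iff₀ hn'] at h1
  rw [div_le_iff₀ hn'] at h2
  constructor <;> linarith

lemma Admissible.schur_bound (h : M.Admissible B a c qmin qmax ρmin ρmax ρDAX) (hn : 0 < n)
    (hB : 0 < B) (hmin : 0 < ρmin) (hmax : 0 < ρmax) (hq : 0 < qmin) (w : Param d) :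
    ρDAX * n * eNorm w.kappa ^ 2 ≤ eNorm (M.linTerm w) ^ 2 := by
  have hn' : (0 : ℝ) < n := by exact_mod_cast hn
  set G := diagonal M.D * M.X with hG
  set H := M.A * M.X with hH
  have hGt : Gᵀ = M.Xᵀ * diagonal M.D := by rw [hG, transpose_mul, diagonal_transpose]
  have hGG : M.Xᵀ * (diagonal M.D) ^ 2 * M.X = Gᵀ * G := by
    rw [hGt, hG, pow_two]; simp only [Matrix.mul_assoc]
  have hW : (Gᵀ * G).PosDef := by
    refine PosDef.of_dotProduct_mulVec_pos ?_ fun u hu => ?_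
    · exact isHermitian_of_isSymm (by rw [IsSymm, transpose_mul, transpose_transpose])
    · rw [star_trivial, ← mulVec_dotProduct_mulVec_self, hG, ← mulVec_mulVec]
      have h1 := h.le_eNorm_D hB hmin hmax (M.X *ᵥ u)
      have h2 := (h.X_bounds hn u).1
      have h3 : 0 < u ⬝ᵥ u := by simpa using dotProduct_star_self_pos_iff.2 hu
      have : 0 < ρmax⁻¹ ^ 2 * (qmin * n * (u ⬝ᵥ u)) := by positivity
      exact this.trans_le ((mul_le_mul_of_nonneg_left h2 (by positivity)).trans h1)
  have hS : M.schurMatrix = (1 / (n : ℝ)) • (Hᵀ * (1 - G * (Gᵀ * G)⁻¹ * Gᵀ) * H) := by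
    rw [schurMatrix, hGG, hH, transpose_mul M.A, ← hG]
    nth_rewrite 3 [hGt]
    simp only [Matrix.mul_assoc]
  have hSs : M.schurMatrix.IsHermitian := by
    refine isHermitian_of_isSymm ?_
    rw [hS, IsSymm]
    simp only [transpose_smul, transpose_mul, transpose_sub, transpose_one, transpose_transpose,
      transpose_nonsing_inv, Matrix.mul_assoc]
  have h1 := mul_dotProduct_self_le_of_spectrum hSs h.schur w.kappa
  have h2 := schur_le_dotProduct_self G H hW.det_pos.ne'.isUnit w.theta w.kappa
  rw [hS, smul_mulVec, dotProduct_smul, smul_eq_mul, one_div, ← div_eq_inv_mul,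
    le_div_iff₀ hn'] at h1
  rw [eNorm_sq, eNorm_sq, linTerm, add_comm, mulVec_mulVec, mulVec_mulVec, ← hG, ← hH]
  linarith

/-- Admissible designs are well conditioned, with constants that depend only on the constants of
admissibility. -/
lemma Admissible.wellConditioned (h : M.Admissible B a c qmin qmax ρmin ρmax ρDAX) (hn : 0 < n)
    (hB : 0 < B) (ha : 0 < a) (hq : 0 < qmin) (hq' : 0 < qmax) (hmin : 0 < ρmin)
    (hmax : 0 < ρmax) (hρ : 0 < ρDAX) :
    M.WellConditioned B a c ρmax⁻¹ (B * a + ρmin⁻¹)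
      ((2 + 2 * a ^ 2 * qmax / ρDAX) / (ρmax⁻¹ ^ 2 * qmin) + 1 / ρDAX)⁻¹
      ((a + ρmin⁻¹) * √qmax) := by
  have hn' : (0 : ℝ) < n := by exact_mod_cast hn
  have hX : ∀ u, eNorm (M.X *ᵥ u) ≤ √qmax * √n * eNorm u := fun u => by
    refine eNorm_le_of_sq_le (by positivity) ?_
    rw [mul_pow, Real.sq_sqrt hq'.le, Real.sq_sqrt hn'.le]
    exact (h.X_bounds hn u).2
  have hAX : ∀ u, eNorm (M.A *ᵥ (M.X *ᵥ u)) ≤ a * (√qmax * √n * eNorm u) := fun u =>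
    (h.eNorm_A_le _).trans (mul_le_mul_of_nonneg_left (hX u) ha.le)
  refine ⟨h.symm, fun β hβ => ?_, fun β hβ => h.le_precision hB hmin hmax hβ, fun β hβ x => ?_,
    h.eNorm_A_le, ?_, fun w => ?_, fun w => ?_⟩
  · refine PosDef.of_dotProduct_mulVec_pos (isHermitian_of_isSymm (precision_isSymm h.symm β))
      fun x hx => ?_
    have h3 : 0 < x ⬝ᵥ x := by simpa using dotProduct_star_self_pos_iff.2 hx
    rw [star_trivial]
    exact (mul_pos (inv_pos.2 hmax) h3).trans_le (h.le_precision hB hmin hmax hβ x)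
  · rw [precision, add_mulVec, smul_mulVec]
    refine (eNorm_add_le _ _).trans ?_
    rw [eNorm_smul, add_mul, mul_assoc]
    exact add_le_add (mul_le_mul hβ (h.eNorm_A_le x) (eNorm_nonneg _) hB.le)
      (h.eNorm_D_le hB hmin hmax x)
  · refine h.frobenius_ge.trans (le_of_eq ?_)
    simp only [trace, diag_apply, mul_apply, transpose_apply, pow_two]
  -- the Schur complement bounds `κ` by the linear term, and then `D X θ = linTerm w - A X κ` gives
  -- the bound of `θ`
  · set N := eNorm (M.linTerm w) with hN
    have h1 := h.schur_bound hn hB hmin hmax hq w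
    rw [← hN] at h1
    have h2 : eNorm (diagonal M.D *ᵥ (M.X *ᵥ w.theta)) ≤ N + eNorm (M.A *ᵥ (M.X *ᵥ w.kappa)) := by
      have : diagonal M.D *ᵥ (M.X *ᵥ w.theta) = M.linTerm w - M.A *ᵥ (M.X *ᵥ w.kappa) := by
        rw [linTerm, add_sub_cancel_left]
      rw [this]
      exact eNorm_sub_le _ _
    have h3 : ρmax⁻¹ ^ 2 * (qmin * n * eNorm w.theta ^ 2) ≤
        eNorm (diagonal M.D *ᵥ (M.X *ᵥ w.theta)) ^ 2 := by
      rw [eNorm_sq, eNorm_sq]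
      exact (mul_le_mul_of_nonneg_left (h.X_bounds hn _).1 (by positivity)).trans
        (h.le_eNorm_D hB hmin hmax _)
    have h4 : eNorm (M.A *ᵥ (M.X *ᵥ w.kappa)) ^ 2 ≤ a ^ 2 * qmax * (n * eNorm w.kappa ^ 2) := by
      refine (pow_le_pow_left₀ (eNorm_nonneg _) (hAX _) 2).trans (le_of_eq ?_)
      rw [mul_pow, mul_pow, mul_pow, Real.sq_sqrt hq'.le, Real.sq_sqrt hn'.le]; ring
    have h5 : n * eNorm w.kappa ^ 2 ≤ 1 / ρDAX * N ^ 2 := by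
      rw [one_div, ← div_eq_inv_mul, le_div_iff₀ hρ]; linarith
    have h6 : eNorm (diagonal M.D *ᵥ (M.X *ᵥ w.theta)) ^ 2 ≤
        2 * N ^ 2 + 2 * eNorm (M.A *ᵥ (M.X *ᵥ w.kappa)) ^ 2 := by
      nlinarith [pow_le_pow_left₀ (eNorm_nonneg _) h2 2,
        sq_nonneg (N - eNorm (M.A *ᵥ (M.X *ᵥ w.kappa)))]
    have h7 : n * eNorm w.theta ^ 2 ≤
        (2 + 2 * a ^ 2 * qmax / ρDAX) / (ρmax⁻¹ ^ 2 * qmin) * N ^ 2 := by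
      rw [div_mul_eq_mul_div, le_div_iff₀ (by positivity)]
      have h8 := mul_le_mul_of_nonneg_left h5 (show 0 ≤ a ^ 2 * qmax by positivity)
      have h9 : (2 + 2 * a ^ 2 * qmax / ρDAX) * N ^ 2 =
          2 * N ^ 2 + 2 * (a ^ 2 * qmax * (1 / ρDAX * N ^ 2)) := by ring
      rw [h9]
      linarith
    rw [mul_assoc, ← div_eq_inv_mul, div_le_iff₀ (by positivity)]
    linarith
  · rw [linTerm]
    refine (eNorm_add_le _ _).trans ?_
    have h1 := hAX w.kappa
    have h2 := (h.eNorm_D_le hB hmin hmax (M.X *ᵥ w.theta)).trans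
      (mul_le_mul_of_nonneg_left (hX w.theta) (inv_pos.2 hmin).le)
    have h3 : a * (√qmax * √n * eNorm w.kappa) ≤ a * (√qmax * √n * ‖w‖) := by
      gcongr; exact w.eNorm_kappa_le_norm
    have h4 : ρmin⁻¹ * (√qmax * √n * eNorm w.theta) ≤ ρmin⁻¹ * (√qmax * √n * ‖w‖) := by
      gcongr; exact w.eNorm_theta_le_norm
    linarith

end Admissible

end Design

/-! ### Differences of gradients -/

namespace Design

variable {n d : ℕ} {M : Design n d}

lemma inner_gradVec (hA : M.A.IsSymm) (y : Fin n → ℝ) (w v : Param d) :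
    inner ℝ (M.gradVec y w) v = (1 / (n : ℝ)) * ((M.meanVec w - y) ⬝ᵥ M.linTerm v +
      v.beta * ((1 / 2) * (y ⬝ᵥ (M.A *ᵥ y) - ((M.precision w.beta)⁻¹ * M.A).trace
      - M.meanVec w ⬝ᵥ (M.A *ᵥ M.meanVec w)))) := by
  rw [Param.inner_eq, dotProduct_linTerm hA]
  simp only [gradVec, Param.theta_mk, Param.beta_mk, Param.kappa_mk, smul_dotProduct, smul_eq_mul]
  ring

lemma trace_inv_sub_inv {w w' : Param d} (hw : w ∈ M.paramDomain) (hw' : w' ∈ M.paramDomain) :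
    ((M.precision w.beta)⁻¹ * M.A).trace - ((M.precision w'.beta)⁻¹ * M.A).trace =
      -((w.beta - w'.beta) *
        ((M.precision w.beta)⁻¹ * M.A * (M.precision w'.beta)⁻¹ * M.A).trace) := by
  have hu := (isUnit_iff_isUnit_det _).2 (PosDef.det_pos hw).ne'.isUnit
  have hu' := (isUnit_iff_isUnit_det _).2 (PosDef.det_pos hw').ne'.isUnit
  have h : M.precision w'.beta - M.precision w.beta = (-(w.beta - w'.beta)) • M.A := by
    rw [precision, precision, add_sub_add_right_eq_sub, ← sub_smul, neg_sub]
  rw [← trace_sub, ← sub_mul, Matrix.inv_sub_inv ⟨fun _ => hu', fun _ => hu⟩, h, mul_smul_comm,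
    smul_mul_assoc, smul_mul_assoc, trace_smul, smul_eq_mul, neg_mul]

lemma inner_gradVec_sub (hA : M.A.IsSymm) (hn : 0 < n) (y : Fin n → ℝ) {w w' : Param d}
    (hw : w ∈ M.paramDomain) (hw' : w' ∈ M.paramDomain) (v : Param d) :
    n * inner ℝ (M.gradVec y w - M.gradVec y w') v =
      (M.meanVec w - M.meanVec w') ⬝ᵥ M.linTerm v + v.beta * ((1 / 2) *
        ((w.beta - w'.beta) *
          ((M.precision w.beta)⁻¹ * M.A * (M.precision w'.beta)⁻¹ * M.A).trace
        - (M.meanVec w - M.meanVec w') ⬝ᵥ (M.A *ᵥ (M.meanVec w + M.meanVec w')))) := by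
  have hn' : (n : ℝ) ≠ 0 := by positivity
  have h1 := trace_inv_sub_inv hw hw'
  have h2 := dotProduct_mulVec_comm_of_isSymm hA (M.meanVec w) (M.meanVec w')
  rw [inner_sub_left, inner_gradVec hA, inner_gradVec hA]
  simp only [sub_dotProduct, mulVec_add, dotProduct_add]
  field_simp
  linear_combination (- v.beta) * h1 + v.beta * h2

lemma precision_eq_add (β β' : ℝ) :
    M.precision β = M.precision β' + (β - β') • M.A := by
  rw [precision, precision, sub_smul]; abel

/-- The equation for the difference of two means. -/
lemma precision_mulVec_meanVec_sub {w w' : Param d}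
    (hw : w ∈ M.paramDomain) (hw' : w' ∈ M.paramDomain) :
    M.precision w.beta *ᵥ (M.meanVec w - M.meanVec w') =
      M.linTerm (w - w') - (w.beta - w'.beta) • (M.A *ᵥ M.meanVec w') := by
  rw [mulVec_sub, precision_mulVec_meanVec hw, precision_eq_add w.beta w'.beta, add_mulVec,
    precision_mulVec_meanVec hw', smul_mulVec, linTerm_sub]
  abel

/-- The gradient of the objective is monotone: up to the factor `2n`, the inner product below is
the symmetrized Kullback-Leibler divergence of the two Gaussian models. -/
lemma inner_gradVec_sub_self (hA : M.A.IsSymm) (hn : 0 < n) (y : Fin n → ℝ) {w w' : Param d}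
    (hw : w ∈ M.paramDomain) (hw' : w' ∈ M.paramDomain) :
    n * inner ℝ (M.gradVec y w - M.gradVec y w') (w - w') =
      (1 / 2) * ((w.beta - w'.beta) ^ 2 *
        ((M.precision w.beta)⁻¹ * M.A * (M.precision w'.beta)⁻¹ * M.A).trace) +
      (1 / 2) * ((M.meanVec w - M.meanVec w') ⬝ᵥ
          (M.precision w.beta *ᵥ (M.meanVec w - M.meanVec w')) +
        (M.meanVec w - M.meanVec w') ⬝ᵥ
          (M.precision w'.beta *ᵥ (M.meanVec w - M.meanVec w'))) := by
  rw [inner_gradVec_sub hA hn y hw hw', Param.beta_sub]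
  have h1 : M.linTerm (w - w') = M.precision w'.beta *ᵥ (M.meanVec w - M.meanVec w') +
      (w.beta - w'.beta) • (M.A *ᵥ M.meanVec w) := by
    rw [linTerm_sub, mulVec_sub, precision_mulVec_meanVec hw', ← precision_mulVec_meanVec hw,
      precision_eq_add w.beta w'.beta, add_mulVec, smul_mulVec]
    abel
  rw [h1, precision_eq_add w.beta w'.beta]
  simp only [add_mulVec, smul_mulVec, dotProduct_add, dotProduct_smul, smul_eq_mul, mulVec_sub,
    mulVec_add, dotProduct_sub]
  ring

/-- A positive definite matrix is `Rᵀ R`. -/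
lemma exists_eq_transpose_mul_self {P : Matrix (Fin n) (Fin n) ℝ} (hP : P.PosDef) :
    ∃ R : Matrix (Fin n) (Fin n) ℝ, P = Rᵀ * R :=
  ⟨_, (exists_sqrt_inv hP).2.1.symm⟩

/-- The trace of `P A Q A` is the value of the form of `Q` on the rows of `R A`, where
`P = Rᵀ R`. -/
lemma exists_trace_mul_mul_mul_eq (hA : M.A.IsSymm) {P : Matrix (Fin n) (Fin n) ℝ} (hP : P.PosDef)
    (Q : Matrix (Fin n) (Fin n) ℝ) : ∃ R : Matrix (Fin n) (Fin n) ℝ,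
      (P * M.A * Q * M.A).trace = ((R * M.A) * Q * (R * M.A)ᵀ).trace ∧
      ((R * M.A) * (R * M.A)ᵀ).trace = (M.A * P * M.Aᵀ).trace := by
  obtain ⟨R, hR⟩ := exists_eq_transpose_mul_self hP
  refine ⟨R, ?_, ?_⟩
  · rw [hR, transpose_mul, hA.eq, Matrix.mul_assoc Rᵀ, Matrix.mul_assoc Rᵀ, Matrix.mul_assoc Rᵀ,
      trace_mul_comm Rᵀ]
    simp only [Matrix.mul_assoc]
  · rw [trace_mul_comm, hR, transpose_mul, hA.eq]
    simp only [Matrix.mul_assoc]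

lemma sq_mul_trace_le_trace_mul_mul_mul (hA : M.A.IsSymm) {P Q : Matrix (Fin n) (Fin n) ℝ}
    (hP : P.PosDef) {r : ℝ} (hr : 0 ≤ r) (hPr : ∀ x, r * (x ⬝ᵥ x) ≤ x ⬝ᵥ (P *ᵥ x))
    (hQr : ∀ x, r * (x ⬝ᵥ x) ≤ x ⬝ᵥ (Q *ᵥ x)) :
    r ^ 2 * (M.A * M.Aᵀ).trace ≤ (P * M.A * Q * M.A).trace := by
  obtain ⟨R, h1, h2⟩ := exists_trace_mul_mul_mul_eq hA hP Q
  have h3 := mul_trace_le_trace_mul_mul_transpose (R * M.A) hQr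
  have h4 := mul_trace_le_trace_mul_mul_transpose M.A hPr
  rw [h2] at h3
  rw [h1, pow_two, mul_assoc r r]
  exact (mul_le_mul_of_nonneg_left h4 hr).trans h3

lemma trace_mul_mul_mul_le (hA : M.A.IsSymm) {P Q : Matrix (Fin n) (Fin n) ℝ}
    (hP : P.PosDef) {r : ℝ} (hr : 0 ≤ r) (hPr : ∀ x, x ⬝ᵥ (P *ᵥ x) ≤ r * (x ⬝ᵥ x))
    (hQr : ∀ x, x ⬝ᵥ (Q *ᵥ x) ≤ r * (x ⬝ᵥ x)) :
    (P * M.A * Q * M.A).trace ≤ r ^ 2 * (M.A * M.Aᵀ).trace := by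
  obtain ⟨R, h1, h2⟩ := exists_trace_mul_mul_mul_eq hA hP Q
  have h3 := trace_mul_mul_transpose_le (R * M.A) hQr
  have h4 := trace_mul_mul_transpose_le M.A hPr
  rw [h2] at h3
  rw [h1, pow_two, mul_assoc r r]
  exact h3.trans (mul_le_mul_of_nonneg_left h4 hr)

lemma trace_mul_mul_mul_nonneg (hA : M.A.IsSymm) {P Q : Matrix (Fin n) (Fin n) ℝ}
    (hP : P.PosDef) (hQ : Q.PosDef) : 0 ≤ (P * M.A * Q * M.A).trace := by
  have := sq_mul_trace_le_trace_mul_mul_mul hA hP le_rfl (r := 0) (Q := Q)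
    (fun x => by simpa using hP.posSemidef.dotProduct_mulVec_nonneg x)
    (fun x => by simpa using hQ.posSemidef.dotProduct_mulVec_nonneg x)
  simpa using this

lemma inv_mulVec_precision {w : Param d} (hw : w ∈ M.paramDomain) (x : Fin n → ℝ) :
    (M.precision w.beta)⁻¹ *ᵥ (M.precision w.beta *ᵥ x) = x := by
  rw [mulVec_mulVec, nonsing_inv_mul _ (PosDef.det_pos hw).ne'.isUnit, one_mulVec]

lemma precision_mulVec_inv {w : Param d} (hw : w ∈ M.paramDomain) (x : Fin n → ℝ) :
    M.precision w.beta *ᵥ ((M.precision w.beta)⁻¹ *ᵥ x) = x := by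
  rw [mulVec_mulVec, mul_nonsing_inv _ (PosDef.det_pos hw).ne'.isUnit, one_mulVec]

/-- The gradient of the objective is strictly monotone on the whole domain, so that it has at most
one zero. -/
lemma eq_of_gradVec_eq (hA : M.A.IsSymm) (hn : 0 < n) (hA0 : 0 < (M.A * M.Aᵀ).trace)
    (hlin : ∀ u : Param d, u.beta = 0 → M.linTerm u = 0 → u = 0)
    (y : Fin n → ℝ) {w w' : Param d} (hw : w ∈ M.paramDomain) (hw' : w' ∈ M.paramDomain)
    (h : M.gradVec y w = M.gradVec y w') : w = w' := by
  have hid := inner_gradVec_sub_self hA hn y hw hw'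
  rw [h, sub_self, inner_zero_left, mul_zero] at hid
  obtain ⟨r, hr, hr'⟩ := exists_pos_mul_dotProduct_self_le (PosDef.inv hw)
  obtain ⟨s, hs, hs'⟩ := exists_pos_mul_dotProduct_self_le (PosDef.inv hw')
  set q := min r s with hq
  have hq0 : 0 < q := lt_min hr hs
  have htr := sq_mul_trace_le_trace_mul_mul_mul hA (PosDef.inv hw) hq0.le
    (fun x => (mul_le_mul_of_nonneg_right (min_le_left r s)
      (by rw [← eNorm_sq]; positivity)).trans (hr' x))
    (fun x => (mul_le_mul_of_nonneg_right (min_le_right r s)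
      (by rw [← eNorm_sq]; positivity)).trans (hs' x))
  have htr' : 0 < ((M.precision w.beta)⁻¹ * M.A * (M.precision w'.beta)⁻¹ * M.A).trace :=
    (by positivity : 0 < q ^ 2 * (M.A * M.Aᵀ).trace).trans_le htr
  set δ := M.meanVec w - M.meanVec w' with hδ
  have hp' : 0 ≤ δ ⬝ᵥ (M.precision w'.beta *ᵥ δ) := by
    have := (PosDef.posSemidef hw').dotProduct_mulVec_nonneg δ
    rwa [star_trivial] at this
  have hp0 : 0 ≤ δ ⬝ᵥ (M.precision w.beta *ᵥ δ) := by
    have := (PosDef.posSemidef hw).dotProduct_mulVec_nonneg δ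
    rwa [star_trivial] at this
  have hb : w.beta - w'.beta = 0 := by
    by_contra hb
    have : 0 < (w.beta - w'.beta) ^ 2 := by positivity
    nlinarith [mul_pos this htr']
  have hδ0 : δ = 0 := by
    by_contra hc
    have := hw.dotProduct_mulVec_pos hc
    rw [star_trivial] at this
    rw [hb] at hid
    nlinarith
  have hl := precision_mulVec_meanVec_sub hw hw'
  rw [← hδ, hδ0, mulVec_zero, hb, zero_smul, sub_zero] at hl
  exact sub_eq_zero.1 (hlin _ hb hl.symm)

namespace WellConditioned

variable {B a c l p s t : ℝ}

lemma mem_paramDomain (h : M.WellConditioned B a c l p s t) {w : Param d} (hw : |w.beta| ≤ B) :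
    w ∈ M.paramDomain := h.posDef _ hw

lemma eNorm_inv_le (h : M.WellConditioned B a c l p s t) (hl : 0 < l) {w : Param d}
    (hw : |w.beta| ≤ B) (x : Fin n → ℝ) :
    eNorm ((M.precision w.beta)⁻¹ *ᵥ x) ≤ l⁻¹ * eNorm x := by
  set z := (M.precision w.beta)⁻¹ *ᵥ x with hz
  have h1 := h.le_precision _ hw z
  rw [hz, precision_mulVec_inv (h.mem_paramDomain hw), ← hz, ← eNorm_sq] at h1
  have h2 := h1.trans (dotProduct_le z x)
  rw [← div_eq_inv_mul, le_div_iff₀ hl]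
  rcases (eNorm_nonneg z).eq_or_lt with h0 | h0
  · rw [← h0, zero_mul]; exact eNorm_nonneg x
  · nlinarith

lemma dotProduct_inv_le (h : M.WellConditioned B a c l p s t) (hl : 0 < l) {w : Param d}
    (hw : |w.beta| ≤ B) (x : Fin n → ℝ) :
    x ⬝ᵥ ((M.precision w.beta)⁻¹ *ᵥ x) ≤ l⁻¹ * (x ⬝ᵥ x) := by
  refine (dotProduct_le _ _).trans ?_
  rw [← eNorm_sq, pow_two, mul_left_comm]
  exact mul_le_mul_of_nonneg_left (h.eNorm_inv_le hl hw x) (eNorm_nonneg x)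

lemma le_dotProduct_inv (h : M.WellConditioned B a c l p s t) (hl : 0 < l) (hp : 0 < p)
    {w : Param d} (hw : |w.beta| ≤ B) (x : Fin n → ℝ) :
    l / p ^ 2 * (x ⬝ᵥ x) ≤ x ⬝ᵥ ((M.precision w.beta)⁻¹ *ᵥ x) := by
  set z := (M.precision w.beta)⁻¹ *ᵥ x with hz
  have hx : M.precision w.beta *ᵥ z = x := precision_mulVec_inv (h.mem_paramDomain hw) x
  have h1 := h.le_precision _ hw z
  have h2 := h.precision_le _ hw z
  rw [hx] at h1 h2
  have h3 := pow_le_pow_left₀ (eNorm_nonneg x) h2 2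
  rw [mul_pow, eNorm_sq, eNorm_sq] at h3
  rw [div_mul_eq_mul_div, div_le_iff₀ (by positivity), dotProduct_comm x z]
  rw [dotProduct_comm z x] at h1
  nlinarith [dotProduct_comm x z, sq_nonneg p, mul_le_mul_of_nonneg_left h1 (sq_nonneg p)]

lemma trace_A_le (h : M.WellConditioned B a c l p s t) : (M.A * M.Aᵀ).trace ≤ n * a ^ 2 := by
  rw [trace, show (n : ℝ) * a ^ 2 = ∑ _i : Fin n, a ^ 2 by simp]
  refine Finset.sum_le_sum fun i _ => ?_
  have h1 := h.eNorm_A_le (Pi.single i 1)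
  have h2 : eNorm (Pi.single i (1 : ℝ)) = 1 := by
    have := eNorm_sq (Pi.single i (1 : ℝ))
    rw [single_one_dotProduct, Pi.single_eq_same] at this
    exact (pow_eq_one_iff_of_nonneg (eNorm_nonneg _) two_ne_zero).1 this
  rw [h2, mul_one] at h1
  have h3 := pow_le_pow_left₀ (eNorm_nonneg _) h1 2
  rw [eNorm_sq, mulVec_single_one] at h3
  refine le_trans (le_of_eq ?_) h3
  rw [diag_apply, mul_apply_eq_vecMul, vecMul_transpose]
  simp only [mulVec, dotProduct, col_apply]
  refine Finset.sum_congr rfl fun j _ => ?_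
  rw [h.symm.apply]

lemma eNorm_meanVec_le (h : M.WellConditioned B a c l p s t) (hl : 0 < l) (ht : 0 ≤ t) {w : Param d}
    (hw : |w.beta| ≤ B) {R : ℝ} (hR : ‖w‖ ≤ R) :
    eNorm (M.meanVec w) ≤ l⁻¹ * t * R * √n := by
  refine (h.eNorm_inv_le hl hw _).trans ?_
  rw [mul_assoc, mul_assoc]
  refine mul_le_mul_of_nonneg_left ((h.linTerm_le w).trans ?_) (inv_pos.2 hl).le
  rw [mul_assoc, mul_comm (√(n : ℝ))]
  gcongr

/-- The strong monotonicity of the gradient of the objective, with a constant that depends only on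
the constants of the conditioning and on a bound `R` of the parameters. -/
lemma strongMono (h : M.WellConditioned B a c l p s t) (hn : 0 < n) (ha : 0 < a) (hc : 0 < c)
    (hl : 0 < l) (hp : 0 < p) (hs : 0 < s) (ht : 0 ≤ t) (y : Fin n → ℝ) {w w' : Param d}
    (hw : |w.beta| ≤ B) (hw' : |w'.beta| ≤ B) {R : ℝ} (hR' : ‖w'‖ ≤ R) :
    ((2 * p ^ 2 / l + 4 * (a * (l⁻¹ * t * R)) ^ 2 / ((l / p ^ 2) ^ 2 * c)) / s +
      2 / ((l / p ^ 2) ^ 2 * c))⁻¹ * ‖w - w'‖ ^ 2 ≤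
      inner ℝ (M.gradVec y w - M.gradVec y w') (w - w') := by
  have hn' : (0 : ℝ) < n := by exact_mod_cast hn
  have hid := inner_gradVec_sub_self h.symm hn y (h.mem_paramDomain hw) (h.mem_paramDomain hw')
  set E := inner ℝ (M.gradVec y w - M.gradVec y w') (w - w') with hE
  set δ := M.meanVec w - M.meanVec w' with hδ
  set b := w.beta - w'.beta with hb
  set T := l⁻¹ * t * R with hT
  set r := l / p ^ 2 with hr
  have hr0 : 0 < r := by positivity
  have htr := sq_mul_trace_le_trace_mul_mul_mul h.symm (PosDef.inv (h.posDef _ hw)) hr0.le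
    (h.le_dotProduct_inv hl hp hw) (h.le_dotProduct_inv hl hp hw')
  have htr2 : r ^ 2 * (c * n) ≤ _ := (mul_le_mul_of_nonneg_left h.frobenius (sq_nonneg r)).trans htr
  have h1 := h.le_precision _ hw δ
  have h2 := h.le_precision _ hw' δ
  rw [← eNorm_sq] at h1 h2
  have h3 := mul_le_mul_of_nonneg_left htr2 (sq_nonneg b)
  have hδ0 : 0 ≤ l * eNorm δ ^ 2 := by positivity
  have hb0 : 0 ≤ b ^ 2 * (r ^ 2 * (c * n)) := by positivity
  -- the two parts of the divergence bound the differences `δ` of the means and `b` of the `β`s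
  have hEδ : eNorm δ ^ 2 ≤ n * E / l := by
    rw [le_div_iff₀ hl]; linarith
  have hEb : n * b ^ 2 ≤ 2 * (n * E) / (r ^ 2 * c) := by
    rw [le_div_iff₀ (by positivity)]; nlinarith
  -- by the equation for `δ` they control the linear term of `w - w'`, which controls `θ` and `κ`
  have hg : eNorm (M.linTerm (w - w')) ≤ p * eNorm δ + |b| * (a * (T * √n)) := by
    have e : M.linTerm (w - w') = M.precision w.beta *ᵥ δ + b • (M.A *ᵥ M.meanVec w') := by
      rw [hδ, precision_mulVec_meanVec_sub (h.mem_paramDomain hw) (h.mem_paramDomain hw'),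
        sub_add_cancel]
    rw [e]
    refine (eNorm_add_le _ _).trans (add_le_add (h.precision_le _ hw δ) ?_)
    rw [eNorm_smul]
    refine mul_le_mul_of_nonneg_left ((h.eNorm_A_le _).trans ?_) (abs_nonneg b)
    exact mul_le_mul_of_nonneg_left (h.eNorm_meanVec_le hl ht hw' hR') ha.le
  have hg2 : eNorm (M.linTerm (w - w')) ^ 2 ≤
      2 * p ^ 2 * eNorm δ ^ 2 + 2 * (a * T) ^ 2 * (n * b ^ 2) := by
    refine (pow_le_pow_left₀ (eNorm_nonneg _) hg 2).trans ?_
    have e : (|b| * (a * (T * √n))) ^ 2 = (a * T) ^ 2 * (n * b ^ 2) := by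
      rw [mul_pow, sq_abs, mul_pow, mul_pow, Real.sq_sqrt hn'.le]; ring
    nlinarith [sq_nonneg (p * eNorm δ - |b| * (a * (T * √n)))]
  have hlow := h.le_linTerm (w - w')
  have hkey : s * n * (eNorm (w - w').theta ^ 2 + eNorm (w - w').kappa ^ 2) ≤
      (2 * p ^ 2 / l + 4 * (a * T) ^ 2 / (r ^ 2 * c)) * (n * E) := by
    refine hlow.trans (hg2.trans ?_)
    have e1 := mul_le_mul_of_nonneg_left hEδ (show 0 ≤ 2 * p ^ 2 by positivity)
    have e2 := mul_le_mul_of_nonneg_left hEb (show 0 ≤ 2 * (a * T) ^ 2 by positivity)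
    refine (add_le_add e1 e2).trans (le_of_eq ?_)
    ring
  have hkey2 : n * (eNorm (w - w').theta ^ 2 + eNorm (w - w').kappa ^ 2) ≤
      (2 * p ^ 2 / l + 4 * (a * T) ^ 2 / (r ^ 2 * c)) / s * (n * E) := by
    rw [div_mul_eq_mul_div, le_div_iff₀ hs]; linarith
  have hfin : n * ‖w - w'‖ ^ 2 ≤ n * (((2 * p ^ 2 / l + 4 * (a * T) ^ 2 / (r ^ 2 * c)) / s +
      2 / (r ^ 2 * c)) * E) := by
    rw [Param.norm_sq_eq, Param.beta_sub, ← hb]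
    have e : 2 * (n * E) / (r ^ 2 * c) = n * (2 / (r ^ 2 * c) * E) := by ring
    rw [e] at hEb
    linarith
  rw [← div_eq_inv_mul, div_le_iff₀ (by positivity), mul_comm E]
  exact le_of_mul_le_mul_left hfin hn'

/-- The Lipschitz continuity of the gradient of the objective, with a constant that depends only on
the constants of the conditioning and on a bound `R` of the parameters. -/
lemma norm_gradVec_sub_le (h : M.WellConditioned B a c l p s t) (hn : 0 < n) (ha : 0 < a)
    (hl : 0 < l) (ht : 0 ≤ t) (y : Fin n → ℝ) {w w' : Param d}
    (hw : |w.beta| ≤ B) (hw' : |w'.beta| ≤ B) {R : ℝ} (hR : ‖w‖ ≤ R) (hR' : ‖w'‖ ≤ R) :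
    ‖M.gradVec y w - M.gradVec y w'‖ ≤
      (l⁻¹ * (t + a * (l⁻¹ * t * R)) * t + (1 / 2) * (l⁻¹ ^ 2 * a ^ 2 +
        l⁻¹ * (t + a * (l⁻¹ * t * R)) * (a * (2 * (l⁻¹ * t * R))))) * ‖w - w'‖ := by
  have hn' : (0 : ℝ) < n := by exact_mod_cast hn
  have hR0 : 0 ≤ R := (norm_nonneg _).trans hR
  set v := M.gradVec y w - M.gradVec y w' with hv
  have hid := inner_gradVec_sub h.symm hn y (h.mem_paramDomain hw) (h.mem_paramDomain hw') v
  rw [← hv, real_inner_self_eq_norm_sq] at hid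
  set δ := M.meanVec w - M.meanVec w' with hδ
  set b := w.beta - w'.beta with hb
  have hT0 : 0 ≤ l⁻¹ * t * R := by positivity
  have hm := h.eNorm_meanVec_le hl ht hw hR
  have hm' := h.eNorm_meanVec_le hl ht hw' hR'
  set T := l⁻¹ * t * R with hT
  have hbN : |b| ≤ ‖w - w'‖ := (w - w').abs_beta_le_norm
  have hδN : eNorm δ ≤ l⁻¹ * (t + a * T) * (√n * ‖w - w'‖) := by
    have e : δ = (M.precision w.beta)⁻¹ *ᵥ
        (M.linTerm (w - w') - b • (M.A *ᵥ M.meanVec w')) := by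
      rw [← precision_mulVec_meanVec_sub (h.mem_paramDomain hw) (h.mem_paramDomain hw'),
        inv_mulVec_precision (h.mem_paramDomain hw)]
    rw [e, mul_assoc]
    refine (h.eNorm_inv_le hl hw _).trans (mul_le_mul_of_nonneg_left ?_ (inv_pos.2 hl).le)
    refine (eNorm_sub_le _ _).trans ?_
    rw [eNorm_smul]
    have e1 := h.linTerm_le (w - w')
    have e2 : |b| * eNorm (M.A *ᵥ M.meanVec w') ≤ ‖w - w'‖ * (a * (T * √n)) :=
      mul_le_mul hbN ((h.eNorm_A_le _).trans (mul_le_mul_of_nonneg_left hm' ha.le))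
        (eNorm_nonneg _) (norm_nonneg _)
    linarith
  have hk : 0 ≤ l⁻¹ * (t + a * T) := by positivity
  set k := l⁻¹ * (t + a * T) with hkd
  have hvb : |v.beta| ≤ ‖v‖ := v.abs_beta_le_norm
  have hlo : 0 ≤ ((M.precision w.beta)⁻¹ * M.A * (M.precision w'.beta)⁻¹ * M.A).trace :=
    trace_mul_mul_mul_nonneg h.symm (h.posDef _ hw).inv (h.posDef _ hw').inv
  have hup := trace_mul_mul_mul_le h.symm (PosDef.inv (h.posDef _ hw)) (inv_pos.2 hl).le
    (h.dotProduct_inv_le hl hw) (h.dotProduct_inv_le hl hw')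
  set τ := ((M.precision w.beta)⁻¹ * M.A * (M.precision w'.beta)⁻¹ * M.A).trace with hτ
  have hup2 : τ ≤ n * (l⁻¹ ^ 2 * a ^ 2) :=
    hup.trans ((mul_le_mul_of_nonneg_left h.trace_A_le (sq_nonneg _)).trans (le_of_eq (by ring)))
  have ht1 : |b * τ| ≤ ‖w - w'‖ * (n * (l⁻¹ ^ 2 * a ^ 2)) := by
    rw [abs_mul, abs_of_nonneg hlo]
    exact mul_le_mul hbN hup2 hlo (norm_nonneg _)
  have hsn : √(n : ℝ) * √n = n := Real.mul_self_sqrt hn'.le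
  have ht2 : |δ ⬝ᵥ (M.A *ᵥ (M.meanVec w + M.meanVec w'))| ≤
      ‖w - w'‖ * (n * (k * (a * (2 * T)))) := by
    have e1 : eNorm (M.A *ᵥ (M.meanVec w + M.meanVec w')) ≤ a * (2 * T * √n) :=
      (h.eNorm_A_le _).trans (mul_le_mul_of_nonneg_left
        ((eNorm_add_le _ _).trans (by linarith)) ha.le)
    refine (abs_dotProduct_le _ _).trans ((mul_le_mul hδN e1 (eNorm_nonneg _)
      (by positivity)).trans (le_of_eq ?_))
    linear_combination (k * ‖w - w'‖ * a * 2 * T) * hsn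
  have ht3 : |δ ⬝ᵥ M.linTerm v| ≤ ‖v‖ * (‖w - w'‖ * (n * (k * t))) := by
    refine (abs_dotProduct_le _ _).trans ((mul_le_mul hδN (h.linTerm_le v) (eNorm_nonneg _)
      (by positivity)).trans (le_of_eq ?_))
    linear_combination (k * ‖w - w'‖ * t * ‖v‖) * hsn
  have ht4 : |v.beta * ((1 / 2) * (b * τ - δ ⬝ᵥ (M.A *ᵥ (M.meanVec w + M.meanVec w'))))| ≤
      ‖v‖ * ((1 / 2) * (‖w - w'‖ * (n * (l⁻¹ ^ 2 * a ^ 2)) +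
        ‖w - w'‖ * (n * (k * (a * (2 * T)))))) := by
    rw [abs_mul, abs_mul, abs_of_pos (by norm_num : (0 : ℝ) < 1 / 2)]
    refine mul_le_mul hvb (mul_le_mul_of_nonneg_left ?_ (by norm_num)) (by positivity)
      (norm_nonneg _)
    exact (abs_sub _ _).trans (add_le_add ht1 ht2)
  have hfin : n * ‖v‖ ^ 2 ≤ n * (‖v‖ * ((k * t + (1 / 2) * (l⁻¹ ^ 2 * a ^ 2 +
      k * (a * (2 * T)))) * ‖w - w'‖)) := by
    rw [hid]
    refine (le_abs_self _).trans ((abs_add_le _ _).trans ((add_le_add ht3 ht4).trans (le_of_eq ?_)))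
    ring
  have hfin2 := le_of_mul_le_mul_left hfin hn'
  rcases (norm_nonneg v).eq_or_lt with h0 | h0
  · rw [← h0]; positivity
  · rw [pow_two] at hfin2
    exact le_of_mul_le_mul_left hfin2 h0

end WellConditioned

end Design

/-! ### Projected gradient descent as a contraction -/

section Box

variable {d : ℕ} {Θ B : ℝ}

lemma halfWidth_pos (hΘ : 0 < Θ) (hB : 0 < B) (i : Fin d ⊕ Unit ⊕ Fin d) :
    0 < halfWidth d Θ B i := by
  rcases i with k | ⟨⟨⟩⟩ | k
  · exact hΘ
  · exact hB
  · exact mul_pos hΘ hB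

lemma projBox_mem (hΘ : 0 < Θ) (hB : 0 < B) (w : Param d) : projBox Θ B w ∈ paramBox d Θ B := by
  intro i
  have h := halfWidth_pos (d := d) hΘ hB i
  rw [abs_le]
  exact ⟨le_max_left _ _, max_le (by linarith) (min_le_left _ _)⟩

lemma projBox_of_mem {w : Param d} (hw : w ∈ paramBox d Θ B) : projBox Θ B w = w := by
  ext i
  have h := abs_le.1 (hw i)
  change max _ (min _ (w i)) = w i
  rw [min_eq_right h.2, max_eq_right h.1]

lemma norm_projBox_sub_le (w u : Param d) : ‖projBox Θ B w - projBox Θ B u‖ ≤ ‖w - u‖ := by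
  rw [EuclideanSpace.norm_eq, EuclideanSpace.norm_eq]
  refine Real.sqrt_le_sqrt (Finset.sum_le_sum fun i _ => pow_le_pow_left₀ (norm_nonneg _) ?_ 2)
  change |max _ (min _ (w i)) - max _ (min _ (u i))| ≤ |w i - u i|
  refine (abs_max_sub_max_le_max _ _ _ _).trans ?_
  rw [sub_self, abs_zero]
  refine max_le (abs_nonneg _) ((abs_min_sub_min_le_max _ _ _ _).trans ?_)
  rw [sub_self, abs_zero]
  exact max_le (abs_nonneg _) le_rfl

lemma isClosed_paramBox : IsClosed (paramBox d Θ B) := by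
  simp only [paramBox, Set.ofPred_forall]
  refine isClosed_iInter fun i => isClosed_le ?_ continuous_const
  fun_prop

/-- The Euclidean norm of the corners of the box. -/
noncomputable def boxRadius (d : ℕ) (Θ B : ℝ) : ℝ := √(∑ i, halfWidth d Θ B i ^ 2)

lemma norm_le_boxRadius {w : Param d} (hw : w ∈ paramBox d Θ B) : ‖w‖ ≤ boxRadius d Θ B := by
  rw [EuclideanSpace.norm_eq, boxRadius]
  exact Real.sqrt_le_sqrt (Finset.sum_le_sum fun i _ => pow_le_pow_left₀ (norm_nonneg _) (hw i) 2)

lemma abs_beta_le_of_mem {w : Param d} (hw : w ∈ paramBox d Θ B) : |w.beta| ≤ B :=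
  hw (Sum.inr (Sum.inl ()))

lemma lt_halfWidth_of_ball_subset {w : Param d} {r : ℝ} (hr : 0 < r)
    (h : Metric.ball w r ⊆ paramBox d Θ B) (i : Fin d ⊕ Unit ⊕ Fin d) :
    |w i| < halfWidth d Θ B i := by
  have key : ∀ σ : ℝ, |σ| = 1 → |w i + r / 2 * σ| ≤ halfWidth d Θ B i := by
    intro σ hσ
    have hm : w + (r / 2 * σ) • EuclideanSpace.single i (1 : ℝ) ∈ Metric.ball w r := by
      rw [Metric.mem_ball, dist_eq_norm, add_sub_cancel_left, norm_smul, PiLp.norm_single,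
        norm_one, mul_one, Real.norm_eq_abs, abs_mul, hσ, mul_one, abs_of_pos (by positivity)]
      linarith
    have := h hm i
    simpa using this
  have h1 := abs_le.1 (key 1 abs_one)
  have h2 := abs_le.1 (key (-1) (by simp))
  rw [abs_lt]
  constructor <;> linarith

/-- An interior point that is fixed under the clipping of a step is fixed under the step. -/
lemma eq_of_projBox_eq {w z : Param d} {r : ℝ} (hr : 0 < r)
    (h : Metric.ball w r ⊆ paramBox d Θ B) (hz : projBox Θ B z = w) : z = w := by
  ext i
  have h1 := abs_lt.1 (lt_halfWidth_of_ball_subset hr h i)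
  have h2 : max (-halfWidth d Θ B i) (min (halfWidth d Θ B i) (z i)) = w i :=
    congrArg (fun v : Param d => v i) hz
  rcases max_choice (-halfWidth d Θ B i) (min (halfWidth d Θ B i) (z i)) with h3 | h3
  · linarith
  rcases min_choice (halfWidth d Θ B i) (z i) with h4 | h4
  · linarith
  · linarith

end Box

namespace Design

variable {n d : ℕ}

/-- The properties of the objective that the convergence analysis uses: on the box its gradient is
strongly monotone with constant `m` and Lipschitz with constant `L`, and on the whole
domain the gradient is injective. -/
structure Regular (M : Design n d) (Θ B m L : ℝ) : Prop where
  symm : M.A.IsSymm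
  box_subset : paramBox d Θ B ⊆ M.paramDomain
  strongMono : ∀ y : Fin n → ℝ, ∀ w ∈ paramBox d Θ B, ∀ w' ∈ paramBox d Θ B,
    m * ‖w - w'‖ ^ 2 ≤ inner ℝ (M.gradVec y w - M.gradVec y w') (w - w')
  lipschitz : ∀ y : Fin n → ℝ, ∀ w ∈ paramBox d Θ B, ∀ w' ∈ paramBox d Θ B,
    ‖M.gradVec y w - M.gradVec y w'‖ ≤ L * ‖w - w'‖
  injective : ∀ y : Fin n → ℝ, ∀ w ∈ M.paramDomain, ∀ w' ∈ M.paramDomain,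
    M.gradVec y w = M.gradVec y w' → w = w'

/-- Admissible designs are regular, with constants that depend only on the constants of
admissibility. -/
lemma exists_regular (d : ℕ) {Θ B a c qmin qmax ρmin ρmax ρDAX : ℝ} (hB : 0 < B)
    (ha : 0 < a) (hc : 0 < c) (hq : 0 < qmin) (hq' : 0 < qmax) (hmin : 0 < ρmin)
    (hmax : 0 < ρmax) (hρ : 0 < ρDAX) :
    ∃ m L : ℝ, 0 < m ∧ 0 < L ∧ ∀ n : ℕ, 0 < n → ∀ M : Design n d,
      M.Admissible B a c qmin qmax ρmin ρmax ρDAX → M.Regular Θ B m L := by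
  set l := ρmax⁻¹ with hl
  set p := B * a + ρmin⁻¹ with hp
  set s := ((2 + 2 * a ^ 2 * qmax / ρDAX) / (ρmax⁻¹ ^ 2 * qmin) + 1 / ρDAX)⁻¹ with hs
  set t := (a + ρmin⁻¹) * √qmax with ht
  set R := boxRadius d Θ B with hR
  have hl0 : 0 < l := inv_pos.2 hmax
  have hp0 : 0 < p := by positivity
  have hs0 : 0 < s := by positivity
  have ht0 : 0 < t := by positivity
  have hR0 : 0 ≤ R := Real.sqrt_nonneg _
  refine ⟨((2 * p ^ 2 / l + 4 * (a * (l⁻¹ * t * R)) ^ 2 / ((l / p ^ 2) ^ 2 * c)) / s +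
      2 / ((l / p ^ 2) ^ 2 * c))⁻¹, l⁻¹ * (t + a * (l⁻¹ * t * R)) * t +
        (1 / 2) * (l⁻¹ ^ 2 * a ^ 2 + l⁻¹ * (t + a * (l⁻¹ * t * R)) * (a * (2 * (l⁻¹ * t * R)))),
      by positivity, by positivity, fun n hn M hM => ?_⟩
  have hn' : (0 : ℝ) < n := by exact_mod_cast hn
  have h := hM.wellConditioned hn hB ha hq hq' hmin hmax hρ
  refine ⟨h.symm, fun w hw => h.mem_paramDomain (abs_beta_le_of_mem hw),
    fun y w hw w' hw' => h.strongMono hn ha hc hl0 hp0 hs0 ht0.le y (abs_beta_le_of_mem hw)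
      (abs_beta_le_of_mem hw') (norm_le_boxRadius hw'),
    fun y w hw w' hw' => h.norm_gradVec_sub_le hn ha hl0 ht0.le y (abs_beta_le_of_mem hw)
      (abs_beta_le_of_mem hw') (norm_le_boxRadius hw) (norm_le_boxRadius hw'),
    fun y w hw w' hw' => eq_of_gradVec_eq h.symm hn
      ((by positivity : 0 < c * n).trans_le h.frobenius) (fun u hu hlin => ?_) y hw hw'⟩
  have h1 := h.le_linTerm u
  have h2 : eNorm (M.linTerm u) = 0 := by rw [hlin, eNorm, WithLp.toLp_zero, norm_zero]
  rw [h2, ← hs] at h1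
  have h3 : eNorm u.theta ^ 2 + eNorm u.kappa ^ 2 ≤ 0 := by
    by_contra hcon
    push Not at hcon
    have : 0 < s * n * (eNorm u.theta ^ 2 + eNorm u.kappa ^ 2) := by positivity
    linarith
  have h4 := Param.norm_sq_eq u
  rw [hu] at h4
  have : ‖u‖ ^ 2 = 0 := le_antisymm (by linarith) (sq_nonneg _)
  exact norm_eq_zero.1 (pow_eq_zero_iff two_ne_zero |>.1 this)

variable {M : Design n d} {Θ B m L : ℝ}

lemma pgdStep_eq (hA : M.A.IsSymm) (η : ℝ) (y : Fin n → ℝ) {w : Param d} (hw : w ∈ M.paramDomain) :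
    M.pgdStep Θ B η y w = projBox Θ B (w - η • M.gradVec y w) := by
  rw [pgdStep, (hasGradientAt_objective hA hw y).gradient]

lemma segment_mem_paramDomain (hA : M.A.IsSymm) {w w' : Param d} (hw : w ∈ M.paramDomain)
    (hw' : w' ∈ M.paramDomain) {t : ℝ} (ht0 : 0 ≤ t) (ht1 : t ≤ 1) :
    w + t • (w' - w) ∈ M.paramDomain := by
  change (M.precision (w + t • (w' - w)).beta).PosDef
  have e : M.precision (w + t • (w' - w)).beta =
      (1 - t) • M.precision w.beta + t • M.precision w'.beta := by
    simp only [Param.beta_add, Param.beta_smul, Param.beta_sub, precision]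
    module
  rw [e]
  refine PosDef.of_dotProduct_mulVec_pos ?_ fun x hx => ?_
  · rw [← e]; exact isHermitian_of_isSymm (precision_isSymm hA _)
  · have h1 := PosDef.dotProduct_mulVec_pos hw hx
    have h2 := PosDef.dotProduct_mulVec_pos hw' hx
    rw [add_mulVec, smul_mulVec, smul_mulVec, dotProduct_add, dotProduct_smul, dotProduct_smul,
      smul_eq_mul, smul_eq_mul]
    rcases ht0.eq_or_lt with h | h
    · rw [← h]; linarith
    · nlinarith [mul_pos h h2, mul_nonneg (sub_nonneg.2 ht1) h1.le]

/-- The mean value theorem for the objective. -/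
lemma exists_objective_sub_eq (hA : M.A.IsSymm) (y : Fin n → ℝ) {w w' : Param d}
    (hw : w ∈ M.paramDomain) (hw' : w' ∈ M.paramDomain) :
    ∃ t : ℝ, 0 < t ∧ t < 1 ∧ M.objective y w' - M.objective y w =
      inner ℝ (M.gradVec y (w + t • (w' - w))) (w' - w) := by
  have hder : ∀ t ∈ Set.Icc (0 : ℝ) 1, HasDerivAt (fun t : ℝ => M.objective y (w + t • (w' - w)))
      (inner ℝ (M.gradVec y (w + t • (w' - w))) (w' - w)) t := by
    intro t ht
    have h1 := (hasGradientAt_objective hA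
      (segment_mem_paramDomain hA hw hw' ht.1 ht.2) y).hasFDerivAt
    have h2 : HasDerivAt (fun t : ℝ => w + t • (w' - w)) (w' - w) t := by
      simpa using ((hasDerivAt_id t).smul_const (w' - w)).const_add w
    have h3 := h1.comp_hasDerivAt t h2
    rwa [InnerProductSpace.toDual_apply_apply] at h3
  obtain ⟨t, ht, h⟩ := exists_hasDerivAt_eq_slope _ _ zero_lt_one
    (fun t ht => (hder t ht).continuousAt.continuousWithinAt)
    (fun t ht => hder t ⟨ht.1.le, ht.2.le⟩)
  refine ⟨t, ht.1, ht.2, ?_⟩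
  rw [h]
  simp

/-- A critical point of the objective is the one and only maximum likelihood estimate: it is a
minimum of the objective as the gradient is monotone, and every other minimum would be another
critical point. -/
lemma Regular.isTheMLE (hM : M.Regular Θ B m L) (hn : 0 < n) {y : Fin n → ℝ} {w : Param d}
    (hw : w ∈ M.paramDomain) (hcrit : M.gradVec y w = 0) : M.IsTheMLE y w := by
  have hn' : (0 : ℝ) < n := by exact_mod_cast hn
  have hobj := M.logLik_eq hn y
  refine ⟨⟨hw, fun w' hw' => ?_⟩, fun w' hw' => ?_⟩
  · obtain ⟨t, ht0, ht1, ht⟩ := exists_objective_sub_eq hM.symm y hw hw'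
    have hmem := segment_mem_paramDomain hM.symm hw hw' ht0.le ht1.le
    have hid := inner_gradVec_sub_self hM.symm hn y hmem hw
    rw [hcrit, sub_zero, add_sub_cancel_left, inner_smul_right] at hid
    set v := w + t • (w' - w) with hv
    have h1 := trace_mul_mul_mul_nonneg hM.symm (PosDef.inv hmem) (PosDef.inv hw)
    have h2 := (PosDef.posSemidef hmem).dotProduct_mulVec_nonneg (M.meanVec v - M.meanVec w)
    have h3 := (PosDef.posSemidef hw).dotProduct_mulVec_nonneg (M.meanVec v - M.meanVec w)
    rw [star_trivial] at h2 h3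
    have h4 : 0 ≤ (n : ℝ) * (t * inner ℝ (M.gradVec y v) (w' - w)) := by
      rw [hid]
      have := mul_nonneg (sq_nonneg (v.beta - w.beta)) h1
      linarith
    have h5 : 0 ≤ inner ℝ (M.gradVec y v) (w' - w) := by
      have := nonneg_of_mul_nonneg_right h4 hn'
      exact nonneg_of_mul_nonneg_right this ht0
    change M.logLik y w' ≤ M.logLik y w
    rw [hobj, hobj]
    nlinarith
  · refine hM.injective y w' hw'.1 w hw ?_
    rw [hcrit]
    have hloc : IsLocalMin (M.objective y) w' := by
      filter_upwards [(isOpen_paramDomain hM.symm).mem_nhds hw'.1] with u hu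
      have h1 : M.logLik y u ≤ M.logLik y w' := hw'.2 hu
      rw [hobj, hobj] at h1
      nlinarith
    have h2 := hloc.hasFDerivAt_eq_zero (hasGradientAt_objective hM.symm hw'.1 y).hasFDerivAt
    exact (InnerProductSpace.toDual ℝ (Param d)).map_eq_zero_iff.1 h2

/-- The contraction factor of projected gradient descent with step size `m / L ^ 2`. -/
noncomputable def rate (m L : ℝ) : ℝ := √(1 - m ^ 2 / L ^ 2)

lemma rate_nonneg (m L : ℝ) : 0 ≤ rate m L := Real.sqrt_nonneg _

lemma rate_lt_one (hm : 0 < m) (hL : 0 < L) : rate m L < 1 := by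
  rw [rate, Real.sqrt_lt' one_pos]
  have : 0 < m ^ 2 / L ^ 2 := by positivity
  linarith

lemma Regular.norm_pgdStep_sub_le (hM : M.Regular Θ B m L) (hm : 0 < m) (hL : 0 < L)
    (y : Fin n → ℝ) {w w' : Param d} (hw : w ∈ paramBox d Θ B) (hw' : w' ∈ paramBox d Θ B) :
    ‖M.pgdStep Θ B (m / L ^ 2) y w - M.pgdStep Θ B (m / L ^ 2) y w'‖ ≤ rate m L * ‖w - w'‖ := by
  rw [pgdStep_eq hM.symm _ y (hM.box_subset hw), pgdStep_eq hM.symm _ y (hM.box_subset hw')]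
  refine (norm_projBox_sub_le _ _).trans ?_
  have e : w - (m / L ^ 2) • M.gradVec y w - (w' - (m / L ^ 2) • M.gradVec y w') =
      (w - w') - (m / L ^ 2) • (M.gradVec y w - M.gradVec y w') := by module
  rw [e]
  refine (abs_le_of_sq_le_sq' ?_ (mul_nonneg (rate_nonneg m L) (norm_nonneg _))).2
  rw [norm_sub_sq_real, inner_smul_right, norm_smul, real_inner_comm, Real.norm_eq_abs, mul_pow,
    mul_pow, sq_abs]
  have h1 := hM.strongMono y w hw w' hw'
  have h2 := pow_le_pow_left₀ (norm_nonneg _) (hM.lipschitz y w hw w' hw') 2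
  have h3 := mul_le_mul_of_nonneg_left h1 (show 0 ≤ 2 * (m / L ^ 2) by positivity)
  have h4 := mul_le_mul_of_nonneg_left h2 (show 0 ≤ (m / L ^ 2) ^ 2 by positivity)
  have h5 : 1 - m ^ 2 / L ^ 2 ≤ rate m L ^ 2 := by
    rcases le_total 0 (1 - m ^ 2 / L ^ 2) with h | h
    · rw [rate, Real.sq_sqrt h]
    · exact h.trans (sq_nonneg _)
  have h6 := mul_le_mul_of_nonneg_right h5 (sq_nonneg ‖w - w'‖)
  have h7 : (m / L ^ 2) ^ 2 * (L * ‖w - w'‖) ^ 2 = m ^ 2 / L ^ 2 * ‖w - w'‖ ^ 2 := by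
    field_simp
  have h8 : 2 * (m / L ^ 2) * (m * ‖w - w'‖ ^ 2) = 2 * (m ^ 2 / L ^ 2 * ‖w - w'‖ ^ 2) := by ring
  rw [h7] at h4
  rw [h8] at h3
  linarith

lemma Regular.pgdStep_mem (hM : M.Regular Θ B m L) (hΘ : 0 < Θ) (hB : 0 < B) (η : ℝ)
    (y : Fin n → ℝ) {w : Param d} (hw : w ∈ paramBox d Θ B) :
    M.pgdStep Θ B η y w ∈ paramBox d Θ B := by
  rw [pgdStep_eq hM.symm η y (hM.box_subset hw)]
  exact projBox_mem hΘ hB _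

lemma Regular.exists_fixedPoint (hM : M.Regular Θ B m L) (hΘ : 0 < Θ) (hB : 0 < B) (hm : 0 < m)
    (hL : 0 < L) (y : Fin n → ℝ) {w₀ : Param d} (hw₀ : w₀ ∈ paramBox d Θ B) :
    ∃ w ∈ paramBox d Θ B, M.pgdStep Θ B (m / L ^ 2) y w = w := by
  have hmaps : Set.MapsTo (M.pgdStep Θ B (m / L ^ 2) y) (paramBox d Θ B) (paramBox d Θ B) :=
    fun w hw => hM.pgdStep_mem hΘ hB _ y hw
  have hcon : ContractingWith ⟨rate m L, rate_nonneg m L⟩ (hmaps.restrict _ _ _) := by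
    refine ⟨by exact_mod_cast rate_lt_one hm hL, LipschitzWith.of_dist_le_mul fun u v => ?_⟩
    rw [Subtype.dist_eq, Subtype.dist_eq, dist_eq_norm, dist_eq_norm]
    exact hM.norm_pgdStep_sub_le hm hL y u.2 v.2
  obtain ⟨w, hw, hfix, -⟩ := hcon.exists_fixedPoint' isClosed_paramBox.isComplete hmaps hw₀
    (edist_ne_top _ _)
  exact ⟨w, hw, hfix⟩

/-- If the gradient at an interior point `w₀` of the box is small, then the maximum likelihood
estimate exists, is unique, is close to `w₀`, and attracts projected gradient descent. -/
lemma Regular.exists_isTheMLE (hM : M.Regular Θ B m L) (hn : 0 < n) (hΘ : 0 < Θ) (hB : 0 < B)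
    (hm : 0 < m) (hL : 0 < L) {y : Fin n → ℝ} {w₀ : Param d} {r g : ℝ} (hr : 0 < r)
    (hw₀ : Metric.ball w₀ r ⊆ paramBox d Θ B) (hg : ‖M.gradVec y w₀‖ ≤ g)
    (hgr : m / L ^ 2 / (1 - rate m L) * g < r) :
    ∃ w : Param d, M.IsTheMLE y w ∧ ‖w - w₀‖ ≤ m / L ^ 2 / (1 - rate m L) * g ∧
      ∀ t : ℕ, ‖M.pgd Θ B (m / L ^ 2) y t - w‖ ≤ rate m L ^ t * boxRadius d Θ B := by
  have hw₀b : w₀ ∈ paramBox d Θ B := hw₀ (Metric.mem_ball_self hr)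
  obtain ⟨w, hw, hfix⟩ := hM.exists_fixedPoint hΘ hB hm hL y hw₀b
  have hq := rate_lt_one hm hL
  have hq0 := rate_nonneg m L
  have hdist : ‖w - w₀‖ ≤ m / L ^ 2 / (1 - rate m L) * g := by
    have h1 := hM.norm_pgdStep_sub_le hm hL y hw hw₀b
    have h2 : ‖M.pgdStep Θ B (m / L ^ 2) y w₀ - w₀‖ ≤ m / L ^ 2 * g := by
      have := norm_projBox_sub_le (Θ := Θ) (B := B) (w₀ - (m / L ^ 2) • M.gradVec y w₀) w₀
      rw [projBox_of_mem hw₀b, ← pgdStep_eq hM.symm _ y (hM.box_subset hw₀b), sub_sub_cancel_left,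
        norm_neg, norm_smul, Real.norm_eq_abs, abs_of_pos (by positivity)] at this
      exact this.trans (mul_le_mul_of_nonneg_left hg (by positivity))
    have h3 : ‖w - w₀‖ ≤ ‖M.pgdStep Θ B (m / L ^ 2) y w - M.pgdStep Θ B (m / L ^ 2) y w₀‖ +
        ‖M.pgdStep Θ B (m / L ^ 2) y w₀ - w₀‖ := by
      rw [hfix]
      exact norm_sub_le_norm_sub_add_norm_sub _ _ _
    rw [div_mul_eq_mul_div, le_div_iff₀ (by linarith)]
    linarith
  have hball : Metric.ball w (r - ‖w - w₀‖) ⊆ paramBox d Θ B := by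
    refine (Metric.ball_subset_ball' ?_).trans hw₀
    rw [dist_eq_norm]; linarith
  have hpos : 0 < r - ‖w - w₀‖ := by linarith
  have hcrit : M.gradVec y w = 0 := by
    rw [pgdStep_eq hM.symm _ y (hM.box_subset hw)] at hfix
    have h1 := eq_of_projBox_eq hpos hball hfix
    rw [sub_eq_self, smul_eq_zero] at h1
    exact h1.resolve_left (by positivity)
  refine ⟨w, hM.isTheMLE hn (hM.box_subset hw) hcrit, hdist, fun t => ?_⟩
  have h0 : (0 : Param d) ∈ paramBox d Θ B := fun i => by
    simpa using (halfWidth_pos hΘ hB i).le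
  have key : ∀ t : ℕ, M.pgd Θ B (m / L ^ 2) y t ∈ paramBox d Θ B ∧
      ‖M.pgd Θ B (m / L ^ 2) y t - w‖ ≤ rate m L ^ t * boxRadius d Θ B := by
    intro t
    induction t with
    | zero =>
      refine ⟨h0, ?_⟩
      change ‖(0 : Param d) - w‖ ≤ _
      rw [pow_zero, one_mul, zero_sub, norm_neg]
      exact norm_le_boxRadius hw
    | succ t ih =>
      have e : M.pgd Θ B (m / L ^ 2) y (t + 1) =
          M.pgdStep Θ B (m / L ^ 2) y (M.pgd Θ B (m / L ^ 2) y t) :=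
        Function.iterate_succ_apply' _ _ _
      rw [e]
      refine ⟨hM.pgdStep_mem hΘ hB _ y ih.1, ?_⟩
      have h1 := hM.norm_pgdStep_sub_le hm hL y ih.1 hw
      rw [hfix] at h1
      rw [pow_succ' (rate m L), mul_assoc]
      exact h1.trans (mul_le_mul_of_nonneg_left ih.2 hq0)
  exact (key t).2

end Design

/-! ### Concentration of the gradient at the true parameter -/

namespace Design

variable {n d : ℕ} {M : Design n d}

lemma responseLaw_eq (M : Design n d) (θ₀ : Fin d → ℝ) (β₀ : ℝ)
    (hw : Param.mk θ₀ β₀ (β₀ • θ₀) ∈ M.paramDomain) :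
    M.responseLaw θ₀ β₀ = multivariateGaussian
      (WithLp.toLp 2 (M.meanVec (Param.mk θ₀ β₀ (β₀ • θ₀)))) (M.precision β₀)⁻¹ := by
  have h : M.linTerm (Param.mk θ₀ β₀ (β₀ • θ₀)) = M.precision β₀ *ᵥ (M.X *ᵥ θ₀) := by
    rw [linTerm, Param.kappa_mk, Param.theta_mk, mulVec_smul, mulVec_smul, precision, add_mulVec,
      smul_mulVec]
  have h2 := inv_mulVec_precision hw (M.X *ᵥ θ₀)
  rw [responseLaw, meanVec, Param.beta_mk, h]
  rw [Param.beta_mk] at h2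
  rw [h2]

/-- The likelihood ratio has expectation one under the true parameter, so that it is
unlikely to be large. -/
lemma responseLaw_logLik_sub_ge_le (hA : M.A.IsSymm) {θ₀ : Fin d → ℝ} {β₀ : ℝ}
    (hw₀ : Param.mk θ₀ β₀ (β₀ • θ₀) ∈ M.paramDomain) {w₁ : Param d} (hw₁ : w₁ ∈ M.paramDomain)
    (τ : ℝ) :
    M.responseLaw θ₀ β₀ {y | τ ≤ M.logLik y w₁ - M.logLik y (Param.mk θ₀ β₀ (β₀ • θ₀))} ≤
      ENNReal.ofReal (Real.exp (-τ)) := by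
  rw [responseLaw_eq M θ₀ β₀ hw₀]
  set w₀ := Param.mk θ₀ β₀ (β₀ • θ₀) with hw₀d
  have hpos : ∀ w ∈ M.paramDomain, ∀ z, 0 < gaussianDensity (M.meanVec w) (M.precision w.beta) z :=
    fun w hw z => by rw [← exp_logLik hA hw]; exact Real.exp_pos _
  set g : (Fin n → ℝ) → ℝ≥0∞ := fun z =>
    ENNReal.ofReal (Real.exp (M.logLik z w₁ - M.logLik z w₀)) with hg
  have hg' : g = fun z => ENNReal.ofReal (gaussianDensity (M.meanVec w₁) (M.precision w₁.beta) z /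
      gaussianDensity (M.meanVec w₀) (M.precision w₀.beta) z) := by
    funext z
    rw [hg, ← exp_logLik hA hw₀, ← exp_logLik hA hw₁, ← Real.exp_sub]
  have hgm : Measurable g := by
    rw [hg']
    exact (((continuous_gaussianDensity _ _).div (continuous_gaussianDensity _ _)
      fun z => (hpos w₀ hw₀ z).ne').measurable).ennreal_ofReal
  have hint : ∫⁻ y : EuclideanSpace ℝ (Fin n), g (WithLp.ofLp y) ∂(multivariateGaussian
      (WithLp.toLp 2 (M.meanVec w₀)) (M.precision β₀)⁻¹) = 1 := by
    have hP : (M.precision β₀).PosDef := hw₀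
    rw [lintegral_multivariateGaussian (M.meanVec w₀) hP hgm,
      ← lintegral_gaussianDensity (M.meanVec w₁) hw₁]
    refine lintegral_congr fun z => ?_
    have h0 := hpos w₀ hw₀ z
    have h1 := hpos w₁ hw₁ z
    change g z * ENNReal.ofReal (gaussianDensity (M.meanVec w₀) (M.precision w₀.beta) z) = _
    rw [hg', ← ENNReal.ofReal_mul (by positivity), div_mul_cancel₀ _ h0.ne']
  have hmk := mul_meas_ge_le_lintegral (μ := multivariateGaussian
      (WithLp.toLp 2 (M.meanVec w₀)) (M.precision β₀)⁻¹)
      (f := fun y : EuclideanSpace ℝ (Fin n) => g (WithLp.ofLp y)) (hgm.comp (by fun_prop))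
      (ENNReal.ofReal (Real.exp τ))
  rw [hint] at hmk
  have hset : {y : EuclideanSpace ℝ (Fin n) | τ ≤ M.logLik y w₁ - M.logLik y w₀} ⊆
      {y | ENNReal.ofReal (Real.exp τ) ≤ g (WithLp.ofLp y)} := fun y hy =>
    ENNReal.ofReal_le_ofReal (Real.exp_le_exp.2 hy)
  refine (measure_mono hset).trans ?_
  rw [Real.exp_neg, ENNReal.ofReal_inv_of_pos (Real.exp_pos τ)]
  rw [mul_comm] at hmk
  exact ENNReal.le_inv_iff_mul_le.2 hmk

variable {Θ B m L : ℝ}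

/-- The derivative of the normalized objective in a unit direction `u` is at least `-(τ + L) / √n`
with high probability: otherwise the likelihood ratio of the true parameter moved by `u / √n` would
be large, as the Lipschitz bound controls the second order term. -/
lemma Regular.responseLaw_inner_gradVec_le (hM : M.Regular Θ B m L) (hn : 0 < n) (hL : 0 ≤ L)
    {θ₀ : Fin d → ℝ} {β₀ r : ℝ}
    (hw₀ : Metric.ball (Param.mk θ₀ β₀ (β₀ • θ₀)) r ⊆ paramBox d Θ B) (hr : 1 / √(n : ℝ) < r)
    {u : Param d} (hu : ‖u‖ = 1) (τ : ℝ) :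
    M.responseLaw θ₀ β₀ {y | inner ℝ (M.gradVec y (Param.mk θ₀ β₀ (β₀ • θ₀))) u ≤
      -((τ + L) / √n)} ≤ ENNReal.ofReal (Real.exp (-τ)) := by
  have hn' : (0 : ℝ) < n := by exact_mod_cast hn
  have hsn : 0 < √(n : ℝ) := Real.sqrt_pos.2 hn'
  set w₀ := Param.mk θ₀ β₀ (β₀ • θ₀) with hw₀d
  set w₁ := w₀ + (1 / √(n : ℝ)) • u with hw₁
  have hr0 : 0 < r := lt_trans (by positivity) hr
  have hnorm : ∀ t : ℝ, 0 ≤ t → t ≤ 1 → w₀ + t • (w₁ - w₀) ∈ paramBox d Θ B := by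
    intro t ht0 ht1
    refine hw₀ ?_
    rw [Metric.mem_ball, dist_eq_norm, hw₁, add_sub_cancel_left, add_sub_cancel_left, norm_smul,
      norm_smul, hu, mul_one, Real.norm_eq_abs, Real.norm_eq_abs, abs_of_nonneg ht0,
      abs_of_pos (by positivity)]
    have : t * (1 / √(n : ℝ)) ≤ 1 * (1 / √(n : ℝ)) := by gcongr
    linarith
  have hw₀b : w₀ ∈ paramBox d Θ B := hw₀ (Metric.mem_ball_self hr0)
  have hw₁b : w₁ ∈ paramBox d Θ B := by simpa using hnorm 1 zero_le_one le_rfl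
  refine le_trans (measure_mono fun y hy => ?_) (responseLaw_logLik_sub_ge_le hM.symm
    (hM.box_subset hw₀b) (hM.box_subset hw₁b) τ)
  obtain ⟨t, ht0, ht1, ht⟩ := exists_objective_sub_eq hM.symm y (hM.box_subset hw₀b)
    (hM.box_subset hw₁b)
  have hlip := hM.lipschitz y _ (hnorm t ht0.le ht1.le) w₀ hw₀b
  have hd : ‖w₁ - w₀‖ = 1 / √(n : ℝ) := by
    rw [hw₁, add_sub_cancel_left, norm_smul, hu, mul_one, Real.norm_eq_abs,
      abs_of_pos (by positivity)]
  have hcs := real_inner_le_norm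
    (M.gradVec y (w₀ + t • (w₁ - w₀)) - M.gradVec y w₀) (w₁ - w₀)
  rw [add_sub_cancel_left w₀ (t • (w₁ - w₀)), norm_smul, hd, Real.norm_eq_abs,
    abs_of_pos ht0] at hlip
  rw [inner_sub_left, hd] at hcs
  have hy' : inner ℝ (M.gradVec y w₀) u ≤ -((τ + L) / √n) := hy
  have hin : inner ℝ (M.gradVec y w₀) (w₁ - w₀) =
      1 / √(n : ℝ) * inner ℝ (M.gradVec y w₀) u := by
    rw [hw₁, add_sub_cancel_left, inner_smul_right]
  have hobj := M.logLik_eq hn y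
  change τ ≤ M.logLik y w₁ - M.logLik y w₀
  rw [hobj, hobj]
  have e1 : n * (M.objective y w₁ - M.objective y w₀) ≤ -τ := by
    have h1 : ‖M.gradVec y (w₀ + t • (w₁ - w₀)) - M.gradVec y w₀‖ ≤ L * (1 / √(n : ℝ)) := by
      refine hlip.trans (mul_le_mul_of_nonneg_left ?_ hL)
      calc t * (1 / √(n : ℝ)) ≤ 1 * (1 / √(n : ℝ)) := by gcongr
        _ = _ := one_mul _
    have h2 := mul_le_mul_of_nonneg_right h1 (show 0 ≤ 1 / √(n : ℝ) by positivity)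
    have h3 := mul_le_mul_of_nonneg_left hy' (show 0 ≤ 1 / √(n : ℝ) by positivity)
    have h4 : M.objective y w₁ - M.objective y w₀ ≤
        L * (1 / √(n : ℝ)) * (1 / √(n : ℝ)) + 1 / √(n : ℝ) * -((τ + L) / √n) := by
      rw [ht]; linarith
    have h5 := mul_le_mul_of_nonneg_left h4 hn'.le
    refine h5.trans (le_of_eq ?_)
    field_simp
    linear_combination (-τ) * (Real.sq_sqrt hn'.le).symm
  linarith

/-- The gradient at the true parameter is of order `1 / √n` with high probability. -/
lemma Regular.responseLaw_norm_gradVec_le (hM : M.Regular Θ B m L) (hn : 0 < n) (hL : 0 ≤ L)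
    {θ₀ : Fin d → ℝ} {β₀ r : ℝ}
    (hw₀ : Metric.ball (Param.mk θ₀ β₀ (β₀ • θ₀)) r ⊆ paramBox d Θ B) (hr : 1 / √(n : ℝ) < r)
    (τ : ℝ) :
    M.responseLaw θ₀ β₀ {y | ¬ ‖M.gradVec y (Param.mk θ₀ β₀ (β₀ • θ₀))‖ ≤
      (2 * d + 1) * ((τ + L) / √n)} ≤ ENNReal.ofReal (2 * (2 * d + 1) * Real.exp (-τ)) := by
  set w₀ := Param.mk θ₀ β₀ (β₀ • θ₀) with hw₀d
  set S : (Fin d ⊕ Unit ⊕ Fin d) × Bool → Set (EuclideanSpace ℝ (Fin n)) := fun i =>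
    {y | inner ℝ (M.gradVec y w₀) ((if i.2 then 1 else -1 : ℝ) •
      EuclideanSpace.single i.1 (1 : ℝ)) ≤ -((τ + L) / √n)} with hS
  have hsub : {y : EuclideanSpace ℝ (Fin n) | ¬ ‖M.gradVec y w₀‖ ≤
      (2 * d + 1) * ((τ + L) / √n)} ⊆ ⋃ i, S i := by
    intro y hy
    by_contra hcon
    simp only [Set.mem_iUnion, not_exists] at hcon
    refine hy ?_
    have hcoord : ∀ i, |M.gradVec y w₀ i| ≤ (τ + L) / √n := by
      intro i
      have h1 := hcon (i, true)
      have h2 := hcon (i, false)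
      simp only [hS, Set.mem_ofPred_eq, not_le, inner_smul_right, EuclideanSpace.inner_single_right,
        if_true, Bool.false_eq_true, if_false, one_mul, conj_trivial] at h1 h2
      rw [abs_le]
      constructor <;> linarith
    have hsum : ‖M.gradVec y w₀‖ ≤ ∑ i, |M.gradVec y w₀ i| := by
      rw [EuclideanSpace.norm_eq]
      refine Real.sqrt_le_iff.2 ⟨Finset.sum_nonneg fun i _ => abs_nonneg _, ?_⟩
      simp only [Real.norm_eq_abs]
      exact Finset.sum_sq_le_sq_sum_of_nonneg fun i _ => abs_nonneg _
    refine hsum.trans ((Finset.sum_le_sum fun i _ => hcoord i).trans (le_of_eq ?_))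
    simp only [Finset.sum_const, Finset.card_univ, Fintype.card_sum, Fintype.card_fin,
      Fintype.card_unit, nsmul_eq_mul]
    push_cast
    ring
  have hSi : ∀ i, M.responseLaw θ₀ β₀ (S i) ≤ ENNReal.ofReal (Real.exp (-τ)) := fun i =>
    hM.responseLaw_inner_gradVec_le hn hL hw₀ hr (by
      rw [norm_smul, PiLp.norm_single, norm_one, mul_one]
      split_ifs <;> simp) τ
  refine (measure_mono hsub).trans ((measure_iUnion_fintype_le _ _).trans
    ((Finset.sum_le_sum fun i _ => hSi i).trans (le_of_eq ?_)))
  rw [Finset.sum_const, ← ENNReal.ofReal_nsmul]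
  congr 1
  simp only [Finset.card_univ, Fintype.card_sum, Fintype.card_fin, Fintype.card_prod,
    Fintype.card_bool, Fintype.card_unit, nsmul_eq_mul]
  push_cast
  ring

/-- For every `δ` there is a `G` such that the gradient at the true parameter is at most `G / √n`
with probability at least `1 - δ`; `G` depends only on `δ`, `d` and the Lipschitz constant. -/
lemma exists_norm_gradVec_bound (d : ℕ) {L : ℝ} (hL : 0 ≤ L) {δ : ℝ} (hδ : 0 < δ) :
    ∃ G : ℝ, 0 ≤ G ∧ ∀ (n : ℕ) (M : Design n d) (Θ B m : ℝ), M.Regular Θ B m L → 0 < n →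
      ∀ (θ₀ : Fin d → ℝ) (β₀ r : ℝ), Metric.ball (Param.mk θ₀ β₀ (β₀ • θ₀)) r ⊆ paramBox d Θ B →
      1 / √(n : ℝ) < r → M.responseLaw θ₀ β₀ {y | ¬ ‖M.gradVec y (Param.mk θ₀ β₀ (β₀ • θ₀))‖ ≤
        G / √n} ≤ ENNReal.ofReal δ := by
  set τ := |Real.log (δ / (2 * (2 * d + 1)))| with hτ
  refine ⟨(2 * d + 1) * (τ + L), by positivity, fun n M Θ B m hM hn θ₀ β₀ r hball hr => ?_⟩
  have h := hM.responseLaw_norm_gradVec_le hn hL hball hr τ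
  rw [← mul_div_assoc] at h
  refine h.trans (ENNReal.ofReal_le_ofReal ?_)
  have h1 : Real.exp (-τ) ≤ δ / (2 * (2 * d + 1)) := by
    rw [← Real.exp_log (show 0 < δ / (2 * (2 * (d : ℝ) + 1)) by positivity), Real.exp_le_exp, hτ]
    exact neg_abs_le _
  rw [le_div_iff₀ (by positivity)] at h1
  linarith

end Design

/-! ### Consistency of the estimate and convergence of the iteration -/

open Design in
/-- With probability at least `1 - δ`, the maximum likelihood estimate exists, is unique, is within
`C / √n` of the true parameter, and attracts projected gradient descent at a geometric rate. -/
lemma exists_estimate_bound (d : ℕ) {Θ B m L : ℝ} (hΘ : 0 < Θ) (hB : 0 < B) (hm : 0 < m)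
    (hL : 0 < L) {δ : ℝ} (hδ : 0 < δ) :
    ∃ C : ℝ, 0 < C ∧ ∀ (θ₀ : Fin d → ℝ) (β₀ : ℝ),
      Param.mk θ₀ β₀ (β₀ • θ₀) ∈ interior (paramBox d Θ B) → ∃ n₀ : ℕ, 0 < n₀ ∧
        ∀ n : ℕ, n₀ ≤ n → ∀ M : Design n d, M.Regular Θ B m L →
          M.responseLaw θ₀ β₀ {y | ¬ ∃ w : Param d, M.IsTheMLE y w ∧
            ‖w - Param.mk θ₀ β₀ (β₀ • θ₀)‖ ≤ C / √(n : ℝ) ∧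
            ∀ t : ℕ, ‖M.pgd Θ B (m / L ^ 2) y t - w‖ ≤ rate m L ^ t * boxRadius d Θ B} ≤
          ENNReal.ofReal δ := by
  obtain ⟨G, hG, hGb⟩ := exists_norm_gradVec_bound d hL.le hδ
  have hq := rate_lt_one hm hL
  have hq' : 0 < 1 - rate m L := by linarith
  set s := m / L ^ 2 / (1 - rate m L) with hs
  have hs0 : 0 < s := by positivity
  refine ⟨s * G + 1, by positivity, fun θ₀ β₀ hint => ?_⟩
  obtain ⟨r, hr, hball⟩ := Metric.isOpen_iff.1 isOpen_interior _ hint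
  have hball' := hball.trans interior_subset
  obtain ⟨n₀, hn₀⟩ := exists_nat_gt (((s * G + 1) / r) ^ 2)
  refine ⟨n₀ + 1, Nat.succ_pos _, fun n hn M hM => ?_⟩
  have hnpos : 0 < n := by omega
  have hn' : (0 : ℝ) < n := by exact_mod_cast hnpos
  have hsn : 0 < √(n : ℝ) := Real.sqrt_pos.2 hn'
  have hlt : (s * G + 1) / √(n : ℝ) < r := by
    rw [div_lt_iff₀ hsn, ← div_lt_iff₀' hr]
    refine Real.lt_sqrt_of_sq_lt (hn₀.trans_le ?_)
    exact_mod_cast (Nat.le_succ n₀).trans hn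
  have h1 : 1 / √(n : ℝ) < r := by
    refine lt_of_le_of_lt ?_ hlt
    gcongr
    have := mul_nonneg hs0.le hG
    linarith
  refine (measure_mono fun y hy => ?_).trans (hGb n M Θ B m hM hnpos θ₀ β₀ r hball' h1)
  intro hgrad
  have hsG : s * (G / √(n : ℝ)) ≤ (s * G + 1) / √(n : ℝ) := by
    rw [← mul_div_assoc]; gcongr; linarith
  obtain ⟨w, hw1, hw2, hw3⟩ := hM.exists_isTheMLE hnpos hΘ hB hm hL hr hball' hgrad
    (hsG.trans_lt hlt)
  exact hy ⟨w, hw1, hw2.trans hsG, hw3⟩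

/-- After `K ln n` steps a geometric sequence is below `1 / √n`. -/
lemma exists_pow_le_inv_sqrt {q : ℝ} (hq0 : 0 ≤ q) (hq1 : q < 1) :
    ∃ K : ℝ, 0 < K ∧ ∀ n : ℕ, 0 < n → ∀ t : ℕ, K * Real.log n ≤ t → q ^ t ≤ 1 / √(n : ℝ) := by
  -- `q` may be zero, so that a positive upper bound is used for the logarithm
  set p := max q (1 / 2) with hp
  have hp0 : 0 < p := lt_of_lt_of_le (by norm_num) (le_max_right _ _)
  have hp1 : p < 1 := max_lt hq1 (by norm_num)
  have hlog : Real.log p < 0 := Real.log_neg hp0 hp1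
  refine ⟨1 / (2 * -Real.log p), by
    have : 0 < -Real.log p := by linarith
    positivity, fun n hn t ht => ?_⟩
  have hn' : (0 : ℝ) < n := by exact_mod_cast hn
  refine (pow_le_pow_left₀ hq0 (le_max_left q (1 / 2)) t).trans ?_
  rw [← hp]
  have h1 : p ^ t = Real.exp (t * Real.log p) := by
    rw [← Real.log_pow, Real.exp_log (by positivity)]
  have h2 : 1 / √(n : ℝ) = Real.exp (-(Real.log n / 2)) := by
    rw [Real.exp_neg, ← Real.log_sqrt hn'.le, Real.exp_log (Real.sqrt_pos.2 hn'), one_div]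
  rw [h1, h2, Real.exp_le_exp]
  rw [one_div, ← div_eq_inv_mul, div_le_iff₀ (by linarith)] at ht
  linarith

/-! ### Cost of programs -/

/-- The loop bound is a constant or one of the two input sizes. -/
def IdxExpr.IsSize : IdxExpr → Prop
  | .const _ => True
  | .var v => v < 2

/-- The bounds of all loops are constants or input sizes, and no loop overwrites the input
sizes. Loops may be nested arbitrarily. -/
def Prog.SizeBounded : Prog → Prop
  | .skip => True
  | .assign _ _ _ _ => True
  | .seq p q => p.SizeBounded ∧ q.SizeBounded
  | .ifLe _ _ p q => p.SizeBounded ∧ q.SizeBounded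
  | .forLoop v b p => 2 ≤ v ∧ b.IsSize ∧ p.SizeBounded

lemma IdxExpr.IsSize.exists_le {b : IdxExpr} (hb : b.IsSize) :
    ∃ c : ℕ, ∀ m : Memory, b.eval m ≤ c * (m.idx 0 + m.idx 1 + 1) := by
  cases b with
  | const k => exact ⟨k, fun m => Nat.le_mul_of_pos_right k (Nat.succ_pos _)⟩
  | var v =>
    refine ⟨1, fun m => ?_⟩
    have : v < 2 := hb
    change m.idx v ≤ _
    interval_cases v <;> omega

lemma Prog.run_forLoop_succ_aux (v : ℕ) (p : Prog) (m : Memory) (N : ℕ) (P : ℕ → Memory × ℕ → Prop)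
    (h0 : P 0 (m, 1)) (hs : ∀ k < N, ∀ r, P k r →
      P (k + 1) ((p.run (r.1.setIdx v k)).1, r.2 + (p.run (r.1.setIdx v k)).2 + 1)) :
    P N (Nat.rec (m, 1)
        (fun k r => ((p.run (r.1.setIdx v k)).1, r.2 + (p.run (r.1.setIdx v k)).2 + 1)) N) := by
  induction N with
  | zero => exact h0
  | succ N ih => exact hs N (Nat.lt_succ_self N) _ (ih fun k hk => hs k (hk.trans (Nat.lt_succ_self N)))

/-- The invariant rule for loops; the invariant speaks of the memory and of the steps so far. -/
lemma Prog.forLoop_invariant (v : ℕ) (b : IdxExpr) (p : Prog) (m : Memory)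
    (P : ℕ → Memory × ℕ → Prop) (h0 : P 0 (m, 1)) (hs : ∀ k < b.eval m, ∀ r, P k r →
      P (k + 1) ((p.run (r.1.setIdx v k)).1, r.2 + (p.run (r.1.setIdx v k)).2 + 1)) :
    P (b.eval m) ((Prog.forLoop v b p).run m) :=
  Prog.run_forLoop_succ_aux v p m (b.eval m) P h0 hs

/-- A program whose loops are bounded by the input sizes runs in polynomial time. -/
lemma Prog.SizeBounded.exists_cost_le {p : Prog} (hp : p.SizeBounded) :
    ∃ c k : ℕ, ∀ m : Memory, (p.run m).2 ≤ c * (m.idx 0 + m.idx 1 + 1) ^ k ∧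
      (p.run m).1.idx 0 = m.idx 0 ∧ (p.run m).1.idx 1 = m.idx 1 := by
  induction p with
  | skip => exact ⟨1, 0, fun m => ⟨by simp [Prog.run], rfl, rfl⟩⟩
  | assign a i j e => exact ⟨e.cost + 1, 0, fun m => ⟨by simp [Prog.run], rfl, rfl⟩⟩
  | seq p q ihp ihq =>
    obtain ⟨c₁, k₁, h₁⟩ := ihp hp.1
    obtain ⟨c₂, k₂, h₂⟩ := ihq hp.2
    refine ⟨c₁ + c₂, k₁ + k₂, fun m => ?_⟩
    obtain ⟨a1, a2, a3⟩ := h₁ m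
    obtain ⟨b1, b2, b3⟩ := h₂ (p.run m).1
    rw [a2, a3] at b1
    refine ⟨?_, b2.trans a2, b3.trans a3⟩
    change (p.run m).2 + (q.run (p.run m).1).2 ≤ _
    set s := m.idx 0 + m.idx 1 + 1
    have hs : 0 < s := Nat.succ_pos _
    have e1 : s ^ k₁ ≤ s ^ (k₁ + k₂) := Nat.pow_le_pow_right hs (Nat.le_add_right _ _)
    have e2 : s ^ k₂ ≤ s ^ (k₁ + k₂) := Nat.pow_le_pow_right hs (Nat.le_add_left _ _)
    nlinarith [Nat.mul_le_mul_left c₁ e1, Nat.mul_le_mul_left c₂ e2]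
  | ifLe e f p q ihp ihq =>
    obtain ⟨c₁, k₁, h₁⟩ := ihp hp.1
    obtain ⟨c₂, k₂, h₂⟩ := ihq hp.2
    refine ⟨e.cost + f.cost + 1 + c₁ + c₂, k₁ + k₂, fun m => ?_⟩
    obtain ⟨a1, a2, a3⟩ := h₁ m
    obtain ⟨b1, b2, b3⟩ := h₂ m
    set s := m.idx 0 + m.idx 1 + 1
    have hs : 0 < s := Nat.succ_pos _
    have e1 : s ^ k₁ ≤ s ^ (k₁ + k₂) := Nat.pow_le_pow_right hs (Nat.le_add_right _ _)
    have e2 : s ^ k₂ ≤ s ^ (k₁ + k₂) := Nat.pow_le_pow_right hs (Nat.le_add_left _ _)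
    have e3 : 1 ≤ s ^ (k₁ + k₂) := Nat.one_le_pow _ _ hs
    have f1 := Nat.mul_le_mul_left c₁ e1
    have f2 := Nat.mul_le_mul_left c₂ e2
    have f3 := Nat.mul_le_mul_left (e.cost + f.cost + 1) e3
    have f4 := Nat.zero_le (c₁ * s ^ (k₁ + k₂))
    have f5 := Nat.zero_le (c₂ * s ^ (k₁ + k₂))
    rw [add_mul, add_mul]
    rw [Prog.run]
    split_ifs with h
    · exact ⟨by linarith, a2, a3⟩
    · exact ⟨by linarith, b2, b3⟩
  | forLoop v b p ih =>
    obtain ⟨hv, hb, hp⟩ := hp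
    obtain ⟨c, k, h⟩ := ih hp
    obtain ⟨c', hc'⟩ := hb.exists_le
    refine ⟨1 + c' * (c + 1), k + 1, fun m => ?_⟩
    have hbm := hc' m
    set s := m.idx 0 + m.idx 1 + 1 with hsd
    have hs : 0 < s := Nat.succ_pos _
    have key := Prog.forLoop_invariant v b p m (fun N r => r.2 ≤ 1 + N * (c * s ^ k + 1) ∧
      r.1.idx 0 = m.idx 0 ∧ r.1.idx 1 = m.idx 1) ⟨by simp, rfl, rfl⟩ (by
        rintro N - r ⟨h1, h2, h3⟩
        obtain ⟨a1, a2, a3⟩ := h (r.1.setIdx v N)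
        have i0 : (r.1.setIdx v N).idx 0 = m.idx 0 :=
          (Function.update_of_ne (by omega) _ _).trans h2
        have i1 : (r.1.setIdx v N).idx 1 = m.idx 1 :=
          (Function.update_of_ne (by omega) _ _).trans h3
        rw [i0, i1, ← hsd] at a1
        refine ⟨?_, a2.trans i0, a3.trans i1⟩
        change r.2 + _ + 1 ≤ _
        rw [add_mul, one_mul]
        omega)
    refine ⟨key.1.trans ?_, key.2⟩
    have e1 : 1 ≤ s ^ k := Nat.one_le_pow _ _ hs
    calc 1 + b.eval m * (c * s ^ k + 1) ≤ 1 + (c' * s) * (c * s ^ k + s ^ k) := by gcongr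
      _ = 1 + c' * (c + 1) * s ^ (k + 1) := by ring
      _ ≤ s ^ (k + 1) + c' * (c + 1) * s ^ (k + 1) := by
        gcongr; exact Nat.one_le_pow _ _ hs
      _ = (1 + c' * (c + 1)) * s ^ (k + 1) := by ring

/-! ### Program schemes -/

/-- The memory `m'` differs from `m` only in the array `a` and in the loop variables 2, 3, 4. -/
structure Memory.Frame (a : ℕ) (m m' : Memory) : Prop where
  idx : ∀ v, v < 2 ∨ 4 < v → m'.idx v = m.idx v
  arr : ∀ a', a' ≠ a → m'.arr a' = m.arr a'

namespace Memory

lemma Frame.refl (a : ℕ) (m : Memory) : Frame a m m := ⟨fun _ _ => rfl, fun _ _ => rfl⟩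

lemma Frame.setIdx {a : ℕ} {m m' : Memory} (h : Frame a m m') {v : ℕ} (hv : 2 ≤ v ∧ v ≤ 4)
    (k : ℕ) : Frame a m (m'.setIdx v k) :=
  ⟨fun u hu => (Function.update_of_ne (by omega) _ _).trans (h.idx u hu), h.arr⟩

lemma Frame.setCell {a : ℕ} {m m' : Memory} (h : Frame a m m') (i j : ℕ) (x : ℝ) :
    Frame a m (m'.setCell a i j x) := by
  refine ⟨h.idx, fun a' ha' => ?_⟩
  rw [← h.arr a' ha']
  funext i' j'
  simp [Memory.setCell, ha']

@[simp] lemma setIdx_idx (m : Memory) (v k u : ℕ) :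
    (m.setIdx v k).idx u = if u = v then k else m.idx u := by
  simp [Memory.setIdx, Function.update_apply]

@[simp] lemma setIdx_arr (m : Memory) (v k : ℕ) : (m.setIdx v k).arr = m.arr := rfl

@[simp] lemma setCell_idx (m : Memory) (a i j : ℕ) (x : ℝ) : (m.setCell a i j x).idx = m.idx := rfl

lemma setCell_arr (m : Memory) (a i j : ℕ) (x : ℝ) (i' j' : ℕ) :
    (m.setCell a i j x).arr a i' j' = if i' = i ∧ j' = j then x else m.arr a i' j' := by
  simp [Memory.setCell]

end Memory

/-- The loop rule for loops whose iterations establish independent properties `Q k`, under a common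
invariant `R`. -/
lemma Prog.forLoop_forall (v : ℕ) (b : IdxExpr) (p : Prog) (m : Memory) (R : Memory → Prop)
    (Q : ℕ → Memory → Prop) (h0 : R m) (hs : ∀ k < b.eval m, ∀ m', R m' →
      R (p.run (m'.setIdx v k)).1 ∧ Q k (p.run (m'.setIdx v k)).1 ∧
        ∀ k' < k, Q k' m' → Q k' (p.run (m'.setIdx v k)).1) :
    R ((Prog.forLoop v b p).run m).1 ∧
      ∀ k < b.eval m, Q k ((Prog.forLoop v b p).run m).1 := by
  refine Prog.forLoop_invariant v b p m (fun N r => R r.1 ∧ ∀ k < N, Q k r.1)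
    ⟨h0, fun k hk => absurd hk (Nat.not_lt_zero k)⟩ ?_
  rintro k hk r ⟨h1, h2⟩
  obtain ⟨h3, h4, h5⟩ := hs k hk r.1 h1
  refine ⟨h3, fun k' hk' => ?_⟩
  rcases Nat.lt_succ_iff_lt_or_eq.1 hk' with h | rfl
  · exact h5 k' h (h2 k' h)
  · exact h4

/-- `a[i][j] := ∑ k < b₃, e`, for the current values `i`, `j` of the loop variables 2 and 3; the
summation variable is 4. -/
def accumulate (a : ℕ) (b₃ : IdxExpr) (e : RealExpr) : Prog :=
  .seq (.assign a (.var 2) (.var 3) (.const 0))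
    (.forLoop 4 b₃ (.assign a (.var 2) (.var 3) (.add (.cell a (.var 2) (.var 3)) e)))

lemma accumulate_spec {a : ℕ} {b₃ : IdxExpr} {e : RealExpr} {m m₁ : Memory} {i j N : ℕ}
    {f : ℕ → ℝ} (hm₁ : Memory.Frame a m m₁) (hi : m₁.idx 2 = i) (hj : m₁.idx 3 = j)
    (hb : ∀ m', Memory.Frame a m m' → b₃.eval m' = N)
    (he : ∀ k < N, ∀ m', Memory.Frame a m m' → m'.idx 2 = i → m'.idx 3 = j → m'.idx 4 = k →
      e.eval m' = f k) :
    Memory.Frame a m ((accumulate a b₃ e).run m₁).1 ∧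
    ((accumulate a b₃ e).run m₁).1.idx 2 = i ∧
    ((accumulate a b₃ e).run m₁).1.arr a i j = ∑ k ∈ Finset.range N, f k ∧
    ∀ i' j', ¬ (i' = i ∧ j' = j) →
      ((accumulate a b₃ e).run m₁).1.arr a i' j' = m₁.arr a i' j' := by
  set m₂ := m₁.setCell a i j 0 with hm₂
  have hrun : ((accumulate a b₃ e).run m₁).1 = ((Prog.forLoop 4 b₃ (.assign a (.var 2) (.var 3)
      (.add (.cell a (.var 2) (.var 3)) e))).run m₂).1 := by
    simp only [accumulate, Prog.run, IdxExpr.eval, RealExpr.eval, hi, hj, Int.cast_zero, hm₂]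
  have hF₂ : Memory.Frame a m m₂ := hm₁.setCell i j 0
  have key := Prog.forLoop_invariant 4 b₃ (.assign a (.var 2) (.var 3)
      (.add (.cell a (.var 2) (.var 3)) e)) m₂ (fun K r => Memory.Frame a m r.1 ∧
        r.1.idx 2 = i ∧ r.1.idx 3 = j ∧ r.1.arr a i j = ∑ k ∈ Finset.range K, f k ∧
        ∀ i' j', ¬ (i' = i ∧ j' = j) → r.1.arr a i' j' = m₁.arr a i' j')
    ⟨hF₂, hi, hj, by simp [hm₂, Memory.setCell_arr], fun i' j' h => by
      rw [hm₂, Memory.setCell_arr, if_neg h]⟩ ?_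
  · rw [hb m₂ hF₂] at key
    rw [hrun]
    exact ⟨key.1, key.2.1, key.2.2.2⟩
  · rintro k hk r ⟨h1, h2, h3, h4, h5⟩
    rw [hb m₂ hF₂] at hk
    have hF := h1.setIdx (v := 4) (by omega) k
    have i2 : (r.1.setIdx 4 k).idx 2 = i := by simpa using h2
    have i3 : (r.1.setIdx 4 k).idx 3 = j := by simpa using h3
    have he' := he k hk (r.1.setIdx 4 k) hF i2 i3 (by simp)
    simp only [Prog.run, IdxExpr.eval, RealExpr.eval, he', i2, i3, Memory.setIdx_arr,
      Memory.setCell_idx]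
    refine ⟨hF.setCell _ _ _, trivial, trivial, ?_, fun i' j' h => ?_⟩
    · simp [Memory.setCell_arr, h4, Finset.sum_range_succ]
    · rw [Memory.setCell_arr, if_neg h]
      exact h5 i' j' h

/-- `a[i][j] := ∑ k < b₃, e` for all `i < b₁`, `j < b₂`. -/
def sumFill (a : ℕ) (b₁ b₂ b₃ : IdxExpr) (e : RealExpr) : Prog :=
  .forLoop 2 b₁ (.forLoop 3 b₂ (accumulate a b₃ e))

lemma sumFill_spec {a : ℕ} {b₁ b₂ b₃ : IdxExpr} {e : RealExpr} {m : Memory} {N₁ N₂ N₃ : ℕ}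
    (f : Fin N₁ → Fin N₂ → Fin N₃ → ℝ)
    (hb₁ : b₁.eval m = N₁) (hb₂ : ∀ m', Memory.Frame a m m' → b₂.eval m' = N₂)
    (hb₃ : ∀ m', Memory.Frame a m m' → b₃.eval m' = N₃)
    (he : ∀ (i : Fin N₁) (j : Fin N₂) (k : Fin N₃), ∀ m', Memory.Frame a m m' →
      m'.idx 2 = i → m'.idx 3 = j → m'.idx 4 = k → e.eval m' = f i j k) :
    Memory.Frame a m ((sumFill a b₁ b₂ b₃ e).run m).1 ∧
    ∀ (i : Fin N₁) (j : Fin N₂), ((sumFill a b₁ b₂ b₃ e).run m).1.arr a i j = ∑ k, f i j k := by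
  -- the summands extended by zero, so that sums over `Finset.range` can be used
  set g : ℕ → ℕ → ℕ → ℝ := fun i j k =>
    if h : i < N₁ ∧ j < N₂ ∧ k < N₃ then f ⟨i, h.1⟩ ⟨j, h.2.1⟩ ⟨k, h.2.2⟩ else 0 with hg
  have hsum : ∀ (i : Fin N₁) (j : Fin N₂), ∑ k ∈ Finset.range N₃, g i j k = ∑ k, f i j k := by
    intro i j
    rw [Finset.sum_range]
    refine Finset.sum_congr rfl fun k _ => ?_
    rw [hg]
    simp [i.2, j.2, k.2]
  have inner : ∀ i < N₁, ∀ m₁, Memory.Frame a m m₁ → m₁.idx 2 = i →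
      (Memory.Frame a m ((Prog.forLoop 3 b₂ (accumulate a b₃ e)).run m₁).1 ∧
        ((Prog.forLoop 3 b₂ (accumulate a b₃ e)).run m₁).1.idx 2 = i ∧
        ∀ i' j', i' ≠ i → ((Prog.forLoop 3 b₂ (accumulate a b₃ e)).run m₁).1.arr a i' j' =
          m₁.arr a i' j') ∧
      ∀ j < N₂, ((Prog.forLoop 3 b₂ (accumulate a b₃ e)).run m₁).1.arr a i j =
        ∑ k ∈ Finset.range N₃, g i j k := by
    intro i hi m₁ hm₁ hi₁
    have := Prog.forLoop_forall 3 b₂ (accumulate a b₃ e) m₁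
      (fun r => Memory.Frame a m r ∧ r.idx 2 = i ∧ ∀ i' j', i' ≠ i → r.arr a i' j' = m₁.arr a i' j')
      (fun j r => r.arr a i j = ∑ k ∈ Finset.range N₃, g i j k)
      ⟨hm₁, hi₁, fun _ _ _ => rfl⟩ ?_
    · rwa [hb₂ m₁ hm₁] at this
    · rintro j hj r ⟨h1, h2, h3⟩
      rw [hb₂ m₁ hm₁] at hj
      obtain ⟨a1, a2, a3, a4⟩ := accumulate_spec (f := g i j) (i := i) (j := j)
        (h1.setIdx (v := 3) (by omega) j) (by simpa using h2) (by simp) hb₃ (by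
          intro k hk m' hm' e1 e2 e3
          have := he ⟨i, hi⟩ ⟨j, hj⟩ ⟨k, hk⟩ m' hm' e1 e2 e3
          rw [this, hg]
          simp [hi, hj, hk])
      refine ⟨⟨a1, a2, fun i' j' h => ?_⟩, a3, fun j' hj' h => ?_⟩
      · rw [a4 i' j' fun hc => h hc.1]; exact h3 i' j' h
      · rw [a4 i j' fun hc => hj'.ne hc.2]; exact h
  have outer := Prog.forLoop_forall 2 b₁ (Prog.forLoop 3 b₂ (accumulate a b₃ e)) m
    (fun r => Memory.Frame a m r)
    (fun i r => ∀ j < N₂, r.arr a i j = ∑ k ∈ Finset.range N₃, g i j k) (Memory.Frame.refl a m) ?_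
  · refine ⟨outer.1, fun i j => ?_⟩
    rw [← hsum]
    exact outer.2 i (by rw [hb₁]; exact i.2) j j.2
  · intro i hi r hr
    rw [hb₁] at hi
    obtain ⟨⟨h1, h2, h3⟩, h4⟩ := inner i hi (r.setIdx 2 i) (hr.setIdx (by omega) i) (by simp)
    exact ⟨h1, h4, fun i' hi' h j hj => by rw [h3 i' j hi'.ne]; exact h j hj⟩

/-- `a[i][i] := 1` for all `i < b`. -/
def diagFill (a : ℕ) (b : IdxExpr) : Prog :=
  .forLoop 2 b (.assign a (.var 2) (.var 2) (.const 1))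

lemma diagFill_spec (a : ℕ) {b : IdxExpr} {m : Memory} {N : ℕ} (hb : b.eval m = N) :
    Memory.Frame a m ((diagFill a b).run m).1 ∧
    (∀ i < N, ((diagFill a b).run m).1.arr a i i = 1) ∧
    ∀ i j, i ≠ j → ((diagFill a b).run m).1.arr a i j = m.arr a i j := by
  have h := Prog.forLoop_forall 2 b (.assign a (.var 2) (.var 2) (.const 1)) m
    (fun r => Memory.Frame a m r ∧ ∀ i j, i ≠ j → r.arr a i j = m.arr a i j)
    (fun i r => r.arr a i i = 1) ⟨Memory.Frame.refl a m, fun _ _ _ => rfl⟩ ?_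
  · rw [hb] at h
    exact ⟨h.1.1, h.2, h.1.2⟩
  · rintro k hk r ⟨h1, h2⟩
    simp only [Prog.run, IdxExpr.eval, RealExpr.eval, Int.cast_one]
    refine ⟨⟨(h1.setIdx (by omega) k).setCell _ _ _, fun i j hij => ?_⟩, ?_, fun k' hk' h => ?_⟩
    · rw [Memory.setCell_arr, if_neg (by rintro ⟨rfl, rfl⟩; exact hij rfl)]; exact h2 i j hij
    · simp [Memory.setCell_arr]
    · rw [Memory.setCell_arr]; split_ifs
      · rfl
      · exact h

/-- `a[i][0] := max (-e) (min e s[i][0])`, for the current value `i` of the loop variable 2. -/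
def clipEntry (a s : ℕ) (e : RealExpr) : Prog :=
  .ifLe (.cell s (.var 2) (.const 0)) e
    (.ifLe (.sub (.const 0) e) (.cell s (.var 2) (.const 0))
      (.assign a (.var 2) (.const 0) (.cell s (.var 2) (.const 0)))
      (.assign a (.var 2) (.const 0) (.sub (.const 0) e)))
    (.ifLe (.sub (.const 0) e) e (.assign a (.var 2) (.const 0) e)
      (.assign a (.var 2) (.const 0) (.sub (.const 0) e)))

/-- `a[i][0] := max (-e) (min e s[i][0])` for all `i < b`. -/
def clipFill (a s : ℕ) (b : IdxExpr) (e : RealExpr) : Prog :=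
  .forLoop 2 b (clipEntry a s e)

lemma clipFill_spec {a s : ℕ} (has : s ≠ a) {b : IdxExpr} {e : RealExpr} {m : Memory} {N : ℕ}
    {h : ℝ} (hb : b.eval m = N) (he : ∀ m', Memory.Frame a m m' → e.eval m' = h) :
    Memory.Frame a m ((clipFill a s b e).run m).1 ∧
    ∀ i < N, ((clipFill a s b e).run m).1.arr a i 0 = max (-h) (min h (m.arr s i 0)) := by
  have key := Prog.forLoop_forall 2 b (clipEntry a s e) m (fun r => Memory.Frame a m r)
    (fun i r => r.arr a i 0 = max (-h) (min h (m.arr s i 0))) (Memory.Frame.refl a m) ?_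
  · rw [hb] at key; exact key
  · intro k hk r hr
    have hF := hr.setIdx (v := 2) (by omega) k
    have e1 := he _ hF
    have e2 := hF.arr s has
    have hrun : ((clipEntry a s e).run (r.setIdx 2 k)).1 =
        (r.setIdx 2 k).setCell a k 0 (max (-h) (min h (m.arr s k 0))) := by
      have e3 : (r.setIdx 2 k).idx 2 = k := by simp
      simp only [clipEntry, Prog.run, RealExpr.eval, IdxExpr.eval, e1, e2, e3, Int.cast_zero,
        zero_sub]
      split_ifs with c1 c2 c3
      · rw [min_eq_right c1, max_eq_right c2]
      · rw [min_eq_right c1, max_eq_left (not_le.1 c2).le]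
      · rw [min_eq_left (not_le.1 c1).le, max_eq_right c3]
      · rw [min_eq_left (not_le.1 c1).le, max_eq_left (not_le.1 c3).le]
    rw [hrun]
    refine ⟨hF.setCell _ _ _, by simp [Memory.setCell_arr], fun k' hk' hq => ?_⟩
    rw [Memory.setCell_arr, if_neg fun hc => hk'.ne hc.1]
    exact hq

/-! ### Inversion of a positive definite matrix by elimination without pivoting -/

section Elimination

variable {n : ℕ}

/-- One elimination step at the pivot `k` of `W`, applied to the rows of `V`: the pivot row is
divided by the pivot, and its multiples are subtracted from the other rows. -/
noncomputable def eliminate (W V : Matrix (Fin n) (Fin n) ℝ) (k : Fin n) :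
    Matrix (Fin n) (Fin n) ℝ :=
  fun i j => V i j - (W i k - (1 : Matrix (Fin n) (Fin n) ℝ) i k) * (V k j / W k k)

/-- The invariant of the elimination after `k` steps: `W = V P`, the first `k` columns of `W` and
the other columns of `V` are those of the identity matrix. -/
structure EliminationState (P : Matrix (Fin n) (Fin n) ℝ) (k : ℕ)
    (W V : Matrix (Fin n) (Fin n) ℝ) : Prop where
  eq_mul : W = V * P
  left : ∀ i j : Fin n, (j : ℕ) < k → W i j = (1 : Matrix (Fin n) (Fin n) ℝ) i j
  right : ∀ i j : Fin n, k ≤ (j : ℕ) → V i j = (1 : Matrix (Fin n) (Fin n) ℝ) i j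

variable {P W V : Matrix (Fin n) (Fin n) ℝ}

lemma eliminationState_zero (P : Matrix (Fin n) (Fin n) ℝ) : EliminationState P 0 P 1 :=
  ⟨(one_mul P).symm, fun _ _ h => absurd h (Nat.not_lt_zero _), fun _ _ _ => rfl⟩

/-- The pivot is the value of the quadratic form of `P` at the nonzero row `k` of `V`. -/
lemma EliminationState.pivot_pos (hP : P.PosDef) {k : Fin n} (h : EliminationState P k W V) :
    0 < W k k := by
  have hv : V k ≠ 0 := by
    intro hc
    have h1 := h.right k k le_rfl
    rw [hc, one_apply_eq] at h1
    exact zero_ne_one h1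
  have hpos := hP.dotProduct_mulVec_pos hv
  have hPs : P.IsSymm := by simpa [IsSymm, IsHermitian] using hP.isHermitian
  have hW : P *ᵥ V k = W k := by
    rw [h.eq_mul, mul_apply_eq_vecMul, ← mulVec_transpose, hPs.eq]
  rw [star_trivial, hW, dotProduct, Finset.sum_eq_single k] at hpos
  · rwa [h.right k k le_rfl, one_apply_eq, one_mul] at hpos
  · intro j _ hj
    rcases lt_or_gt_of_ne hj with hlt | hgt
    · rw [h.left k j hlt, one_apply_ne hj.symm, mul_zero]
    · rw [h.right k j (le_of_lt hgt), one_apply_ne hj.symm, zero_mul]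
  · exact fun hc => absurd (Finset.mem_univ k) hc

lemma EliminationState.succ (hP : P.PosDef) {k : Fin n} (h : EliminationState P k W V) :
    EliminationState P (k + 1) (eliminate W W k) (eliminate W V k) := by
  have hpiv := (h.pivot_pos hP).ne'
  refine ⟨?_, fun i j hj => ?_, fun i j hj => ?_⟩
  · ext i j
    have hW : ∀ i, W i j = ∑ l, V i l * P l j := fun i => by
      conv_lhs => rw [h.eq_mul]
      rw [mul_apply]
    rw [mul_apply]
    simp only [eliminate, sub_mul, Finset.sum_sub_distrib]
    rw [← hW i, hW k]
    congr 1
    simp only [Finset.sum_div, Finset.mul_sum, ← Finset.sum_sub_distrib]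
    exact Finset.sum_congr rfl fun l _ => by ring
  · rcases Nat.lt_succ_iff_lt_or_eq.1 hj with hlt | heq
    · have hne : k ≠ j := fun hc => by rw [hc] at hlt; exact lt_irrefl _ hlt
      rw [eliminate, h.left k j hlt, one_apply_ne hne, zero_div, mul_zero, sub_zero, h.left i j hlt]
    · obtain rfl : j = k := Fin.ext heq
      rw [eliminate, div_self hpiv, mul_one, sub_sub_cancel]
  · have hne : k ≠ j := fun hc => by rw [hc] at hj; omega
    rw [eliminate, h.right k j (by omega), one_apply_ne hne, zero_div, mul_zero, sub_zero,
      h.right i j (by omega)]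

lemma EliminationState.eq_inv (h : EliminationState P n W V) : V = P⁻¹ := by
  have hW : W = 1 := by
    ext i j
    exact h.left i j j.2
  exact (inv_eq_left_inv (h.eq_mul.symm.trans hW)).symm

end Elimination

/-! ### The program for one iteration -/

namespace Memory

/-- The input sizes and the arrays below `a` are the same in `m` and `m'`. -/
structure Keeps (a : ℕ) (m m' : Memory) : Prop where
  idx : ∀ v < 2, m'.idx v = m.idx v
  arr : ∀ a' < a, m'.arr a' = m.arr a'

lemma Frame.keeps {a : ℕ} {m m' : Memory} (h : Frame a m m') : Keeps a m m' :=
  ⟨fun v hv => h.idx v (Or.inl hv), fun a' ha' => h.arr a' ha'.ne⟩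

lemma Keeps.refl (a : ℕ) (m : Memory) : Keeps a m m := ⟨fun _ _ => rfl, fun _ _ => rfl⟩

lemma Keeps.mono {a b : ℕ} {m m' : Memory} (h : Keeps a m m') (hb : b ≤ a) : Keeps b m m' :=
  ⟨h.idx, fun a' ha' => h.arr a' (ha'.trans_le hb)⟩

lemma Keeps.trans {a : ℕ} {m₁ m₂ m₃ : Memory} (h : Keeps a m₁ m₂) (h' : Keeps a m₂ m₃) :
    Keeps a m₁ m₃ :=
  ⟨fun v hv => (h'.idx v hv).trans (h.idx v hv), fun a' ha' => (h'.arr a' ha').trans (h.arr a' ha')⟩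

/-- The array `a` holds the matrix `F`. -/
def Holds (m : Memory) (a : ℕ) {p q : ℕ} (F : Matrix (Fin p) (Fin q) ℝ) : Prop :=
  ∀ (i : Fin p) (j : Fin q), m.arr a i j = F i j

/-- The first column of the array `a` holds the vector `v`. -/
def HoldsVec (m : Memory) (a : ℕ) {p : ℕ} (v : Fin p → ℝ) : Prop :=
  ∀ i : Fin p, m.arr a i 0 = v i

variable {m m' : Memory} {a b p q : ℕ}

lemma Keeps.holds (h : Keeps a m m') (hb : b < a) {F : Matrix (Fin p) (Fin q) ℝ}
    (hF : m.Holds b F) : m'.Holds b F := fun i j => by rw [h.arr b hb]; exact hF i j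

lemma Keeps.holdsVec (h : Keeps a m m') (hb : b < a) {v : Fin p → ℝ} (hv : m.HoldsVec b v) :
    m'.HoldsVec b v := fun i => by rw [h.arr b hb]; exact hv i

end Memory

open Memory

/-- `a[i][j] := e` for all `i < b₁`, `j < b₂`. -/
def fill (a : ℕ) (b₁ b₂ : IdxExpr) (e : RealExpr) : Prog := sumFill a b₁ b₂ (.const 1) e

/-- `a[i][0] := ∑ k < b₃, e` for all `i < b₁`. -/
def sumVec (a : ℕ) (b₁ b₃ : IdxExpr) (e : RealExpr) : Prog := sumFill a b₁ (.const 1) b₃ e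

lemma fill_spec {a v₁ v₂ : ℕ} {e : RealExpr} {m : Memory} {N₁ N₂ : ℕ}
    (F : Matrix (Fin N₁) (Fin N₂) ℝ) (hb₁ : m.idx v₁ = N₁) (h₂ : v₂ < 2)
    (hb₂ : m.idx v₂ = N₂)
    (he : ∀ (i : Fin N₁) (j : Fin N₂), ∀ m', Frame a m m' → m'.idx 2 = i → m'.idx 3 = j →
      e.eval m' = F i j) :
    Frame a m ((fill a (.var v₁) (.var v₂) e).run m).1 ∧
      ((fill a (.var v₁) (.var v₂) e).run m).1.Holds a F := by
  have h := sumFill_spec (a := a) (b₁ := .var v₁) (b₂ := .var v₂) (b₃ := .const 1) (e := e)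
    (m := m) (fun i j (_ : Fin 1) => F i j) hb₁
    (fun m' hm' => (hm'.idx v₂ (Or.inl h₂)).trans hb₂) (fun _ _ => rfl)
    (fun i j _ m' hm' e2 e3 _ => he i j m' hm' e2 e3)
  exact ⟨h.1, fun i j => (h.2 i j).trans (by simp)⟩

lemma sumVec_spec {a : ℕ} {b₁ b₃ : IdxExpr} {e : RealExpr} {m : Memory} {N₁ N₃ : ℕ}
    (f : Fin N₁ → Fin N₃ → ℝ) (hb₁ : b₁.eval m = N₁)
    (hb₃ : ∀ m', Frame a m m' → b₃.eval m' = N₃)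
    (he : ∀ (i : Fin N₁) (k : Fin N₃), ∀ m', Frame a m m' → m'.idx 2 = i → m'.idx 4 = k →
      e.eval m' = f i k) :
    Frame a m ((sumVec a b₁ b₃ e).run m).1 ∧
      ((sumVec a b₁ b₃ e).run m).1.HoldsVec a (fun i => ∑ k, f i k) := by
  have h := sumFill_spec (a := a) (b₁ := b₁) (b₂ := .const 1) (b₃ := b₃) (e := e)
    (m := m) (fun i (_ : Fin 1) k => f i k) hb₁ (fun _ _ => rfl) hb₃
    (fun i _ k m' hm' e2 _ e4 => he i k m' hm' e2 e4)
  exact ⟨h.1, fun i => h.2 i 0⟩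

/-- One elimination step, with the identity in the array 8, `W` and `V` in the arrays 9 and 10, and
the pivot position in the index variable 5. The results are collected in the arrays 11 and 12 before
they replace `W` and `V`, since every entry is computed from the old pivot row and column. -/
def elimStep : Prog :=
  .seq (fill 11 (.var 0) (.var 0) (.sub (.cell 9 (.var 2) (.var 3))
      (.mul (.sub (.cell 9 (.var 2) (.var 5)) (.cell 8 (.var 2) (.var 5)))
        (.div (.cell 9 (.var 5) (.var 3)) (.cell 9 (.var 5) (.var 5))))))
  (.seq (fill 12 (.var 0) (.var 0) (.sub (.cell 10 (.var 2) (.var 3))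
      (.mul (.sub (.cell 9 (.var 2) (.var 5)) (.cell 8 (.var 2) (.var 5)))
        (.div (.cell 10 (.var 5) (.var 3)) (.cell 9 (.var 5) (.var 5))))))
  (.seq (fill 9 (.var 0) (.var 0) (.cell 11 (.var 2) (.var 3)))
    (fill 10 (.var 0) (.var 0) (.cell 12 (.var 2) (.var 3)))))

lemma elimStep_spec {n : ℕ} {m : Memory} {W V : Matrix (Fin n) (Fin n) ℝ} (k : Fin n)
    (h0 : m.idx 0 = n) (h5 : m.idx 5 = k) (hI : m.Holds 8 (1 : Matrix (Fin n) (Fin n) ℝ))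
    (hW : m.Holds 9 W) (hV : m.Holds 10 V) :
    Keeps 9 m (elimStep.run m).1 ∧ (elimStep.run m).1.Holds 9 (eliminate W W k) ∧
      (elimStep.run m).1.Holds 10 (eliminate W V k) := by
  simp only [elimStep, Prog.run]
  generalize hm₁ : ((fill 11 _ _ _).run m).1 = m₁
  have s₁ := fill_spec (a := 11) (m := m) (e := .sub (.cell 9 (.var 2) (.var 3))
      (.mul (.sub (.cell 9 (.var 2) (.var 5)) (.cell 8 (.var 2) (.var 5)))
        (.div (.cell 9 (.var 5) (.var 3)) (.cell 9 (.var 5) (.var 5)))))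
    (eliminate W W k) h0 (by norm_num) h0 (by
      intro i j m' hm' e2 e3
      simp only [RealExpr.eval, IdxExpr.eval, e2, e3, hm'.idx 5 (by norm_num), h5,
        hm'.arr 8 (by norm_num), hm'.arr 9 (by norm_num), hI _ _, hW _ _]
      rfl)
  rw [hm₁] at s₁
  obtain ⟨f₁, r₁⟩ := s₁
  have a0 : m₁.idx 0 = n := (f₁.idx 0 (by norm_num)).trans h0
  have a5 : m₁.idx 5 = k := (f₁.idx 5 (by norm_num)).trans h5
  have aI := f₁.keeps.holds (by norm_num) hI
  have aW := f₁.keeps.holds (by norm_num) hW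
  have aV := f₁.keeps.holds (by norm_num) hV
  generalize hm₂ : ((fill 12 _ _ _).run m₁).1 = m₂
  have s₂ := fill_spec (a := 12) (m := m₁) (e := .sub (.cell 10 (.var 2) (.var 3))
      (.mul (.sub (.cell 9 (.var 2) (.var 5)) (.cell 8 (.var 2) (.var 5)))
        (.div (.cell 10 (.var 5) (.var 3)) (.cell 9 (.var 5) (.var 5)))))
    (eliminate W V k) a0 (by norm_num) a0 (by
      intro i j m' hm' e2 e3
      simp only [RealExpr.eval, IdxExpr.eval, e2, e3, hm'.idx 5 (by norm_num), a5,
        hm'.arr 8 (by norm_num), hm'.arr 9 (by norm_num), hm'.arr 10 (by norm_num), aI _ _, aW _ _,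
        aV _ _]
      rfl)
  rw [hm₂] at s₂
  obtain ⟨f₂, r₂⟩ := s₂
  have b0 : m₂.idx 0 = n := (f₂.idx 0 (by norm_num)).trans a0
  have b11 := f₂.keeps.holds (by norm_num) r₁
  generalize hm₃ : ((fill 9 _ _ _).run m₂).1 = m₃
  have s₃ := fill_spec (a := 9) (m := m₂) (e := .cell 11 (.var 2) (.var 3))
    (eliminate W W k) b0 (by norm_num) b0 (by
      intro i j m' hm' e2 e3
      simp only [RealExpr.eval, IdxExpr.eval, e2, e3, hm'.arr 11 (by norm_num), b11 _ _])
  rw [hm₃] at s₃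
  obtain ⟨f₃, r₃⟩ := s₃
  have c0 : m₃.idx 0 = n := (f₃.idx 0 (by norm_num)).trans b0
  have c12 : m₃.Holds 12 (eliminate W V k) := fun i j => by rw [f₃.arr 12 (by norm_num)]; exact r₂ i j
  have s₄ := fill_spec (a := 10) (m := m₃) (e := .cell 12 (.var 2) (.var 3))
    (eliminate W V k) c0 (by norm_num) c0 (by
      intro i j m' hm' e2 e3
      simp only [RealExpr.eval, IdxExpr.eval, e2, e3, hm'.arr 12 (by norm_num), c12 _ _])
  obtain ⟨f₄, r₄⟩ := s₄
  exact ⟨(f₁.keeps.mono (by norm_num)).trans ((f₂.keeps.mono (by norm_num)).trans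
    (f₃.keeps.trans (f₄.keeps.mono (by norm_num)))), f₄.keeps.holds (by norm_num) r₃, r₄⟩

/-- Inversion of the matrix in the array 9, given the identity in the arrays 8 and 10; the inverse
is left in the array 10. -/
def invert : Prog := .forLoop 5 (.var 0) elimStep

lemma invert_spec {n : ℕ} {m : Memory} {P : Matrix (Fin n) (Fin n) ℝ} (hP : P.PosDef)
    (h0 : m.idx 0 = n) (hI : m.Holds 8 (1 : Matrix (Fin n) (Fin n) ℝ)) (hW : m.Holds 9 P)
    (hV : m.Holds 10 (1 : Matrix (Fin n) (Fin n) ℝ)) :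
    Keeps 9 m (invert.run m).1 ∧ (invert.run m).1.Holds 10 P⁻¹ := by
  have key := Prog.forLoop_invariant 5 (.var 0) elimStep m (fun k r => Keeps 9 m r.1 ∧
      ∃ W V : Matrix (Fin n) (Fin n) ℝ, r.1.Holds 9 W ∧ r.1.Holds 10 V ∧ EliminationState P k W V)
    ⟨Keeps.refl 9 m, P, 1, hW, hV, eliminationState_zero P⟩ ?_
  · change Keeps 9 m (invert.run m).1 ∧ _ at key
    obtain ⟨h1, W, V, -, h3, h4⟩ := key
    refine ⟨h1, ?_⟩
    change EliminationState P (m.idx 0) W V at h4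
    rw [h0] at h4
    rw [← h4.eq_inv]
    exact h3
  · rintro k hk r ⟨h1, W, V, h2, h3, h4⟩
    change k < m.idx 0 at hk
    rw [h0] at hk
    have e0 : (r.1.setIdx 5 k).idx 0 = n := by
      simpa using (h1.idx 0 (by norm_num)).trans h0
    have h8 := h1.holds (show 8 < 9 by norm_num) hI
    have s := elimStep_spec (m := r.1.setIdx 5 k) (W := W) (V := V) ⟨k, hk⟩ e0 (by simp) h8 h2 h3
    have hk5 : Keeps 9 r.1 (r.1.setIdx 5 k) :=
      ⟨fun v hv => by simp only [setIdx_idx]; rw [if_neg (by omega)], fun _ _ => rfl⟩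
    exact ⟨h1.trans (hk5.trans s.1), _, _, s.2.1, s.2.2,
      EliminationState.succ hP (k := ⟨k, hk⟩) h4⟩

/-- `a[i][0] := e` for all `i < b`. -/
def vecFill (a : ℕ) (b : IdxExpr) (e : RealExpr) : Prog := sumVec a b (.const 1) e

lemma vecFill_spec {a : ℕ} {b : IdxExpr} {e : RealExpr} {m : Memory} {N : ℕ}
    (f : Fin N → ℝ) (hb : b.eval m = N)
    (he : ∀ i : Fin N, ∀ m', Frame a m m' → m'.idx 2 = i → e.eval m' = f i) :
    Frame a m ((vecFill a b e).run m).1 ∧ ((vecFill a b e).run m).1.HoldsVec a f := by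
  have h := sumVec_spec (a := a) (b₁ := b) (b₃ := .const 1) (e := e) (m := m)
    (fun i (_ : Fin 1) => f i) hb (fun _ _ => rfl) (fun i _ m' hm' e2 _ => he i m' hm' e2)
  exact ⟨h.1, fun i => (h.2 i).trans (by simp)⟩

section Iteration

variable {n d : ℕ} {M : Design n d} {Θ B η : ℝ} {y : Fin n → ℝ} {w : Param d} {m m' : Memory}

/-- The input of one iteration is stored in the arrays `0` to `7`. -/
structure Loaded (M : Design n d) (Θ B η : ℝ) (y : Fin n → ℝ) (w : Param d) (m : Memory) :
    Prop where
  idx_zero : m.idx 0 = n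
  idx_one : m.idx 1 = d
  A : m.Holds 0 M.A
  X : m.Holds 1 M.X
  D : m.HoldsVec 2 M.D
  y : m.HoldsVec 3 y
  step : m.arr 4 0 0 = η
  width_theta : m.arr 4 1 0 = Θ
  width_beta : m.arr 4 2 0 = B
  theta : m.HoldsVec 5 w.theta
  beta : m.arr 6 0 0 = w.beta
  kappa : m.HoldsVec 7 w.kappa

lemma padVec_coe {N : ℕ} (v : Fin N → ℝ) (i : Fin N) : padVec v i = v i := by
  simp [padVec]

lemma loaded_loadInput (M : Design n d) (Θ B η : ℝ) (y : Fin n → ℝ) (w : Param d) :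
    Loaded M Θ B η y w (loadInput M Θ B η y w) where
  idx_zero := rfl
  idx_one := rfl
  A i j := by simp [loadInput, padVec_coe]
  X i j := by simp [loadInput, padVec_coe]
  D i := by simp [loadInput, padVec_coe]
  y i := by simp [loadInput, padVec_coe]
  step := by simp [loadInput, padVec]
  width_theta := by simp [loadInput, padVec]
  width_beta := by simp [loadInput, padVec]
  theta i := by simp [loadInput, padVec_coe]
  beta := by simp [loadInput]
  kappa i := by simp [loadInput, padVec_coe]

lemma Loaded.keeps (h : Loaded M Θ B η y w m) {a : ℕ} (ha : 8 ≤ a) (hk : Keeps a m m') :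
    Loaded M Θ B η y w m' where
  idx_zero := (hk.idx 0 (by norm_num)).trans h.idx_zero
  idx_one := (hk.idx 1 (by norm_num)).trans h.idx_one
  A := hk.holds (by omega) h.A
  X := hk.holds (by omega) h.X
  D := hk.holdsVec (by omega) h.D
  y := hk.holdsVec (by omega) h.y
  step := by rw [hk.arr 4 (by omega)]; exact h.step
  width_theta := by rw [hk.arr 4 (by omega)]; exact h.width_theta
  width_beta := by rw [hk.arr 4 (by omega)]; exact h.width_beta
  theta := hk.holdsVec (by omega) h.theta
  beta := by rw [hk.arr 6 (by omega)]; exact h.beta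
  kappa := hk.holdsVec (by omega) h.kappa

/-- The covariance matrix `(β A + D)⁻¹`, left in the array 10. -/
def covarianceProg : Prog :=
  .seq (diagFill 8 (.var 0))
  (.seq (fill 9 (.var 0) (.var 0) (.add
      (.mul (.cell 6 (.const 0) (.const 0)) (.cell 0 (.var 2) (.var 3)))
      (.mul (.cell 8 (.var 2) (.var 3)) (.cell 2 (.var 2) (.const 0)))))
  (.seq (fill 10 (.var 0) (.var 0) (.cell 8 (.var 2) (.var 3))) invert))

lemma covarianceProg_spec (h : Loaded M Θ B η y w m) (h8 : ∀ i j, m.arr 8 i j = 0)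
    (hw : w ∈ M.paramDomain) :
    Keeps 8 m (covarianceProg.run m).1 ∧
      (covarianceProg.run m).1.Holds 10 (M.precision w.beta)⁻¹ := by
  simp only [covarianceProg, Prog.run]
  obtain ⟨f₁, r₁, r₁'⟩ := diagFill_spec 8 (b := .var 0) (m := m) h.idx_zero
  generalize ((diagFill 8 _).run m).1 = m₁ at *
  have l₁ := h.keeps le_rfl f₁.keeps
  have i₁ : m₁.Holds 8 (1 : Matrix (Fin n) (Fin n) ℝ) := by
    intro i j
    by_cases hij : i = j
    · rw [hij, one_apply_eq]; exact r₁ j j.2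
    · rw [one_apply_ne hij, r₁' _ _ (fun hc => hij (Fin.ext hc)), h8]
  obtain ⟨f₂, r₂⟩ := fill_spec (a := 9) (v₁ := 0) (v₂ := 0) (m := m₁) (e := .add
      (.mul (.cell 6 (.const 0) (.const 0)) (.cell 0 (.var 2) (.var 3)))
      (.mul (.cell 8 (.var 2) (.var 3)) (.cell 2 (.var 2) (.const 0))))
    (M.precision w.beta) l₁.idx_zero (by norm_num) l₁.idx_zero (by
      intro i j m' hm' e2 e3
      have l := l₁.keeps (by norm_num) hm'.keeps
      simp only [RealExpr.eval, IdxExpr.eval, e2, e3, l.beta, l.A _ _, l.D _,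
        (hm'.keeps.holds (by norm_num) i₁) _ _]
      rw [Design.precision, Matrix.add_apply, Matrix.smul_apply, diagonal_apply, one_apply, smul_eq_mul]
      split_ifs <;> simp)
  generalize ((fill 9 _ _ _).run m₁).1 = m₂ at *
  have l₂ := l₁.keeps (by norm_num) f₂.keeps
  have i₂ := f₂.keeps.holds (by norm_num) i₁
  obtain ⟨f₃, r₃⟩ := fill_spec (a := 10) (v₁ := 0) (v₂ := 0) (m := m₂)
    (e := .cell 8 (.var 2) (.var 3))
    (1 : Matrix (Fin n) (Fin n) ℝ) l₂.idx_zero (by norm_num) l₂.idx_zero (by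
      intro i j m' hm' e2 e3
      simp only [RealExpr.eval, IdxExpr.eval, e2, e3, (hm'.keeps.holds (by norm_num) i₂) _ _])
  generalize ((fill 10 _ _ _).run m₂).1 = m₃ at *
  have l₃ := l₂.keeps (by norm_num) f₃.keeps
  obtain ⟨f₄, r₄⟩ := invert_spec hw l₃.idx_zero (f₃.keeps.holds (by norm_num) i₂)
    (f₃.keeps.holds (by norm_num) r₂) r₃
  exact ⟨f₁.keeps.trans ((f₂.keeps.mono (by norm_num)).trans
    ((f₃.keeps.mono (by norm_num)).trans (f₄.mono (by norm_num)))), r₄⟩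

/-- The matrix `A X` and the mean vector of the model, left in the arrays 13 and 15. -/
def meanProg : Prog :=
  .seq (sumFill 13 (.var 0) (.var 1) (.var 0)
      (.mul (.cell 0 (.var 2) (.var 4)) (.cell 1 (.var 4) (.var 3))))
  (.seq (sumVec 14 (.var 0) (.var 1) (.add
      (.mul (.cell 13 (.var 2) (.var 4)) (.cell 7 (.var 4) (.const 0)))
      (.mul (.cell 2 (.var 2) (.const 0))
        (.mul (.cell 1 (.var 2) (.var 4)) (.cell 5 (.var 4) (.const 0))))))
    (sumVec 15 (.var 0) (.var 0)
      (.mul (.cell 10 (.var 2) (.var 4)) (.cell 14 (.var 4) (.const 0)))))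

lemma meanProg_spec (h : Loaded M Θ B η y w m) (hV : m.Holds 10 (M.precision w.beta)⁻¹) :
    Keeps 13 m (meanProg.run m).1 ∧ (meanProg.run m).1.Holds 13 (M.A * M.X) ∧
      (meanProg.run m).1.HoldsVec 15 (M.meanVec w) := by
  simp only [meanProg, Prog.run]
  obtain ⟨f₁, r₁⟩ := sumFill_spec (a := 13) (b₁ := .var 0) (b₂ := .var 1) (b₃ := .var 0) (m := m)
    (e := .mul (.cell 0 (.var 2) (.var 4)) (.cell 1 (.var 4) (.var 3)))
    (fun i k j => M.A i j * M.X j k) h.idx_zero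
    (fun m' hm' => (h.keeps (by norm_num) hm'.keeps).idx_one)
    (fun m' hm' => (h.keeps (by norm_num) hm'.keeps).idx_zero) (by
      intro i j k m' hm' e2 e3 e4
      have l := h.keeps (by norm_num) hm'.keeps
      simp only [RealExpr.eval, IdxExpr.eval, e2, e3, e4, l.A _ _, l.X _ _])
  generalize ((sumFill 13 _ _ _ _).run m).1 = m₁ at *
  have l₁ := h.keeps (by norm_num) f₁.keeps
  have hV₁ := f₁.keeps.holds (by norm_num) hV
  have hAX : m₁.Holds 13 (M.A * M.X) := r₁
  obtain ⟨f₂, r₂⟩ := sumVec_spec (a := 14) (b₁ := .var 0) (b₃ := .var 1) (m := m₁) (e := .add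
      (.mul (.cell 13 (.var 2) (.var 4)) (.cell 7 (.var 4) (.const 0)))
      (.mul (.cell 2 (.var 2) (.const 0))
        (.mul (.cell 1 (.var 2) (.var 4)) (.cell 5 (.var 4) (.const 0)))))
    (fun i k => (M.A * M.X) i k * w.kappa k + M.D i * (M.X i k * w.theta k)) l₁.idx_zero
    (fun m' hm' => (l₁.keeps (by norm_num) hm'.keeps).idx_one) (by
      intro i k m' hm' e2 e4
      have l := l₁.keeps (by norm_num) hm'.keeps
      simp only [RealExpr.eval, IdxExpr.eval, e2, e4, l.D _, l.X _ _, l.theta _, l.kappa _,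
        (hm'.keeps.holds (by norm_num) hAX) _ _])
  generalize ((sumVec 14 _ _ _).run m₁).1 = m₂ at *
  have l₂ := l₁.keeps (by norm_num) f₂.keeps
  have hV₂ := f₂.keeps.holds (by norm_num) hV₁
  have hlin : m₂.HoldsVec 14 (M.linTerm w) := by
    intro i
    refine (r₂ i).trans ?_
    beta_reduce
    rw [Finset.sum_add_distrib, ← Finset.mul_sum, Design.linTerm, mulVec_mulVec,
      Pi.add_apply, mulVec_diagonal]
    rfl
  obtain ⟨f₃, r₃⟩ := sumVec_spec (a := 15) (b₁ := .var 0) (b₃ := .var 0) (m := m₂)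
    (e := .mul (.cell 10 (.var 2) (.var 4)) (.cell 14 (.var 4) (.const 0)))
    (fun i j => (M.precision w.beta)⁻¹ i j * M.linTerm w j) l₂.idx_zero
    (fun m' hm' => (l₂.keeps (by norm_num) hm'.keeps).idx_zero) (by
      intro i k m' hm' e2 e4
      simp only [RealExpr.eval, IdxExpr.eval, e2, e4, (hm'.keeps.holds (by norm_num) hV₂) _ _,
        (hm'.keeps.holdsVec (by norm_num) hlin) _])
  exact ⟨f₁.keeps.trans ((f₂.keeps.mono (by norm_num)).trans (f₃.keeps.mono (by norm_num))),
    f₃.keeps.holds (by norm_num) (f₂.keeps.holds (by norm_num) hAX), r₃⟩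

/-- The number of observations in the array 16, and the components of the gradient, without the
factor `1/n`, in the arrays 19, 18, 20. -/
def gradientProg : Prog :=
  .seq (sumVec 16 (.const 1) (.var 0) (.const 1))
  (.seq (sumVec 17 (.var 0) (.var 0) (.sub (.sub
      (.mul (.cell 3 (.var 2) (.const 0))
        (.mul (.cell 0 (.var 2) (.var 4)) (.cell 3 (.var 4) (.const 0))))
      (.mul (.cell 10 (.var 2) (.var 4)) (.cell 0 (.var 4) (.var 2))))
      (.mul (.cell 15 (.var 2) (.const 0))
        (.mul (.cell 0 (.var 2) (.var 4)) (.cell 15 (.var 4) (.const 0))))))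
  (.seq (sumVec 18 (.const 1) (.var 0) (.div (.cell 17 (.var 4) (.const 0)) (.const 2)))
  (.seq (sumVec 19 (.var 1) (.var 0) (.mul (.cell 1 (.var 4) (.var 2))
      (.mul (.cell 2 (.var 4) (.const 0))
        (.sub (.cell 15 (.var 4) (.const 0)) (.cell 3 (.var 4) (.const 0))))))
    (sumVec 20 (.var 1) (.var 0) (.mul (.cell 13 (.var 4) (.var 2))
      (.sub (.cell 15 (.var 4) (.const 0)) (.cell 3 (.var 4) (.const 0))))))))

lemma gradientProg_spec (h : Loaded M Θ B η y w m) (hA : M.A.IsSymm)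
    (hV : m.Holds 10 (M.precision w.beta)⁻¹) (hAX : m.Holds 13 (M.A * M.X))
    (hμ : m.HoldsVec 15 (M.meanVec w)) :
    Keeps 16 m (gradientProg.run m).1 ∧
      (gradientProg.run m).1.arr 16 0 0 = n ∧
      (gradientProg.run m).1.HoldsVec 19 (M.Xᵀ *ᵥ (diagonal M.D *ᵥ (M.meanVec w - y))) ∧
      (gradientProg.run m).1.arr 18 0 0 = (1 / 2) * (y ⬝ᵥ (M.A *ᵥ y)
        - ((M.precision w.beta)⁻¹ * M.A).trace - M.meanVec w ⬝ᵥ (M.A *ᵥ M.meanVec w)) ∧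
      (gradientProg.run m).1.HoldsVec 20 (M.Xᵀ *ᵥ (M.A *ᵥ (M.meanVec w - y))) := by
  simp only [gradientProg, Prog.run]
  obtain ⟨f₁, r₁⟩ := sumVec_spec (a := 16) (b₁ := .const 1) (b₃ := .var 0) (m := m)
    (e := .const 1) (N₁ := 1) (fun _ (_ : Fin n) => (1 : ℝ)) rfl
    (fun m' hm' => (h.keeps (by norm_num) hm'.keeps).idx_zero) (by
      intro i k m' hm' e2 e4
      simp only [RealExpr.eval, Int.cast_one])
  generalize ((sumVec 16 _ _ _).run m).1 = m₁ at *
  have l₁ := h.keeps (by norm_num) f₁.keeps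
  have hV₁ := f₁.keeps.holds (by norm_num) hV
  have hAX₁ := f₁.keeps.holds (by norm_num) hAX
  have hμ₁ := f₁.keeps.holdsVec (by norm_num) hμ
  have hN : m₁.arr 16 0 0 = n := (r₁ 0).trans (by simp)
  obtain ⟨f₂, r₂⟩ := sumVec_spec (a := 17) (b₁ := .var 0) (b₃ := .var 0) (m := m₁)
    (e := .sub (.sub
      (.mul (.cell 3 (.var 2) (.const 0))
        (.mul (.cell 0 (.var 2) (.var 4)) (.cell 3 (.var 4) (.const 0))))
      (.mul (.cell 10 (.var 2) (.var 4)) (.cell 0 (.var 4) (.var 2))))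
      (.mul (.cell 15 (.var 2) (.const 0))
        (.mul (.cell 0 (.var 2) (.var 4)) (.cell 15 (.var 4) (.const 0)))))
    (fun i j => y i * (M.A i j * y j) - (M.precision w.beta)⁻¹ i j * M.A j i
      - M.meanVec w i * (M.A i j * M.meanVec w j)) l₁.idx_zero
    (fun m' hm' => (l₁.keeps (by norm_num) hm'.keeps).idx_zero) (by
      intro i k m' hm' e2 e4
      have l := l₁.keeps (by norm_num) hm'.keeps
      simp only [RealExpr.eval, IdxExpr.eval, e2, e4, l.A _ _, l.y _,
        (hm'.keeps.holds (by norm_num) hV₁) _ _, (hm'.keeps.holdsVec (by norm_num) hμ₁) _])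
  generalize ((sumVec 17 _ _ _).run m₁).1 = m₂ at *
  have l₂ := l₁.keeps (by norm_num) f₂.keeps
  have hAX₂ := f₂.keeps.holds (by norm_num) hAX₁
  have hμ₂ := f₂.keeps.holdsVec (by norm_num) hμ₁
  obtain ⟨f₃, r₃⟩ := sumVec_spec (a := 18) (b₁ := .const 1) (b₃ := .var 0) (m := m₂)
    (e := .div (.cell 17 (.var 4) (.const 0)) (.const 2)) (N₁ := 1)
    (fun _ (i : Fin n) => (∑ j, (y i * (M.A i j * y j) - (M.precision w.beta)⁻¹ i j * M.A j i
      - M.meanVec w i * (M.A i j * M.meanVec w j))) / 2) rfl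
    (fun m' hm' => (l₂.keeps (by norm_num) hm'.keeps).idx_zero) (by
      intro i k m' hm' e2 e4
      simp only [RealExpr.eval, IdxExpr.eval, e4, (hm'.keeps.holdsVec (by norm_num) r₂) _]
      norm_num)
  generalize ((sumVec 18 _ _ _).run m₂).1 = m₃ at *
  have l₃ := l₂.keeps (by norm_num) f₃.keeps
  have hAX₃ := f₃.keeps.holds (by norm_num) hAX₂
  have hμ₃ := f₃.keeps.holdsVec (by norm_num) hμ₂
  have hS : m₃.arr 18 0 0 = (1 / 2) * (y ⬝ᵥ (M.A *ᵥ y)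
      - ((M.precision w.beta)⁻¹ * M.A).trace - M.meanVec w ⬝ᵥ (M.A *ᵥ M.meanVec w)) := by
    refine (r₃ 0).trans ?_
    beta_reduce
    rw [← Finset.sum_div]
    simp only [dotProduct, mulVec, trace, diag_apply, mul_apply, Finset.mul_sum,
      Finset.sum_sub_distrib]
    ring
  obtain ⟨f₄, r₄⟩ := sumVec_spec (a := 19) (b₁ := .var 1) (b₃ := .var 0) (m := m₃)
    (e := .mul (.cell 1 (.var 4) (.var 2)) (.mul (.cell 2 (.var 4) (.const 0))
        (.sub (.cell 15 (.var 4) (.const 0)) (.cell 3 (.var 4) (.const 0)))))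
    (fun k i => M.X i k * (M.D i * (M.meanVec w i - y i))) l₃.idx_one
    (fun m' hm' => (l₃.keeps (by norm_num) hm'.keeps).idx_zero) (by
      intro i k m' hm' e2 e4
      have l := l₃.keeps (by norm_num) hm'.keeps
      simp only [RealExpr.eval, IdxExpr.eval, e2, e4, l.X _ _, l.D _, l.y _,
        (hm'.keeps.holdsVec (by norm_num) hμ₃) _])
  generalize ((sumVec 19 _ _ _).run m₃).1 = m₄ at *
  have l₄ := l₃.keeps (by norm_num) f₄.keeps
  have hAX₄ := f₄.keeps.holds (by norm_num) hAX₃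
  have hμ₄ := f₄.keeps.holdsVec (by norm_num) hμ₃
  obtain ⟨f₅, r₅⟩ := sumVec_spec (a := 20) (b₁ := .var 1) (b₃ := .var 0) (m := m₄)
    (e := .mul (.cell 13 (.var 4) (.var 2))
      (.sub (.cell 15 (.var 4) (.const 0)) (.cell 3 (.var 4) (.const 0))))
    (fun k i => (M.A * M.X) i k * (M.meanVec w i - y i)) l₄.idx_one
    (fun m' hm' => (l₄.keeps (by norm_num) hm'.keeps).idx_zero) (by
      intro i k m' hm' e2 e4
      have l := l₄.keeps (by norm_num) hm'.keeps
      simp only [RealExpr.eval, IdxExpr.eval, e2, e4, l.y _,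
        (hm'.keeps.holds (by norm_num) hAX₄) _ _, (hm'.keeps.holdsVec (by norm_num) hμ₄) _])
  refine ⟨f₁.keeps.trans ((f₂.keeps.mono (by norm_num)).trans ((f₃.keeps.mono (by norm_num)).trans
    ((f₄.keeps.mono (by norm_num)).trans (f₅.keeps.mono (by norm_num))))), ?_, ?_, ?_, ?_⟩
  · rw [f₅.arr 16 (by norm_num), f₄.arr 16 (by norm_num), f₃.arr 16 (by norm_num),
      f₂.arr 16 (by norm_num), hN]
  · refine f₅.keeps.holdsVec (by norm_num) fun k => (r₄ k).trans ?_
    change _ = ∑ i, M.X i k * (diagonal M.D *ᵥ (M.meanVec w - y)) i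
    simp only [mulVec_diagonal, Pi.sub_apply]
  · rw [f₅.arr 18 (by norm_num), f₄.arr 18 (by norm_num), hS]
  · intro k
    have hT : M.Xᵀ * M.A = (M.A * M.X)ᵀ := by rw [transpose_mul, hA.eq]
    rw [r₅ k, mulVec_mulVec, hT]
    simp only [mulVec, dotProduct, transpose_apply, Pi.sub_apply]

/-- `a[i][0] := p[i][0] - η / n * g[i][0]` for all `i < b`. -/
def stepFill (a p g : ℕ) (b : IdxExpr) : Prog :=
  vecFill a b (.sub (.cell p (.var 2) (.const 0)) (.mul (.cell 4 (.const 0) (.const 0))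
    (.mul (.div (.const 1) (.cell 16 (.const 0) (.const 0))) (.cell g (.var 2) (.const 0)))))

lemma stepFill_spec {a p g N : ℕ} {b : IdxExpr} {u v : Fin N → ℝ} (ha : 16 < a) (hp : p < a)
    (hg : g < a) (hb : b.eval m = N) (hη : m.arr 4 0 0 = η) (hn : m.arr 16 0 0 = n)
    (hu : m.HoldsVec p u) (hv : m.HoldsVec g v) :
    Frame a m ((stepFill a p g b).run m).1 ∧
      ((stepFill a p g b).run m).1.HoldsVec a (fun i => u i - η * (1 / (n : ℝ) * v i)) :=
  vecFill_spec _ hb (by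
    intro i m' hm' e2
    simp only [RealExpr.eval, IdxExpr.eval, e2, (hm'.keeps.holdsVec hp hu) _,
      (hm'.keeps.holdsVec hg hv) _, hm'.arr 4 (by omega), hm'.arr 16 (by omega), hη, hn,
      Int.cast_one])

/-- The gradient step, in the arrays 21, 22, 23, and its projection onto the box. -/
def updateProg : Prog :=
  .seq (stepFill 21 5 19 (.var 1))
  (.seq (stepFill 22 6 18 (.const 1))
  (.seq (stepFill 23 7 20 (.var 1))
  (.seq (clipFill 5 21 (.var 1) (.cell 4 (.const 1) (.const 0)))
  (.seq (clipFill 6 22 (.const 1) (.cell 4 (.const 2) (.const 0)))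
    (clipFill 7 23 (.var 1)
      (.mul (.cell 4 (.const 1) (.const 0)) (.cell 4 (.const 2) (.const 0))))))))

lemma updateProg_spec (h : Loaded M Θ B η y w m) (hn : m.arr 16 0 0 = n) {gθ gκ : Fin d → ℝ}
    {gβ : ℝ} (hθ : m.HoldsVec 19 gθ) (hβ : m.arr 18 0 0 = gβ) (hκ : m.HoldsVec 20 gκ) :
    readParam d (updateProg.run m).1 = projBox Θ B (w - η •
      Param.mk ((1 / (n : ℝ)) • gθ) ((1 / (n : ℝ)) * gβ) ((1 / (n : ℝ)) • gκ)) := by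
  simp only [updateProg, Prog.run]
  obtain ⟨f₁, r₁⟩ := stepFill_spec (a := 21) (by norm_num) (by norm_num) (by norm_num)
    (b := .var 1) h.idx_one h.step hn h.theta hθ
  generalize ((stepFill 21 _ _ _).run m).1 = m₁ at *
  have l₁ := h.keeps (by norm_num) f₁.keeps
  have hn₁ : m₁.arr 16 0 0 = n := by rw [f₁.arr 16 (by norm_num), hn]
  have hβ₁ : m₁.HoldsVec 18 (fun _ : Fin 1 => gβ) := fun i => by
    rw [f₁.arr 18 (by norm_num), Subsingleton.elim i 0]; exact hβ
  obtain ⟨f₂, r₂⟩ := stepFill_spec (a := 22) (p := 6) (by norm_num) (by norm_num) (by norm_num)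
    (b := .const 1) (u := fun _ : Fin 1 => w.beta) rfl l₁.step hn₁
    (fun i => by rw [Subsingleton.elim i 0]; exact l₁.beta) hβ₁
  generalize ((stepFill 22 _ _ _).run m₁).1 = m₂ at *
  have l₂ := l₁.keeps (by norm_num) f₂.keeps
  have hn₂ : m₂.arr 16 0 0 = n := by rw [f₂.arr 16 (by norm_num), hn₁]
  have hκ₂ := f₂.keeps.holdsVec (by norm_num) (f₁.keeps.holdsVec (by norm_num) hκ)
  obtain ⟨f₃, r₃⟩ := stepFill_spec (a := 23) (by norm_num) (by norm_num) (by norm_num)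
    (b := .var 1) l₂.idx_one l₂.step hn₂ l₂.kappa hκ₂
  generalize ((stepFill 23 _ _ _).run m₂).1 = m₃ at *
  have l₃ := l₂.keeps (by norm_num) f₃.keeps
  have s₁ := f₃.keeps.holdsVec (by norm_num) (f₂.keeps.holdsVec (by norm_num) r₁)
  have s₂ := f₃.keeps.holdsVec (by norm_num) r₂
  obtain ⟨f₄, r₄⟩ := clipFill_spec (a := 5) (s := 21) (by norm_num) (b := .var 1) (m := m₃)
    (e := .cell 4 (.const 1) (.const 0)) (h := Θ) l₃.idx_one (fun m' hm' => by
      simp only [RealExpr.eval, IdxExpr.eval]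
      rw [hm'.arr 4 (by norm_num), l₃.width_theta])
  generalize ((clipFill 5 _ _ _).run m₃).1 = m₄ at *
  obtain ⟨f₅, r₅⟩ := clipFill_spec (a := 6) (s := 22) (by norm_num) (b := .const 1) (m := m₄)
    (e := .cell 4 (.const 2) (.const 0)) (h := B) rfl (fun m' hm' => by
      simp only [RealExpr.eval, IdxExpr.eval]
      rw [hm'.arr 4 (by norm_num), f₄.arr 4 (by norm_num), l₃.width_beta])
  generalize ((clipFill 6 _ _ _).run m₄).1 = m₅ at *
  have i₅ : m₅.idx 1 = d := by
    rw [f₅.idx 1 (by norm_num), f₄.idx 1 (by norm_num), l₃.idx_one]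
  obtain ⟨f₆, r₆⟩ := clipFill_spec (a := 7) (s := 23) (by norm_num) (b := .var 1) (m := m₅)
    (e := .mul (.cell 4 (.const 1) (.const 0)) (.cell 4 (.const 2) (.const 0))) (h := Θ * B) i₅
    (fun m' hm' => by
      simp only [RealExpr.eval, IdxExpr.eval]
      rw [hm'.arr 4 (by norm_num), f₅.arr 4 (by norm_num), f₄.arr 4 (by norm_num),
        l₃.width_theta, l₃.width_beta])
  generalize ((clipFill 7 _ _ _).run m₅).1 = m₆ at *
  refine Param.ext ?_ ?_ ?_
  · funext k
    rw [readParam, Param.theta_mk, f₆.arr 5 (by norm_num), f₅.arr 5 (by norm_num), r₄ k k.2, s₁ k]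
    simp [projBox, halfWidth, Param.theta, Param.mk]
  · rw [readParam, Param.beta_mk, f₆.arr 6 (by norm_num), r₅ 0 Nat.one_pos,
      f₄.arr 22 (by norm_num)]
    have := s₂ 0
    rw [Fin.val_zero] at this
    rw [this]
    simp [projBox, halfWidth, Param.beta, Param.mk]
  · funext k
    rw [readParam, Param.kappa_mk, r₆ k k.2, f₅.arr 23 (by norm_num), f₄.arr 23 (by norm_num), r₃ k]
    simp [projBox, halfWidth, Param.kappa, Param.mk]

/-- One iteration of projected gradient descent. -/
def pgdProg : Prog := .seq covarianceProg (.seq meanProg (.seq gradientProg updateProg))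

lemma sizeBounded_pgdProg : pgdProg.SizeBounded := by
  simp [pgdProg, covarianceProg, meanProg, gradientProg, updateProg, stepFill, vecFill, fill,
    sumVec, sumFill, accumulate, diagFill, clipFill, clipEntry, invert, elimStep,
    Prog.SizeBounded, IdxExpr.IsSize]

lemma pgdProg_spec (hA : M.A.IsSymm) (hw : w ∈ M.paramDomain) :
    readParam d (pgdProg.run (loadInput M Θ B η y w)).1 = M.pgdStep Θ B η y w := by
  have l₀ := loaded_loadInput M Θ B η y w
  simp only [pgdProg, Prog.run]
  obtain ⟨f₁, r₁⟩ := covarianceProg_spec l₀ (fun _ _ => rfl) hw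
  generalize (covarianceProg.run (loadInput M Θ B η y w)).1 = m₁ at *
  have l₁ := l₀.keeps le_rfl f₁
  obtain ⟨f₂, r₂, r₂'⟩ := meanProg_spec l₁ r₁
  generalize (meanProg.run m₁).1 = m₂ at *
  have l₂ := l₁.keeps (by norm_num) f₂
  obtain ⟨f₃, s₁, s₂, s₃, s₄⟩ := gradientProg_spec l₂ hA (f₂.holds (by norm_num) r₁) r₂ r₂'
  rw [M.pgdStep_eq hA η y hw]
  exact updateProg_spec (l₂.keeps (by norm_num) f₃) s₁ s₂ s₃ s₄

end Iteration

/-- One program carries out an iteration in polynomial time, for all sizes of the input. -/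
theorem exists_prog_pgdStep : ∃ (P : Prog) (c k : ℕ), ∀ (n d : ℕ) (M : Design n d) (Θ B η : ℝ)
    (y : Fin n → ℝ) (w : Param d), M.A.IsSymm → w ∈ M.paramDomain →
      (P.run (loadInput M Θ B η y w)).2 ≤ c * (n + d + 1) ^ k ∧
      readParam d (P.run (loadInput M Θ B η y w)).1 = M.pgdStep Θ B η y w := by
  obtain ⟨c, k, h⟩ := sizeBounded_pgdProg.exists_cost_le
  exact ⟨pgdProg, c, k, fun n d M Θ B η y w hA hw =>
    ⟨(h (loadInput M Θ B η y w)).1, pgdProg_spec hA hw⟩⟩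

end DepLinReg

open DepLinReg
theorem theorem2 :
    -- statistical claim, for all values of the constants
    (∀ (d : ℕ) (Θ B a c qmin qmax ρmin ρmax ρDAX : ℝ),
      0 < Θ → 0 < B → 0 < a → 0 < c → 0 < qmin → 0 < qmax → 0 < ρmin → 0 < ρmax → 0 < ρDAX →
      -- consistency of the maximum likelihood estimate
      (∀ δ : ℝ, 0 < δ → ∃ C : ℝ, 0 < C ∧
        ∀ (θ₀ : Fin d → ℝ) (β₀ : ℝ),
          Param.mk θ₀ β₀ (β₀ • θ₀) ∈ interior (paramBox d Θ B) →
          ∃ n₀ : ℕ, ∀ n : ℕ, n₀ ≤ n → ∀ M : Design n d,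
            M.Admissible B a c qmin qmax ρmin ρmax ρDAX →
            M.responseLaw θ₀ β₀
              {y | ¬ ∃ w : Param d, M.IsTheMLE y w ∧
                ‖w - Param.mk θ₀ β₀ (β₀ • θ₀)‖ ≤ C / √(n : ℝ)} ≤ ENNReal.ofReal δ) ∧
      -- projected gradient descent approximates the estimate after `O(ln n)` iterations,
      -- with probability `1 - o(1)`
      (∃ η C K : ℝ, 0 < η ∧ 0 < C ∧ 0 < K ∧
        ∀ (θ₀ : Fin d → ℝ) (β₀ : ℝ),
          Param.mk θ₀ β₀ (β₀ • θ₀) ∈ interior (paramBox d Θ B) →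
          ∀ δ : ℝ, 0 < δ → ∃ n₀ : ℕ, ∀ n : ℕ, n₀ ≤ n → ∀ M : Design n d,
            M.Admissible B a c qmin qmax ρmin ρmax ρDAX →
            M.responseLaw θ₀ β₀
              {y | ¬ ∃ w : Param d, M.IsTheMLE y w ∧
                ∀ t : ℕ, K * Real.log n ≤ t →
                  ‖M.pgd Θ B η y t - w‖ ≤ C / √(n : ℝ)} ≤ ENNReal.ofReal δ)) ∧
    -- one iteration takes polynomially many steps, by one program for all sizes
    (∃ (P : Prog) (c k : ℕ), ∀ (n d : ℕ), 0 < n → ∀ (M : Design n d) (Θ B η : ℝ)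
        (y : Fin n → ℝ) (w : Param d), M.A.IsSymm → w ∈ M.paramDomain →
        (P.run (loadInput M Θ B η y w)).2 ≤ c * (n + d + 1) ^ k ∧
        readParam d (P.run (loadInput M Θ B η y w)).1 = M.pgdStep Θ B η y w) := by
  refine ⟨fun d Θ B a c qmin qmax ρmin ρmax ρDAX hΘ hB ha hc hq hq' hmin hmax hρ => ?_, ?_⟩
  · obtain ⟨m, L, hm, hL, hreg⟩ := Design.exists_regular (Θ := Θ) d hB ha hc hq hq' hmin hmax hρ
    refine ⟨fun δ hδ => ?_, ?_⟩
    · obtain ⟨C, hC, h⟩ := exists_estimate_bound d hΘ hB hm hL hδ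
      refine ⟨C, hC, fun θ₀ β₀ hw₀ => ?_⟩
      obtain ⟨n₀, hn₀, h⟩ := h θ₀ β₀ hw₀
      refine ⟨n₀, fun n hn M hM =>
        (measure_mono ?_).trans (h n hn M (hreg n (hn₀.trans_le hn) M hM))⟩
      exact fun y hy hc => hy (hc.imp fun w hw => ⟨hw.1, hw.2.1⟩)
    · obtain ⟨K, hK, hpow⟩ := exists_pow_le_inv_sqrt (Design.rate_nonneg m L)
        (Design.rate_lt_one hm hL)
      have hR : 0 ≤ boxRadius d Θ B := Real.sqrt_nonneg _
      refine ⟨m / L ^ 2, boxRadius d Θ B + 1, K, by positivity, by positivity, hK,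
        fun θ₀ β₀ hw₀ δ hδ => ?_⟩
      obtain ⟨C, -, h⟩ := exists_estimate_bound d hΘ hB hm hL hδ
      obtain ⟨n₀, hn₀, h⟩ := h θ₀ β₀ hw₀
      refine ⟨n₀, fun n hn M hM =>
        (measure_mono ?_).trans (h n hn M (hreg n (hn₀.trans_le hn) M hM))⟩
      refine fun y hy hc => hy (hc.imp fun w hw => ⟨hw.1, fun t ht => (hw.2.2 t).trans ?_⟩)
      rw [div_eq_mul_one_div, mul_comm]
      exact mul_le_mul (by linarith) (hpow n (hn₀.trans_le hn) t ht)
        (pow_nonneg (Design.rate_nonneg m L) t) (by linarith)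
  · obtain ⟨P, c, k, h⟩ := exists_prog_pgdStep
    exact ⟨P, c, k, fun n d _ => h n d⟩
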